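/- Conventions. A planar map is a finite connected graph properly embedded in the sphere (up to homeomorphism) with a distinguished oriented edge, the root; the face on its right is the root face, and its degree is the perimeter. A quadrangulation with a boundary is a planar map all of whose faces other than the root face have degree $4$; $F(\mathfrak q)$ is the set of these interior faces. A quadrangulation with holes is a planar map with some distinguished faces other than the root face, the holes, whose boundaries are simple and pairwise vertex-disjoint, all faces other than the root face and the holes having degree $4$; $F(\mathfrak q)$ denotes its set of interior faces that are not holes. $\mathcal Q_H$ is the set of quadrangulations with holes and $H(\mathfrak q)$ the set of holes of $\mathfrak q$; a fixed deterministic rule distinguishes on each hole of each $\mathfrak q\in\mathcal Q_H$ an oriented boundary edge (with the hole on its left). If $u_h\in\mathcal Q_H$ has perimeter $\deg h$ for each $h\in H(\mathfrak q)$, then $\mathfrak q\circledast(u_h)_{h\in H(\mathfrak q)}$ is the map obtained by gluing $u_h$ into $h$ for every hole $h$ (identify the root of $u_h$ with the distinguished edge of $h$, and then the remaining boundary edges in order). Write $\mathfrak q\subset\mathfrak m$ if $\mathfrak m=\mathfrak q\circledast(u_h)_h$ for some family $(u_h)_h$; this family is then unique and is denoted $(\mathfrak m^{\mathfrak q}_h)_h$.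 For $q>0$, a $q$-Boltzmann map of perimeter $2\ell$ is a random quadrangulation with a boundary of perimeter $2\ell$ whose law is proportional to $q^{|F(\cdot)|}$ (it is part of the assumption that the normalising constant is finite). A filtration on a probability space $(\Omega,\mathcal A,\mathbb P)$ is a family $(\mathcal F_{\mathfrak q})_{\mathfrak q\in\mathcal Q_H}$ of sub-$\sigma$-algebras of $\mathcal A$ with $\mathcal F_{\mathfrak q_1}\subseteq\mathcal F_{\mathfrak q_2}$ whenever $\mathfrak q_1\subset\mathfrak q_2$; it is complete if each $\mathcal F_{\mathfrak q}$ contains all events of probability zero. A $q$-Boltzmann map $\mathfrak Q$ is an $\mathcal F$-Boltzmann map if for every $\mathfrak q\in\mathcal Q_H$ the event $\{\mathfrak q\subset\mathfrak Q\}$ is in $\mathcal F_{\mathfrak q}$ and, conditionally on $\mathcal F_{\mathfrak q}$ and on $\{\mathfrak q\subset\mathfrak Q\}$, the maps $(\mathfrak Q^{\mathfrak q}_h)_{h\in H(\mathfrak q)}$ are independent $q$-Boltzmann maps of perimeters $\deg h$. A random $\mathsf Q\in\mathcal Q_H$ is an $\mathcal F$-stopping map for $\mathfrak Q$ if almost surely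 $\mathsf Q\subset\mathfrak Q$ and $\{\mathsf Q\subset\mathfrak q\}\in\mathcal F_{\mathfrak q}$ for all $\mathfrak q\in\mathcal Q_H$; then $\mathcal F_{\mathsf Q}$ is the $\sigma$-algebra of all $\Theta\in\bigvee_{\mathfrak q}\mathcal F_{\mathfrak q}$ with $\Theta\cap\{\mathsf Q\subset\mathfrak q\}\in\mathcal F_{\mathfrak q}$ for all $\mathfrak q\in\mathcal Q_H$. Decorated maps. A decoration of a map $\mathfrak q\in\mathcal Q_H$ is a function $\sigma:F(\mathfrak q)\to\mathbb R^k$. Let $\beta>0$ and let $\mu$ be a $\sigma$-finite measure on $\mathbb R^k$. For a quadrangulation with a boundary $\mathfrak q$ of perimeter $N$, a decoration $\sigma$, and a boundary condition $b:\{0,\dots,N-1\}\to\mathbb R^k$, let $\mathcal H^b(\mathfrak q,\sigma)=\frac\beta2\sum_e\|\sigma_{i}-\sigma_{j}\|^2$, where $e$ runs over all edges, $i$ and $j$ are the faces on the two sides of $e$, and on the side of the $m$-th boundary edge (following the root face from the root, $m=0,\dots,N-1$) that lies in the root face the value is $b_m$. The $q$-Boltzmann decorated map with perimeter $N$ and boundary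 condition $b$ is the random pair $(\mathfrak Q,\phi)$ with $$\mathbb P(\mathfrak Q=\mathfrak q,\ \phi\in d\sigma)=\frac1{W}\,q^{|F(\mathfrak q)|}e^{-\mathcal H^b(\mathfrak q,\sigma)}\prod_{f\in F(\mathfrak q)}\mu(d\sigma_f),\qquad W<\infty .$$ If $\mathfrak q\subset\mathfrak Q$, then $\phi|_{\mathfrak q}$ and $\phi^{\mathfrak q}_h$ are the restrictions of $\phi$ to the faces of $\mathfrak q$ and of $\mathfrak Q^{\mathfrak q}_h$, and $\phi|_h$ is the boundary condition on a hole $h$ given by the values (of $\phi|_{\mathfrak q}$, or of $b$ at the root face) on the other side of the edges of $h$. $(\mathfrak Q,\phi)$ is an $\mathcal F$-Boltzmann decorated map if for every $\mathfrak q\in\mathcal Q_H$ the event $\{\mathfrak q\subset\mathfrak Q\}$ and $\phi|_{\mathfrak q}\mathbf 1_{\{\mathfrak q\subset\mathfrak Q\}}$ are $\mathcal F_{\mathfrak q}$-measurable and, conditionally on $\mathcal F_{\mathfrak q}$ and $\{\mathfrak q\subset\mathfrak Q\}$, the pairs $(\mathfrak Q^{\mathfrak q}_h,\phi^{\mathfrak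 q}_h)_{h\in H(\mathfrak q)}$ are independent $q$-Boltzmann decorated maps with perimeters $\deg h$ and boundary conditions $\phi|_h$. Stopping maps are defined as before. Theorem. Let $q>0$ and $\ell\in\mathbb N^*$. (i) Let $(\mathcal F_{\mathfrak q})_{\mathfrak q\in\mathcal Q_H}$ be a filtration, $\mathfrak Q$ an $\mathcal F$-Boltzmann map with parameter $q$ and perimeter $2\ell$, and $\mathsf Q$ an $\mathcal F$-stopping map for $\mathfrak Q$. Then there are maps $(\mathfrak Q^{\mathsf Q}_h)_{h\in H(\mathsf Q)}$ such that (1) almost surely $\mathfrak Q=\mathsf Q\circledast(\mathfrak Q^{\mathsf Q}_h)_{h\in H(\mathsf Q)}$; (2) conditionally on $\mathsf Q$, the maps $(\mathfrak Q^{\mathsf Q}_h)_{h\in H(\mathsf Q)}$ are independent $q$-Boltzmann maps with perimeters $\deg h$. Moreover $\mathsf Q$ is $\mathcal F_{\mathsf Q}$-measurable, and (2) holds conditionally on $\mathcal F_{\mathsf Q}$ as well. (ii) Conversely, let $\mathfrak Q$ be a $q$-Boltzmann map with perimeter $2\ell$ and $\mathsf Q$ a random quadrangulation with holes on the same probability space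 such that (1) and (2) hold. Then there is a complete filtration $\mathcal F$ such that $\mathfrak Q$ is an $\mathcal F$-Boltzmann map and $\mathsf Q$ is an $\mathcal F$-stopping map for $\mathfrak Q$. (iii) The same holds with decorations: let $(\mathfrak Q,\phi)$ be a $q$-Boltzmann decorated map with perimeter $2\ell$ and boundary condition $b$, and let $\mathsf Q$ be a random quadrangulation with holes such that almost surely $\mathsf Q\subset\mathfrak Q$ and, conditionally on $\mathsf Q$ and $\phi|_{\mathsf Q}$, the pairs $(\mathfrak Q^{\mathsf Q}_h,\phi^{\mathsf Q}_h)_{h\in H(\mathsf Q)}$ are independent $q$-Boltzmann decorated maps with perimeters $\deg h$ and boundary conditions $\phi|_h$. Then there is a complete filtration $\mathcal F$ such that $(\mathfrak Q,\phi)$ is an $\mathcal F$-Boltzmann decorated map and $\mathsf Q$ is an $\mathcal F$-stopping map for it. -/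

import Mathlib

open MeasureTheory
open scoped ENNReal

namespace QuadHoles

/-! ### Rooted planar quadrangulations with a boundary and holes

A planar map is encoded, as usual, by its oriented edges ("darts"), which are labelled by `Fin n`.
Every dart is assigned to the face on its right. -/

/-- A rooted planar quadrangulation with a boundary and holes, with labelled darts.
The root face is the face to the right of the root, every face which is neither the root face
nor a hole has degree `4`, and the boundaries of the holes are simple and pairwise
vertex-disjoint. -/
structure LMap where
  /-- the number of darts, i.e. twice the number of edges -/
  n : ℕ
  /-- reversal of a dart -/
  rev : Equiv.Perm (Fin n)
  /-- the next dart along the face to the right of a dart -/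
  nxt : Equiv.Perm (Fin n)
  /-- the root -/
  root : Fin n
  /-- the darts whose face is a hole -/
  holeDarts : Finset (Fin n)
  rev_rev : ∀ d, rev (rev d) = d
  rev_ne : ∀ d, rev d ≠ d
  connected : ∀ d, ∃ g ∈ Subgroup.closure ({rev, nxt} : Set (Equiv.Perm (Fin n))), g root = d
  /-- Euler's formula `V + F = E + 2`, multiplied by two. The vertices are the cycles of
  `nxt * rev` (which maps a dart to another dart with the same starting vertex), the faces are
  the cycles of `nxt`. -/
  euler : 2 * (Nat.card (Quotient (Equiv.Perm.SameCycle.setoid (nxt * rev)))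
      + Nat.card (Quotient (Equiv.Perm.SameCycle.setoid nxt))) = n + 4
  nxt_mem_holeDarts : ∀ d, nxt d ∈ holeDarts ↔ d ∈ holeDarts
  root_notMem_holeDarts : root ∉ holeDarts
  face_degree : ∀ d, d ∉ holeDarts → ¬ nxt.SameCycle root d →
    Nat.card {e // nxt.SameCycle d e} = 4
  /-- Every vertex is visited at most once, in total, by the boundaries of the holes. -/
  holes_simple : ∀ d ∈ holeDarts, ∀ e ∈ holeDarts, (nxt * rev).SameCycle d e → d = e

namespace LMap

/-- The set of darts of the face to the right of `d`. -/
noncomputable def face (M : LMap) (d : Fin M.n) : Finset (Fin M.n) := by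
  classical exact Finset.univ.filter fun e => M.nxt.SameCycle d e

/-- The root face (exterior face). -/
noncomputable def rootFace (M : LMap) : Finset (Fin M.n) := M.face M.root

/-- The perimeter: the degree of the root face. -/
noncomputable def perimeter (M : LMap) : ℕ := M.rootFace.card

/-- The dart lies on an interior face that is not a hole. -/
def IsInner (M : LMap) (d : Fin M.n) : Prop := d ∉ M.holeDarts ∧ d ∉ M.rootFace

/-- The holes, as faces. -/
def Hole (M : LMap) : Type := {f : Finset (Fin M.n) // ∃ d ∈ M.holeDarts, M.face d = f}

/-- The degree of a hole. -/
def Hole.degree {M : LMap} (h : M.Hole) : ℕ := h.1.card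

/-- The interior faces (holes and root face excluded). -/
def InnerFace (M : LMap) : Type := {f : Finset (Fin M.n) // ∃ d, M.IsInner d ∧ M.face d = f}

instance (M : LMap) : Finite M.Hole := Subtype.finite
instance (M : LMap) : Finite M.InnerFace := Subtype.finite
noncomputable instance (M : LMap) : Fintype M.Hole := Fintype.ofFinite _
noncomputable instance (M : LMap) : Fintype M.InnerFace := Fintype.ofFinite _

/-- Isomorphism of rooted maps with holes: equality up to the names of the darts. -/
def Iso (M N : LMap) : Prop :=
  ∃ f : Fin M.n ≃ Fin N.n, f M.root = N.root ∧ (∀ d, f (M.rev d) = N.rev (f d)) ∧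
    (∀ d, f (M.nxt d) = N.nxt (f d)) ∧ ∀ d, f d ∈ N.holeDarts ↔ d ∈ M.holeDarts

theorem iso_refl (M : LMap) : M.Iso M :=
  ⟨Equiv.refl _, rfl, fun _ => rfl, fun _ => rfl, fun _ => Iff.rfl⟩

theorem iso_symm {M N : LMap} : M.Iso N → N.Iso M := by
  rintro ⟨f, h1, h2, h3, h4⟩
  refine ⟨f.symm, ?_, fun d => ?_, fun d => ?_, fun d => ?_⟩
  · rw [← h1, Equiv.symm_apply_apply]
  · rw [Equiv.symm_apply_eq, h2, Equiv.apply_symm_apply]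
  · rw [Equiv.symm_apply_eq, h3, Equiv.apply_symm_apply]
  · rw [← h4, Equiv.apply_symm_apply]

theorem iso_trans {M N K : LMap} : M.Iso N → N.Iso K → M.Iso K := by
  rintro ⟨f, h1, h2, h3, h4⟩ ⟨g, k1, k2, k3, k4⟩
  refine ⟨f.trans g, ?_, fun d => ?_, fun d => ?_, fun d => ?_⟩
  · simp [h1, k1]
  · simp [h2, k2]
  · simp [h3, k3]
  · simp [h4, k4]

instance isoSetoid : Setoid LMap := ⟨Iso, iso_refl, iso_symm, iso_trans⟩

/-- `GlueMaps p mk u m` is a realization of `m` as the map obtained from `p` by gluing into every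
hole `h` of `p` the map `u h`, where `mk h` is a dart of the hole `h`, whose reversal is the
distinguished oriented edge of `h`. The darts of `m` are those of `p` and of all `u h`, where
the distinguished edge of `h` is identified with the root of `u h` and the other edges are
identified by following the boundary; the faces of `m` are the faces of `p` that are not holes
and the faces of the `u h` that are not their root faces; the holes of `m` are those of the
`u h`. -/
structure GlueMaps (p : LMap) (mk : p.Hole → Fin p.n) (u : p.Hole → LMap) (m : LMap) where
  fromOuter : Fin p.n → Fin m.n
  fromHole : ∀ h, Fin (u h).n → Fin m.n
  perimeter_eq : ∀ h, (u h).perimeter = h.degree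
  outer_rev : ∀ d, fromOuter (p.rev d) = m.rev (fromOuter d)
  hole_rev : ∀ h d, fromHole h ((u h).rev d) = m.rev (fromHole h d)
  glued : ∀ h (i : ℕ), fromOuter (p.rev ((p.nxt⁻¹ ^ i) (mk h)))
    = fromHole h (((u h).nxt ^ i) (u h).root)
  outer_root : fromOuter p.root = m.root
  outer_nxt : ∀ d, d ∉ p.holeDarts → fromOuter (p.nxt d) = m.nxt (fromOuter d)
  hole_nxt : ∀ h d, d ∉ (u h).rootFace → fromHole h ((u h).nxt d) = m.nxt (fromHole h d)
  outer_notMem : ∀ d, d ∉ p.holeDarts → fromOuter d ∉ m.holeDarts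
  hole_mem : ∀ h d, d ∉ (u h).rootFace → (fromHole h d ∈ m.holeDarts ↔ d ∈ (u h).holeDarts)
  /-- Every side of an edge of `m` comes from exactly one place. -/
  bijective : Function.Bijective
    (Sum.elim (fun d : {d // d ∉ p.holeDarts} => fromOuter d.1)
      (fun x : Σ h, {d // d ∉ (u h).rootFace} => fromHole x.1 x.2.1))

end LMap

/-- The countable set of rooted planar quadrangulations with a boundary and holes. -/
def QH : Type := Quotient LMap.isoSetoid

instance : MeasurableSpace QH := ⊤

namespace QH

/-- A labelled representative. (Rooted maps have no nontrivial automorphisms, hence faces and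
holes of a map and of its representative are the same thing.) -/
noncomputable def rep (m : QH) : LMap := Quotient.out m

/-- The holes `H(m)`. -/
abbrev Hole (m : QH) : Type := m.rep.Hole

/-- The interior faces of `m`, not counting holes. -/
abbrev InnerFace (m : QH) : Type := m.rep.InnerFace

/-- `m` is a quadrangulation with a boundary (without holes) of perimeter `N`. -/
def IsQuad (m : QH) (N : ℕ) : Prop := m.rep.holeDarts = ∅ ∧ m.rep.perimeter = N

end QH

/-- A deterministic rule that distinguishes an edge on every hole of every map: `mk p h` is a
dart on the boundary of `h` with `h` on its right. -/
def Marking : Type := ∀ (p : QH) (h : p.Hole), {d : Fin p.rep.n // d ∈ h.1}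

/-- `m` is the map `p` glued with the maps `u h` in its holes. -/
def IsGluing (mk : Marking) (p : QH) (u : p.Hole → QH) (m : QH) : Prop :=
  Nonempty (LMap.GlueMaps p.rep (fun h => (mk p h).1) (fun h => (u h).rep) m.rep)

/-- The relation `p ⊂ m` of maps with holes. -/
def Sub (mk : Marking) (p m : QH) : Prop := ∃ u : p.Hole → QH, IsGluing mk p u m

/-! ### Boltzmann maps -/

/-- Normalization of a measure to total mass one. It is `0` if the total mass is `0` or `∞`. -/
noncomputable def normalize {S : Type*} [MeasurableSpace S] (ν : Measure S) : Measure S :=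
  (ν Set.univ)⁻¹ • ν

open Classical in
/-- The law of the `q`-Boltzmann map of perimeter `N`: proportional to `q ^ |F(m)|` on
quadrangulations with a boundary of perimeter `N`. -/
noncomputable def boltzmann (q : ℝ) (N : ℕ) : Measure QH :=
  normalize (Measure.sum fun m : QH =>
    if m.IsQuad N then ENNReal.ofReal q ^ Fintype.card m.InnerFace • Measure.dirac m else 0)

/-! ### Filtrations, Boltzmann maps with respect to a filtration, stopping maps -/

section Undecorated

variable {Ω : Type*} [mΩ : MeasurableSpace Ω]

/-- A filtration indexed by maps with holes. -/
structure IsFiltration (mk : Marking) (F : QH → MeasurableSpace Ω) : Prop where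
  le : ∀ p, F p ≤ mΩ
  mono : ∀ p p', Sub mk p p' → F p ≤ F p'

/-- Every `F p` contains all events of probability zero. -/
def IsCompleteFiltration (P : Measure Ω) (F : QH → MeasurableSpace Ω) : Prop :=
  ∀ p A, MeasurableSet A → P A = 0 → MeasurableSet[F p] A

/-- `X` is a `q`-Boltzmann map with semi-perimeter `ℓ`. -/
def IsBoltzmann (P : Measure Ω) (q : ℝ) (ℓ : ℕ) (X : Ω → QH) : Prop :=
  Measurable X ∧ P.map X = boltzmann q (2 * ℓ)

/-- `X` is an `F`-Boltzmann map: adaptability, and, given `F p` and the event `p ⊂ X`, the maps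
in the holes of `p` are independent Boltzmann maps. -/
structure IsFBoltzmann (P : Measure Ω) (mk : Marking) (F : QH → MeasurableSpace Ω)
    (q : ℝ) (ℓ : ℕ) (X : Ω → QH) : Prop where
  boltzmann : IsBoltzmann P q ℓ X
  adapted : ∀ p, MeasurableSet[F p] {ω | Sub mk p (X ω)}
  increments : ∀ p, ∃ U : Ω → p.Hole → QH,
    (∀ ω, Sub mk p (X ω) → IsGluing mk p (U ω) (X ω)) ∧
    ∀ A, MeasurableSet[F p] A → ∀ B : p.Hole → Set QH,
      P (A ∩ {ω | Sub mk p (X ω)} ∩ {ω | ∀ h, U ω h ∈ B h})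
        = P (A ∩ {ω | Sub mk p (X ω)}) * ∏ h, QuadHoles.boltzmann q h.degree (B h)

/-- `Y` is an `F`-stopping map for `X`. -/
structure IsStoppingMap (P : Measure Ω) (mk : Marking) (F : QH → MeasurableSpace Ω)
    (X Y : Ω → QH) : Prop where
  sub : ∀ᵐ ω ∂P, Sub mk (Y ω) (X ω)
  measurable : ∀ p, MeasurableSet[F p] {ω | Sub mk (Y ω) p}

/-- The σ-algebra `F_Y` of a stopping map `Y`. -/
@[reducible] def IsStoppingMap.sigma {P : Measure Ω} {mk : Marking} {F : QH → MeasurableSpace Ω}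
    {X Y : Ω → QH} (hY : IsStoppingMap P mk F X Y) : MeasurableSpace Ω where
  MeasurableSet' A := MeasurableSet[⨆ p, F p] A ∧
    ∀ p, MeasurableSet[F p] (A ∩ {ω | Sub mk (Y ω) p})
  measurableSet_empty := by
    refine ⟨@MeasurableSet.empty _ (⨆ p, F p), fun p => ?_⟩
    rw [Set.empty_inter]
    exact @MeasurableSet.empty _ (F p)
  measurableSet_compl A hA := by
    refine ⟨hA.1.compl, fun p => ?_⟩
    have h : Aᶜ ∩ {ω | Sub mk (Y ω) p}
        = {ω | Sub mk (Y ω) p} \ (A ∩ {ω | Sub mk (Y ω) p}) := by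
      ext ω
      simp only [Set.mem_inter_iff, Set.mem_compl_iff, Set.mem_sdiff]
      tauto
    rw [h]
    exact (hY.measurable p).diff (hA.2 p)
  measurableSet_iUnion f hf := by
    refine ⟨MeasurableSet.iUnion fun i => (hf i).1, fun p => ?_⟩
    rw [Set.iUnion_inter]
    exact MeasurableSet.iUnion fun i => (hf i).2 p

/-- `X` is `Y` glued with maps `U ω h` in its holes and, conditionally on `G`, these maps are
independent `q`-Boltzmann maps with the perimeters of the holes. -/
def MarkovDecomposition (P : Measure Ω) (mk : Marking) (q : ℝ) (G : MeasurableSpace Ω)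
    (X Y : Ω → QH) : Prop :=
  ∃ U : ∀ ω, (Y ω).Hole → QH,
    (∀ᵐ ω ∂P, IsGluing mk (Y ω) (U ω) (X ω)) ∧
    ∀ A, MeasurableSet[G] A → ∀ B : ∀ p : QH, p.Hole → Set QH,
      P (A ∩ {ω | ∀ h, U ω h ∈ B (Y ω) h})
        = ∫⁻ ω in A, ∏ h : (Y ω).Hole, boltzmann q h.degree (B (Y ω) h) ∂P

end Undecorated

/-! ### Decorated maps -/

/-- A map with holes together with a decoration of its interior faces by vectors of `ℝ ^ k`. -/
abbrev DecMap (k : ℕ) : Type := Σ m : QH, (m.InnerFace → EuclideanSpace ℝ (Fin k))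

section Decorated

variable {k : ℕ}

open Classical in
/-- The value of a decoration on the face to the right of the dart `d`. -/
noncomputable def faceValue (m : QH) (σ : m.InnerFace → EuclideanSpace ℝ (Fin k))
    (d : Fin m.rep.n) : EuclideanSpace ℝ (Fin k) :=
  if hd : m.rep.IsInner d then σ ⟨m.rep.face d, d, hd, rfl⟩ else 0

open Classical in
/-- The value to the right of the dart `d`, when there is a boundary condition `b`: on the `i`-th
dart of the root face (counted from the root, which has `i = 0`) the value is `b i`. -/
noncomputable def sideValue (m : QH) {N : ℕ} (b : Fin N → EuclideanSpace ℝ (Fin k))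
    (σ : m.InnerFace → EuclideanSpace ℝ (Fin k)) (d : Fin m.rep.n) :
    EuclideanSpace ℝ (Fin k) :=
  if d ∈ m.rep.rootFace then
    if hi : sInf {i : ℕ | (m.rep.nxt ^ i) m.rep.root = d} < N then
      b ⟨sInf {i : ℕ | (m.rep.nxt ^ i) m.rep.root = d}, hi⟩ else 0
  else faceValue m σ d

/-- The energy `β / 2 * ∑ ‖σ_i - σ_j‖ ^ 2`, the sum being over all edges, each of which is
two darts. -/
noncomputable def energy (β : ℝ) (m : QH) {N : ℕ} (b : Fin N → EuclideanSpace ℝ (Fin k))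
    (σ : m.InnerFace → EuclideanSpace ℝ (Fin k)) : ℝ :=
  β / 2 * ((∑ d, ‖sideValue m b σ d - sideValue m b σ (m.rep.rev d)‖ ^ 2) / 2)

open Classical in
/-- The law of the `q`-Boltzmann decorated map with perimeter `N` and boundary condition `b`. -/
noncomputable def decBoltzmann (q β : ℝ) (μ : Measure (EuclideanSpace ℝ (Fin k)))
    (N : ℕ) (b : Fin N → EuclideanSpace ℝ (Fin k)) : Measure (DecMap k) :=
  normalize (Measure.sum fun m : QH =>
    if m.IsQuad N then
      ENNReal.ofReal q ^ Fintype.card m.InnerFace •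
        ((Measure.pi fun _ : m.InnerFace => μ).withDensity
          fun σ => ENNReal.ofReal (Real.exp (-energy β m b σ))).map (Sigma.mk m)
    else 0)

/-- The decorated map `M` is the map `p`, with decoration `τ` on its faces, glued with the
decorated maps `u h` in its holes. -/
def IsDecGluing (mk : Marking) (p : QH) (τ : p.InnerFace → EuclideanSpace ℝ (Fin k))
    (u : p.Hole → DecMap k) (M : DecMap k) : Prop :=
  ∃ g : LMap.GlueMaps p.rep (fun h => (mk p h).1) (fun h => (u h).1.rep) M.1.rep,
    (∀ d, p.rep.IsInner d → faceValue M.1 M.2 (g.fromOuter d) = faceValue p τ d) ∧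
    ∀ h d, d ∉ (u h).1.rep.rootFace →
      faceValue M.1 M.2 (g.fromHole h d) = faceValue (u h).1 (u h).2 d

/-- The boundary condition that the decoration `τ` of `p` (and the boundary condition `b` of `p`)
induces on the hole `h`, read along the boundary from the distinguished edge. -/
noncomputable def holeBoundary (mk : Marking) (p : QH) {N : ℕ}
    (b : Fin N → EuclideanSpace ℝ (Fin k)) (τ : p.InnerFace → EuclideanSpace ℝ (Fin k))
    (h : p.Hole) : Fin h.degree → EuclideanSpace ℝ (Fin k) :=
  fun i => sideValue p b τ (p.rep.rev ((p.rep.nxt⁻¹ ^ (i : ℕ)) (mk p h).1))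

variable {Ω : Type*} [mΩ : MeasurableSpace Ω]

/-- `M` is a `q`-Boltzmann decorated map with semi-perimeter `ℓ` and boundary condition `b`. -/
def IsDecBoltzmann (P : Measure Ω) (q β : ℝ) (μ : Measure (EuclideanSpace ℝ (Fin k)))
    (ℓ : ℕ) (b : Fin (2 * ℓ) → EuclideanSpace ℝ (Fin k)) (M : Ω → DecMap k) : Prop :=
  Measurable M ∧ P.map M = decBoltzmann q β μ (2 * ℓ) b

/-- `M` is an `F`-Boltzmann decorated map. Here `T` is the restriction of the decoration of `M`
to `p` on the event `p ⊂ M`, and zero elsewhere. -/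
structure IsFDecBoltzmann (P : Measure Ω) (mk : Marking) (F : QH → MeasurableSpace Ω)
    (q β : ℝ) (μ : Measure (EuclideanSpace ℝ (Fin k)))
    (ℓ : ℕ) (b : Fin (2 * ℓ) → EuclideanSpace ℝ (Fin k)) (M : Ω → DecMap k) : Prop where
  boltzmann : IsDecBoltzmann P q β μ ℓ b M
  adapted : ∀ p, MeasurableSet[F p] {ω | Sub mk p (M ω).1}
  increments : ∀ p : QH, ∃ (T : Ω → p.InnerFace → EuclideanSpace ℝ (Fin k))
      (U : Ω → p.Hole → DecMap k),
    (∀ ω, Sub mk p (M ω).1 → IsDecGluing mk p (T ω) (U ω) (M ω)) ∧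
    (∀ ω, ¬ Sub mk p (M ω).1 → T ω = 0) ∧
    Measurable[F p] T ∧
    ∀ A, MeasurableSet[F p] A → ∀ B : p.Hole → Set (DecMap k), (∀ h, MeasurableSet (B h)) →
      P (A ∩ {ω | Sub mk p (M ω).1} ∩ {ω | ∀ h, U ω h ∈ B h})
        = ∫⁻ ω in A ∩ {ω | Sub mk p (M ω).1},
            ∏ h, decBoltzmann q β μ h.degree (holeBoundary mk p b (T ω) h) (B h) ∂P

/-- `(M, Y)` is a local map: `M` is a Boltzmann decorated map, almost surely `Y ⊂ M`, and,
conditionally on `Y` and on the restriction `T` of the decoration of `M` to `Y`, the decorated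
maps in the holes of `Y` are independent Boltzmann decorated maps with the induced boundary
conditions. -/
def IsLocalMap (P : Measure Ω) (mk : Marking) (q β : ℝ)
    (μ : Measure (EuclideanSpace ℝ (Fin k))) (ℓ : ℕ)
    (b : Fin (2 * ℓ) → EuclideanSpace ℝ (Fin k)) (M : Ω → DecMap k) (Y : Ω → QH) : Prop :=
  IsDecBoltzmann P q β μ ℓ b M ∧
  ∃ (T : ∀ ω, (Y ω).InnerFace → EuclideanSpace ℝ (Fin k)) (U : ∀ ω, (Y ω).Hole → DecMap k),
    Measurable (fun ω => (⟨Y ω, T ω⟩ : DecMap k)) ∧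
    (∀ᵐ ω ∂P, IsDecGluing mk (Y ω) (T ω) (U ω) (M ω)) ∧
    ∀ A, MeasurableSet[MeasurableSpace.comap (fun ω => (⟨Y ω, T ω⟩ : DecMap k)) inferInstance] A →
      ∀ B : ∀ p : QH, p.Hole → Set (DecMap k), (∀ p h, MeasurableSet (B p h)) →
      P (A ∩ {ω | ∀ h, U ω h ∈ B (Y ω) h})
        = ∫⁻ ω in A, ∏ h : (Y ω).Hole,
            decBoltzmann q β μ h.degree (holeBoundary mk (Y ω) b (T ω) h) (B (Y ω) h) ∂P

end Decorated

end QuadHoles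

/-! ### Cycles of permutations, rigidity of maps with holes, darts of a hole -/

namespace QuadHoles

/-! The combinatorial basis is that gluing is a free and reversible operation. On darts, a glued map
is the pushout of the outer map and its fillings along the boundary edges (`Pasting`,
`exists_desc`). Since the hole boundaries visit each vertex at most once, all darts around a vertex
can be joined without crossing a hole (`vertex_walk`). Hence the inclusion of `p` into `m` is
unique, whatever the fillings are (`rigid`, `fromOuter_unique`). It follows that the fillings and
the glued map determine each other (`iso_of_family`, `iso_of_gluing`) and that inclusion is
antisymmetric. Filling holes with bare cycles gives reflexivity, and gluing in stages gives
transitivity (`exists_gluing_trans`). A count of vertices, edges and faces shows that every family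
with the right perimeters can be glued (`exists_gluing`).

Strong Markov property. Inclusion is a partial order on a countable set, so a stopping map `Y` is a
discrete variable with `{Y = p}` in `F p`. On that event almost surely `p` is contained in `X`, and
the Markov property at the deterministic map `p` applies. Summing over `p` gives the claim.

Converse with decorations. In a gluing the numbers of faces and the energies add up, the boundary
condition of each filling being read from the outer map (`energy_gluing`). Weights therefore
multiply, and summing over the families of fillings gives the spatial Markov property of the
Boltzmann law at every deterministic `p` (`lintegral_decBoltzmann_sub`). Let `F p` be the completed
σ-algebra generated, for all `r` contained in `p`, by the event that `r` is contained in the map,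
the restriction to `r`, and the event that `Y` is contained in `r`. On the event that `p` is
contained in the map, this amounts to the restriction to `p` together with the value of `Y` if `Y`
is contained in `p`. The Markov property at `p` must survive this additional knowledge. On `{Y = y}`
the law of the map is dominated by the Boltzmann law and has the same conditional law of the parts
given the restriction to `y`. It therefore has a density with respect to the Boltzmann law that
depends on this restriction only (`HasMarkov.exists_density`). For `y` contained in `p` such a
density is a function of the restriction to `p`, so it does not bias the parts in the holes of `p`
(`HasMarkov.of_sub`). The event that `Y` is not contained in `p` is handled by taking differences.

Converse without decorations. It is the decorated case with values in the one-point space `ℝ ^ 0`.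
-/

theorem perm_invariant_iff {α : Type*} [Finite α] (σ : Equiv.Perm α) {S : α → Prop}
    (h : ∀ d, S d → S (σ d)) (d : α) : S (σ d) ↔ S d := by
  refine ⟨fun hd => ?_, h d⟩
  have hpow : ∀ (n : ℕ) (e : α), S e → S ((σ ^ n) e) := by
    intro n
    induction n with
    | zero => intro e he; simpa using he
    | succ n ih => intro e he; rw [pow_succ', Equiv.Perm.mul_apply]; exact h _ (ih e he)
  have h1 := hpow (orderOf σ - 1) _ hd
  rwa [← Equiv.Perm.mul_apply, ← pow_succ, Nat.sub_add_cancel (orderOf_pos σ),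
    pow_orderOf_eq_one] at h1

theorem sameCycle_exists_nat_pow {α : Type*} [Finite α] {σ : Equiv.Perm α} {x y : α}
    (h : σ.SameCycle x y) : ∃ i : ℕ, (σ ^ i) x = y := by
  obtain ⟨i, _, hi⟩ := h.exists_pow_eq'
  exact ⟨i, hi⟩

theorem sameCycle_pow {α : Type*} (σ : Equiv.Perm α) (x : α) (i : ℕ) :
    σ.SameCycle x ((σ ^ i) x) := ⟨i, by simp⟩

theorem sameCycle_inv_pow {α : Type*} (σ : Equiv.Perm α) (x : α) (i : ℕ) :
    σ.SameCycle x ((σ⁻¹ ^ i) x) := ⟨-i, by simp⟩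

theorem invariant_of_sameCycle {α : Type*} {σ : Equiv.Perm α} {S : α → Prop}
    (h : ∀ d, S (σ d) ↔ S d) {x y : α} (hxy : σ.SameCycle x y) : S x ↔ S y := by
  obtain ⟨i, rfl⟩ := hxy
  induction i using Int.induction_on generalizing x with
  | zero => simp
  | succ n ih => rw [zpow_add_one, Equiv.Perm.mul_apply, ← ih, h]
  | pred n ih =>
    rw [zpow_sub_one, Equiv.Perm.mul_apply, ← ih, ← h (σ⁻¹ x)]
    simp

theorem card_sameCycle_eq_minimalPeriod {α : Type*} [Finite α] (σ : Equiv.Perm α) (x : α) :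
    Nat.card {y // σ.SameCycle x y} = Function.minimalPeriod σ x := by
  classical
  have hpos : 0 < Function.minimalPeriod σ x := by
    refine Function.IsPeriodicPt.minimalPeriod_pos (orderOf_pos σ) ?_
    change σ^[orderOf σ] x = x
    rw [← Equiv.Perm.coe_pow, pow_orderOf_eq_one]; rfl
  have e : Fin (Function.minimalPeriod σ x) ≃ {y // σ.SameCycle x y} := by
    refine Equiv.ofBijective (fun i => ⟨(σ ^ (i : ℕ)) x, sameCycle_pow σ x i⟩) ⟨?_, ?_⟩
    · intro i j hij
      have h := congrArg Subtype.val hij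
      simp only [Equiv.Perm.coe_pow] at h
      exact Fin.ext ((Function.iterate_eq_iterate_iff_of_lt_minimalPeriod i.2 j.2).1 h)
    · rintro ⟨y, hy⟩
      obtain ⟨i, rfl⟩ := sameCycle_exists_nat_pow hy
      refine ⟨⟨i % _, Nat.mod_lt _ hpos⟩, Subtype.ext ?_⟩
      simp only [Equiv.Perm.coe_pow]
      exact Function.iterate_mod_minimalPeriod_eq
  rw [← Nat.card_congr e, Nat.card_fin]

/-- Positions along a face are counted modulo its degree. This is what allows the boundary of a hole
to be matched, index by index, with the root face of its filling. -/
theorem pow_apply_eq_iff {α : Type*} [Finite α] (σ : Equiv.Perm α) (x : α) (i j : ℕ) :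
    (σ ^ i) x = (σ ^ j) x ↔ i ≡ j [MOD Nat.card {y // σ.SameCycle x y}] := by
  have hpos : 0 < Function.minimalPeriod σ x := by
    refine Function.IsPeriodicPt.minimalPeriod_pos (orderOf_pos σ) ?_
    change σ^[orderOf σ] x = x
    rw [← Equiv.Perm.coe_pow, pow_orderOf_eq_one]; rfl
  rw [card_sameCycle_eq_minimalPeriod, Equiv.Perm.coe_pow, Equiv.Perm.coe_pow,
    ← Function.iterate_mod_minimalPeriod_eq (n := i),
    ← Function.iterate_mod_minimalPeriod_eq (n := j),
    Function.iterate_eq_iterate_iff_of_lt_minimalPeriod (Nat.mod_lt _ hpos) (Nat.mod_lt _ hpos)]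
  rfl

namespace LMap

variable (M : LMap)

/-- The permutations that preserve `S` form a group containing `rev` and `nxt`, and the group
generated by these two moves the root to every dart. -/
theorem connected_induction {S : Fin M.n → Prop} (h0 : S M.root)
    (hr : ∀ d, S (M.rev d) ↔ S d) (hn : ∀ d, S (M.nxt d) ↔ S d) (d : Fin M.n) : S d := by
  obtain ⟨g, hg, rfl⟩ := M.connected d
  have key : ∀ e, S (g e) ↔ S e := by
    induction hg using Subgroup.closure_induction with
    | mem x hx =>
      rcases hx with rfl | rfl
      · exact hr
      · exact hn
    | one => exact fun e => Iff.rfl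
    | mul x y _ _ hx hy => intro e; rw [Equiv.Perm.mul_apply, hx, hy]
    | inv x _ hx => intro e; rw [← hx]; simp
  exact (key _).2 h0

variable {M}

theorem mem_face {d e : Fin M.n} : e ∈ M.face d ↔ M.nxt.SameCycle d e := by
  classical
  simp [face]

theorem mem_face_self (d : Fin M.n) : d ∈ M.face d := mem_face.2 (Equiv.Perm.SameCycle.refl _ _)

theorem face_eq_face_iff {d e : Fin M.n} : M.face d = M.face e ↔ M.nxt.SameCycle d e := by
  constructor
  · intro h
    rw [← mem_face, h]
    exact mem_face_self e
  · intro h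
    ext x
    rw [mem_face, mem_face]
    exact ⟨fun hx => h.symm.trans hx, fun hx => h.trans hx⟩

theorem card_face (d : Fin M.n) : (M.face d).card = Nat.card {e // M.nxt.SameCycle d e} := by
  classical
  rw [Nat.card_eq_fintype_card, Fintype.card_subtype, face]

theorem mem_rootFace {e : Fin M.n} : e ∈ M.rootFace ↔ M.nxt.SameCycle M.root e := mem_face

theorem root_mem_rootFace : M.root ∈ M.rootFace := mem_face_self _

theorem mem_holeDarts_of_sameCycle {d e : Fin M.n} (h : M.nxt.SameCycle d e) :
    d ∈ M.holeDarts ↔ e ∈ M.holeDarts :=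
  invariant_of_sameCycle (S := (· ∈ M.holeDarts)) M.nxt_mem_holeDarts h

theorem nxt_mem_rootFace {d : Fin M.n} : M.nxt d ∈ M.rootFace ↔ d ∈ M.rootFace := by
  rw [mem_rootFace, mem_rootFace, Equiv.Perm.sameCycle_apply_right]

theorem notMem_holeDarts_of_mem_rootFace {d : Fin M.n} (h : d ∈ M.rootFace) :
    d ∉ M.holeDarts := fun hd =>
  M.root_notMem_holeDarts ((mem_holeDarts_of_sameCycle (mem_rootFace.1 h)).2 hd)

/-- If both sides of an edge were in holes, then `nxt d` and `rev d` would be hole darts at the same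
vertex, hence equal, and likewise `nxt (rev d) = d`. The edge would then be closed under `rev` and
`nxt`, so by connectedness it would contain the root, which is not in a hole. -/
theorem rev_notMem_holeDarts {d : Fin M.n} (hd : d ∈ M.holeDarts) : M.rev d ∉ M.holeDarts := by
  intro hr
  have h1 : M.nxt d = M.rev d := by
    refine M.holes_simple _ ((M.nxt_mem_holeDarts d).2 hd) _ hr ?_
    refine Equiv.Perm.SameCycle.symm ⟨1, ?_⟩
    simp [M.rev_rev]
  have h2 : M.nxt (M.rev d) = d := by
    refine M.holes_simple _ ((M.nxt_mem_holeDarts _).2 hr) _ hd ?_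
    exact Equiv.Perm.SameCycle.symm ⟨1, by simp⟩
  have key := M.connected_induction (S := fun x => ¬ (x = d ∨ x = M.rev d)) ?_ ?_ ?_ d
  · exact key (Or.inl rfl)
  · rintro (h | h)
    · exact M.root_notMem_holeDarts (h ▸ hd)
    · exact M.root_notMem_holeDarts (h ▸ hr)
  · intro x
    rw [not_iff_not]
    constructor
    · rintro (h | h)
      · right; rw [← h, M.rev_rev]
      · left; exact M.rev.injective h
    · rintro (h | h)
      · right; rw [h]
      · left; rw [h, M.rev_rev]
  · intro x
    rw [not_iff_not]
    constructor
    · rintro (h | h)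
      · right; exact M.nxt.injective (h.trans h2.symm)
      · left; exact M.nxt.injective (h.trans h1.symm)
    · rintro (h | h)
      · right; rw [h, h1]
      · left; rw [h, h2]

/-- Walking around a vertex: an equivalence relation that relates two consecutive darts starting
at the same vertex, unless they are separated by a hole, relates all of them. -/
theorem vertex_walk {R : Fin M.n → Fin M.n → Prop} (hR : Equivalence R)
    (h : ∀ e, M.rev e ∉ M.holeDarts → R e (M.nxt (M.rev e))) (e : Fin M.n) :
    R e (M.nxt (M.rev e)) := by
  by_cases he : M.rev e ∉ M.holeDarts
  · exact h e he
  rw [not_not] at he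
  set σ : Equiv.Perm (Fin M.n) := M.nxt * M.rev with hσ
  set x := σ e with hx
  have hxe : M.nxt (M.rev e) = x := rfl
  rw [hxe]
  have hxh : x ∈ M.holeDarts := (M.nxt_mem_holeDarts _).2 he
  set n := Function.minimalPeriod σ x with hn
  have hpos : 0 < n := by
    refine Function.IsPeriodicPt.minimalPeriod_pos (orderOf_pos σ) ?_
    change σ^[orderOf σ] x = x
    rw [← Equiv.Perm.coe_pow, pow_orderOf_eq_one]; rfl
  -- The hole dart `x` is the only one at its vertex. A step that crosses a hole would land on a
  -- hole dart, that is on `x` again, which happens only after a full turn. So the turn from `x` to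
  -- its last element `e` uses allowed steps only, and it replaces the forbidden step from `e` to
  -- `x`.
  have claim : ∀ i < n, R x ((σ ^ i) x) := by
    intro i
    induction i with
    | zero => intro _; exact hR.refl _
    | succ i ih =>
      intro hi
      have hs : (σ ^ (i + 1)) x = M.nxt (M.rev ((σ ^ i) x)) := by
        rw [pow_succ', Equiv.Perm.mul_apply]; rfl
      rw [hs]
      refine hR.trans (ih (by omega)) (h _ fun hh => ?_)
      have h1 : (σ ^ (i + 1)) x ∈ M.holeDarts := by
        rw [hs]; exact (M.nxt_mem_holeDarts _).2 hh
      have h2 := M.holes_simple _ hxh _ h1 (sameCycle_pow σ x (i + 1))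
      exact Function.not_isPeriodicPt_of_pos_of_lt_minimalPeriod (Nat.succ_ne_zero i) hi
        (by rw [Equiv.Perm.coe_pow] at h2; exact h2.symm)
  have h3 : (σ ^ (n - 1)) x = e := by
    apply σ.injective
    rw [← Equiv.Perm.mul_apply, ← pow_succ', Nat.sub_add_cancel hpos, Equiv.Perm.coe_pow]
    exact Function.iterate_minimalPeriod
  have := claim (n - 1) (by omega)
  rw [h3] at this
  exact hR.symm this

/-- Two maps out of the darts of `M` which preserve the root, the reversal, and the successor of
the darts that are not in a hole, agree. -/
theorem rigid {α : Type*} {f f' : Fin M.n → α} {r t : α → α} (hr : Function.Injective r)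
    (ht : Function.Injective t) (h0 : f M.root = f' M.root)
    (h1 : ∀ d, f (M.rev d) = r (f d)) (h1' : ∀ d, f' (M.rev d) = r (f' d))
    (h2 : ∀ d, d ∉ M.holeDarts → f (M.nxt d) = t (f d))
    (h2' : ∀ d, d ∉ M.holeDarts → f' (M.nxt d) = t (f' d)) : f = f' := by
  have hS : ∀ d, f (M.rev d) = f' (M.rev d) ↔ f d = f' d := fun d => by
    rw [h1, h1', hr.eq_iff]
  -- Agreement of `f` and `f'` is carried around each vertex. Together with its invariance under
  -- `rev` this gives invariance under `nxt`, including at hole darts.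
  have hw := M.vertex_walk (R := fun e e' => (f e = f' e ↔ f e' = f' e'))
    ⟨fun _ => Iff.rfl, fun h => h.symm, fun h h' => h.trans h'⟩ (fun e he => by
      rw [h2 _ he, h2' _ he, ht.eq_iff, hS])
  funext d
  refine M.connected_induction (S := fun d => f d = f' d) h0 hS (fun d => ?_) d
  have := hw (M.rev d)
  rw [M.rev_rev, hS] at this
  exact this.symm

theorem Hole.face_eq (h : M.Hole) {d : Fin M.n} (hd : d ∈ h.1) : M.face d = h.1 := by
  obtain ⟨e, _, he'⟩ := h.2
  rw [← he'] at hd ⊢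
  exact (face_eq_face_iff.2 (mem_face.1 hd)).symm

theorem Hole.mem_holeDarts (h : M.Hole) {d : Fin M.n} (hd : d ∈ h.1) : d ∈ M.holeDarts := by
  obtain ⟨e, he, he'⟩ := h.2
  rw [← he'] at hd
  exact (mem_holeDarts_of_sameCycle (mem_face.1 hd)).1 he

theorem exists_hole {d : Fin M.n} (hd : d ∈ M.holeDarts) : ∃ h : M.Hole, d ∈ h.1 :=
  ⟨⟨M.face d, d, hd, rfl⟩, mem_face_self d⟩

theorem Hole.ext_of_mem {h h' : M.Hole} {d : Fin M.n} (hd : d ∈ h.1) (hd' : d ∈ h'.1) :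
    h = h' := Subtype.ext ((h.face_eq hd).symm.trans (h'.face_eq hd'))

theorem Hole.mem_iff (h : M.Hole) {d e : Fin M.n} (hd : d ∈ h.1) :
    e ∈ h.1 ↔ M.nxt.SameCycle d e := by rw [← h.face_eq hd, mem_face]

/-- The boundary is followed with `nxt⁻¹`: the root face of the filling is identified with the
reversals of the hole darts, so following it forwards means following the hole backwards. -/
theorem Hole.exists_pow (h : M.Hole) {d e : Fin M.n} (hd : d ∈ h.1) (he : e ∈ h.1) :
    ∃ i : ℕ, (M.nxt⁻¹ ^ i) d = e :=
  sameCycle_exists_nat_pow (Equiv.Perm.sameCycle_inv.2 ((h.mem_iff hd).1 he))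

theorem Hole.pow_mem (h : M.Hole) {d : Fin M.n} (hd : d ∈ h.1) (i : ℕ) :
    (M.nxt⁻¹ ^ i) d ∈ h.1 :=
  (h.mem_iff hd).2 (sameCycle_inv_pow _ _ _)

theorem Hole.pow_eq_iff (h : M.Hole) {d : Fin M.n} (hd : d ∈ h.1) (i j : ℕ) :
    (M.nxt⁻¹ ^ i) d = (M.nxt⁻¹ ^ j) d ↔ i ≡ j [MOD h.degree] := by
  rw [pow_apply_eq_iff]
  simp only [Equiv.Perm.sameCycle_inv]
  rw [← card_face, h.face_eq hd, Hole.degree]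

theorem root_pow_eq_iff (M : LMap) (i j : ℕ) :
    (M.nxt ^ i) M.root = (M.nxt ^ j) M.root ↔ i ≡ j [MOD M.perimeter] := by
  rw [pow_apply_eq_iff, ← card_face]; rfl

theorem exists_root_pow {d : Fin M.n} (hd : d ∈ M.rootFace) :
    ∃ i : ℕ, (M.nxt ^ i) M.root = d :=
  sameCycle_exists_nat_pow (mem_rootFace.1 hd)

theorem root_pow_mem (M : LMap) (i : ℕ) : (M.nxt ^ i) M.root ∈ M.rootFace :=
  mem_rootFace.2 (sameCycle_pow _ _ _)

end LMap
end QuadHoles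

/-! ### Gluing at the level of darts: pushout, connectedness, faces -/

namespace QuadHoles
namespace LMap

/-- The combinatorial part of `GlueMaps`, for a set `D` of darts with reversal `r` and
successor `t` which is not yet known to be a map. -/
structure Pasting (p : LMap) (mk : p.Hole → Fin p.n) (u : p.Hole → LMap) (D : Type*)
    (r t : Equiv.Perm D) where
  fromOuter : Fin p.n → D
  fromHole : ∀ h, Fin (u h).n → D
  mk_mem : ∀ h, mk h ∈ h.1
  perimeter_eq : ∀ h, (u h).perimeter = h.degree
  outer_rev : ∀ d, fromOuter (p.rev d) = r (fromOuter d)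
  hole_rev : ∀ h d, fromHole h ((u h).rev d) = r (fromHole h d)
  glued : ∀ h (i : ℕ), fromOuter (p.rev ((p.nxt⁻¹ ^ i) (mk h)))
    = fromHole h (((u h).nxt ^ i) (u h).root)
  outer_nxt : ∀ d, d ∉ p.holeDarts → fromOuter (p.nxt d) = t (fromOuter d)
  hole_nxt : ∀ h d, d ∉ (u h).rootFace → fromHole h ((u h).nxt d) = t (fromHole h d)
  bijective : Function.Bijective
    (Sum.elim (fun d : {d // d ∉ p.holeDarts} => fromOuter d.1)
      (fun x : Σ h, {d // d ∉ (u h).rootFace} => fromHole x.1 x.2.1))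

/-- The pasting underlying a gluing. -/
def GlueMaps.toPasting {p : LMap} {mk : p.Hole → Fin p.n} {u : p.Hole → LMap} {m : LMap}
    (g : GlueMaps p mk u m) (hmk : ∀ h, mk h ∈ h.1) : Pasting p mk u (Fin m.n) m.rev m.nxt where
  fromOuter := g.fromOuter
  fromHole := g.fromHole
  mk_mem := hmk
  perimeter_eq := g.perimeter_eq
  outer_rev := g.outer_rev
  hole_rev := g.hole_rev
  glued := g.glued
  outer_nxt := g.outer_nxt
  hole_nxt := g.hole_nxt
  bijective := g.bijective

namespace Pasting

variable {p : LMap} {mk : p.Hole → Fin p.n} {u : p.Hole → LMap} {D : Type*}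
  {r t : Equiv.Perm D} (g : Pasting p mk u D r t)

include g

theorem outer_inj {d e : Fin p.n} (hd : d ∉ p.holeDarts) (he : e ∉ p.holeDarts)
    (h : g.fromOuter d = g.fromOuter e) : d = e := by
  have := @g.bijective.1 (Sum.inl ⟨d, hd⟩) (Sum.inl ⟨e, he⟩) h
  simpa using this

theorem outer_ne_hole {d : Fin p.n} (hd : d ∉ p.holeDarts) {h : p.Hole} {x : Fin (u h).n}
    (hx : x ∉ (u h).rootFace) : g.fromOuter d ≠ g.fromHole h x := by
  intro he
  have := @g.bijective.1 (Sum.inl ⟨d, hd⟩) (Sum.inr ⟨h, x, hx⟩) he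
  simp at this

theorem cases (z : D) : (∃ d, d ∉ p.holeDarts ∧ g.fromOuter d = z) ∨
    ∃ h x, x ∉ (u h).rootFace ∧ g.fromHole h x = z := by
  obtain ⟨y, hy⟩ := g.bijective.2 z
  rcases y with ⟨d, hd⟩ | ⟨h, x, hx⟩
  · exact Or.inl ⟨d, hd, hy⟩
  · exact Or.inr ⟨h, x, hx, hy⟩

theorem pow_mk_mem (h : p.Hole) (i : ℕ) : (p.nxt⁻¹ ^ i) (mk h) ∈ h.1 :=
  h.pow_mem (g.mk_mem h) i

theorem rev_pow_mk_notMem (h : p.Hole) (i : ℕ) : p.rev ((p.nxt⁻¹ ^ i) (mk h)) ∉ p.holeDarts :=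
  rev_notMem_holeDarts (h.mem_holeDarts (g.pow_mk_mem h i))

/-- The root face of a filling is glued to the reversals of the hole darts, which lie outside all
holes by `rev_notMem_holeDarts`. Thus the root face can be recognised inside `D`, without reference
to the filling. -/
theorem mem_rootFace_iff {h : p.Hole} {x : Fin (u h).n} : x ∈ (u h).rootFace ↔
    ∃ d, d ∉ p.holeDarts ∧ g.fromOuter d = g.fromHole h x := by
  constructor
  · intro hx
    obtain ⟨i, rfl⟩ := exists_root_pow hx
    exact ⟨_, g.rev_pow_mk_notMem h i, g.glued h i⟩
  · rintro ⟨d, hd, he⟩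
    by_contra hx
    exact g.outer_ne_hole hd hx he

theorem outer_hole (h : p.Hole) (i : ℕ) : g.fromOuter ((p.nxt⁻¹ ^ i) (mk h))
    = g.fromHole h ((u h).rev (((u h).nxt ^ i) (u h).root)) := by
  rw [g.hole_rev, ← g.glued, ← g.outer_rev, p.rev_rev]

/-- The boundary of a filling need not be simple, but gluing identifies no two of its darts: on the
root face positions are counted modulo the perimeter, on the hole modulo the degree, and these are
equal. -/
theorem hole_inj {h h' : p.Hole} {x : Fin (u h).n} {x' : Fin (u h').n}
    (he : g.fromHole h x = g.fromHole h' x') :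
    (⟨h, x⟩ : Σ h, Fin (u h).n) = ⟨h', x'⟩ := by
  by_cases hx : x ∈ (u h).rootFace
  · have hx' : x' ∈ (u h').rootFace := by
      rw [g.mem_rootFace_iff] at hx ⊢
      rwa [he] at hx
    obtain ⟨i, rfl⟩ := exists_root_pow hx
    obtain ⟨j, rfl⟩ := exists_root_pow hx'
    rw [← g.glued, ← g.glued] at he
    have h1 := p.rev.injective (g.outer_inj (g.rev_pow_mk_notMem h i) (g.rev_pow_mk_notMem h' j) he)
    obtain rfl : h = h' := Hole.ext_of_mem (g.pow_mk_mem h i) (h1 ▸ g.pow_mk_mem h' j)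
    rw [h.pow_eq_iff (g.mk_mem h), ← g.perimeter_eq, ← root_pow_eq_iff] at h1
    rw [h1]
  · have hx' : x' ∉ (u h').rootFace := by
      rw [g.mem_rootFace_iff] at hx ⊢
      rwa [he] at hx
    have := @g.bijective.1 (Sum.inr ⟨h, x, hx⟩) (Sum.inr ⟨h', x', hx'⟩) he
    simp only [Sum.inr.injEq] at this
    exact congrArg (fun y : Σ h, {d // d ∉ (u h).rootFace} =>
      (⟨y.1, y.2.1⟩ : Σ h, Fin (u h).n)) this

theorem hole_injective (h : p.Hole) : Function.Injective (g.fromHole h) := fun x x' he => by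
  simpa using g.hole_inj he

theorem rev_rev (z : D) : r (r z) = z := by
  rcases g.cases z with ⟨d, -, rfl⟩ | ⟨h, x, -, rfl⟩
  · rw [← g.outer_rev, ← g.outer_rev, p.rev_rev]
  · rw [← g.hole_rev, ← g.hole_rev, (u h).rev_rev]

/-- The darts of a pasting are the pushout of the darts of its parts. -/
theorem exists_desc {N : Type*} {rN : N → N} {α : Fin p.n → N} {β : ∀ h, Fin (u h).n → N}
    (hα : ∀ d, α (p.rev d) = rN (α d)) (hβ : ∀ h x, β h ((u h).rev x) = rN (β h x))
    (hαβ : ∀ h (i : ℕ), α (p.rev ((p.nxt⁻¹ ^ i) (mk h))) = β h (((u h).nxt ^ i) (u h).root)) :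
    ∃ γ : D → N, (∀ d, γ (g.fromOuter d) = α d) ∧ ∀ h x, γ (g.fromHole h x) = β h x := by
  let e := Equiv.ofBijective _ g.bijective
  let γ : D → N := fun z => Sum.elim (fun d : {d // d ∉ p.holeDarts} => α d.1)
    (fun x : Σ h, {d // d ∉ (u h).rootFace} => β x.1 x.2.1) (e.symm z)
  have h1 : ∀ d, d ∉ p.holeDarts → γ (g.fromOuter d) = α d := by
    intro d hd
    have : e.symm (g.fromOuter d) = Sum.inl ⟨d, hd⟩ := by rw [Equiv.symm_apply_eq]; rfl
    simp [γ, this]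
  have h2 : ∀ h x, x ∉ (u h).rootFace → γ (g.fromHole h x) = β h x := by
    intro h x hx
    have : e.symm (g.fromHole h x) = Sum.inr ⟨h, x, hx⟩ := by rw [Equiv.symm_apply_eq]; rfl
    simp [γ, this]
  have h3 : ∀ h x, γ (g.fromHole h x) = β h x := by
    intro h x
    by_cases hx : x ∈ (u h).rootFace
    · obtain ⟨i, rfl⟩ := exists_root_pow hx
      rw [← g.glued, h1 _ (g.rev_pow_mk_notMem h i), hαβ]
    · exact h2 h x hx
  refine ⟨γ, fun d => ?_, h3⟩
  by_cases hd : d ∈ p.holeDarts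
  -- A hole dart of `p` becomes the reversal of a root-face dart of the filling (`outer_hole`).
  -- Compatibility with reversal carries the prescribed value across the edge.
  · obtain ⟨h, hh⟩ := exists_hole hd
    obtain ⟨i, rfl⟩ := h.exists_pow (g.mk_mem h) hh
    rw [g.outer_hole, h3, hβ, ← hαβ, ← hα, p.rev_rev]
  · exact h1 d hd

/-- `fromOuter` need not commute with the successor at a hole dart, so the single step that crosses
a hole is replaced by going around the vertex the other way. -/
theorem outer_vertex {R : D → D → Prop} (hR : Equivalence R) (h : ∀ z, R z (t (r z)))
    (e : Fin p.n) : R (g.fromOuter e) (g.fromOuter (p.nxt (p.rev e))) := by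
  refine p.vertex_walk (R := fun e e' => R (g.fromOuter e) (g.fromOuter e'))
    ⟨fun _ => hR.refl _, fun h => hR.symm h, fun h h' => hR.trans h h'⟩ (fun e he => ?_) e
  rw [g.outer_nxt _ he, g.outer_rev]
  exact h _

/-- The corner between two consecutive boundary darts of the filling is transferred to the outer
map. There it is the corner of the hole between the positions `i + 1` and `i`, since `nxt` lowers
the position by one. -/
theorem outer_hole_vertex {R : D → D → Prop} (hR : Equivalence R) (h : ∀ z, R z (t (r z)))
    (k : p.Hole) (i : ℕ) : R (g.fromHole k ((u k).rev (((u k).nxt ^ i) (u k).root)))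
      (g.fromHole k (((u k).nxt ^ (i + 1)) (u k).root)) := by
  rw [← g.outer_hole, ← g.glued]
  have := g.outer_vertex hR h (p.rev ((p.nxt⁻¹ ^ (i + 1)) (mk k)))
  rw [p.rev_rev, pow_succ', Equiv.Perm.mul_apply] at this
  rw [pow_succ', Equiv.Perm.mul_apply]
  have h2 : p.nxt (p.nxt⁻¹ ((p.nxt⁻¹ ^ i) (mk k))) = (p.nxt⁻¹ ^ i) (mk k) := by simp
  rw [h2] at this
  exact hR.symm this

theorem hole_vertex {R : D → D → Prop} (hR : Equivalence R) (h : ∀ z, R z (t (r z)))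
    (k : p.Hole) (x : Fin (u k).n) :
    R (g.fromHole k x) (g.fromHole k ((u k).nxt ((u k).rev x))) := by
  by_cases hx : (u k).rev x ∈ (u k).rootFace
  · obtain ⟨i, hi⟩ := exists_root_pow hx
    have := g.outer_hole_vertex hR h k i
    rw [pow_succ', Equiv.Perm.mul_apply, hi, (u k).rev_rev] at this
    exact this
  · rw [g.hole_nxt _ _ hx, g.hole_rev]
    exact h _

/-- Connectedness of the pasting: the outer map is connected without crossing holes, each filling is
attached to it at its root, and each filling is connected. -/
theorem induction {S : D → Prop} (h0 : S (g.fromOuter p.root)) (hr : ∀ z, S (r z) ↔ S z)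
    (ht : ∀ z, S (t z) ↔ S z) (z : D) : S z := by
  have hR : Equivalence (fun z z' => (S z ↔ S z')) :=
    ⟨fun _ => Iff.rfl, fun h => h.symm, fun h h' => h.trans h'⟩
  have hstep : ∀ z, S z ↔ S (t (r z)) := fun z => by rw [ht, hr]
  have houter : ∀ d, S (g.fromOuter d) := by
    refine p.connected_induction h0 (fun d => by rw [g.outer_rev, hr]) fun d => ?_
    have := g.outer_vertex hR hstep (p.rev d)
    rw [p.rev_rev, g.outer_rev, hr] at this
    exact this.symm
  have hhole : ∀ h x, S (g.fromHole h x) := by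
    intro h
    refine (u h).connected_induction ?_ (fun x => by rw [g.hole_rev, hr]) fun x => ?_
    · have := g.glued h 0
      simp only [pow_zero, Equiv.Perm.coe_one, id_eq] at this
      rw [← this]
      exact houter _
    · have := g.hole_vertex hR hstep h ((u h).rev x)
      rw [(u h).rev_rev, g.hole_rev, hr] at this
      exact this.symm
  rcases g.cases z with ⟨d, -, rfl⟩ | ⟨h, x, -, rfl⟩
  · exact houter d
  · exact hhole h x

theorem outer_pow {d : Fin p.n} (hd : d ∉ p.holeDarts) (i : ℕ) :
    g.fromOuter ((p.nxt ^ i) d) = (t ^ i) (g.fromOuter d) := by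
  induction i with
  | zero => simp
  | succ i ih =>
    rw [pow_succ', pow_succ', Equiv.Perm.mul_apply, Equiv.Perm.mul_apply, ← ih, g.outer_nxt]
    rwa [← mem_holeDarts_of_sameCycle (sameCycle_pow _ _ _)]

theorem hole_pow {h : p.Hole} {x : Fin (u h).n} (hx : x ∉ (u h).rootFace) (i : ℕ) :
    g.fromHole h (((u h).nxt ^ i) x) = (t ^ i) (g.fromHole h x) := by
  induction i with
  | zero => simp
  | succ i ih =>
    rw [pow_succ', pow_succ', Equiv.Perm.mul_apply, Equiv.Perm.mul_apply, ← ih, g.hole_nxt]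
    rwa [← invariant_of_sameCycle (S := (· ∈ (u h).rootFace)) (fun _ => nxt_mem_rootFace)
      (sameCycle_pow _ _ _)]

variable [Finite D]

/-- Away from the holes the successor is inherited from `p`, so a face of `p` that is not a hole is
a full cycle of `t`. -/
theorem outer_sameCycle {d : Fin p.n} (hd : d ∉ p.holeDarts) {z : D} :
    t.SameCycle (g.fromOuter d) z ↔ ∃ e, p.nxt.SameCycle d e ∧ g.fromOuter e = z := by
  constructor
  · intro h
    obtain ⟨i, rfl⟩ := sameCycle_exists_nat_pow h
    exact ⟨(p.nxt ^ i) d, sameCycle_pow _ _ _, g.outer_pow hd i⟩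
  · rintro ⟨e, he, rfl⟩
    obtain ⟨i, rfl⟩ := sameCycle_exists_nat_pow he
    rw [g.outer_pow hd]
    exact sameCycle_pow _ _ _

theorem outer_sameCycle_outer {d e : Fin p.n} (hd : d ∉ p.holeDarts) (he : e ∉ p.holeDarts) :
    t.SameCycle (g.fromOuter d) (g.fromOuter e) ↔ p.nxt.SameCycle d e := by
  rw [g.outer_sameCycle hd]
  constructor
  · rintro ⟨e', h1, h2⟩
    rwa [← g.outer_inj (fun h => hd ((mem_holeDarts_of_sameCycle h1).2 h)) he h2]
  · exact fun h => ⟨e, h, rfl⟩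

theorem hole_sameCycle {h : p.Hole} {x : Fin (u h).n} (hx : x ∉ (u h).rootFace) {z : D} :
    t.SameCycle (g.fromHole h x) z ↔ ∃ y, (u h).nxt.SameCycle x y ∧ g.fromHole h y = z := by
  constructor
  · intro h'
    obtain ⟨i, rfl⟩ := sameCycle_exists_nat_pow h'
    exact ⟨((u h).nxt ^ i) x, sameCycle_pow _ _ _, g.hole_pow hx i⟩
  · rintro ⟨e, he, rfl⟩
    obtain ⟨i, rfl⟩ := sameCycle_exists_nat_pow he
    rw [g.hole_pow hx]
    exact sameCycle_pow _ _ _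

theorem card_outer_cycle {d : Fin p.n} (hd : d ∉ p.holeDarts) :
    Nat.card {z // t.SameCycle (g.fromOuter d) z} = Nat.card {e // p.nxt.SameCycle d e} := by
  refine (Nat.card_congr (Equiv.ofBijective
    (fun e : {e // p.nxt.SameCycle d e} => (⟨g.fromOuter e.1,
      (g.outer_sameCycle hd).2 ⟨e.1, e.2, rfl⟩⟩ : {z // t.SameCycle (g.fromOuter d) z})) ⟨?_, ?_⟩)).symm
  · rintro ⟨e, he⟩ ⟨e', he'⟩ h
    have h1 : ∀ e, p.nxt.SameCycle d e → e ∉ p.holeDarts :=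
      fun e he h => hd ((mem_holeDarts_of_sameCycle he).2 h)
    exact Subtype.ext (g.outer_inj (h1 e he) (h1 e' he') (congrArg Subtype.val h))
  · rintro ⟨z, hz⟩
    obtain ⟨e, he, rfl⟩ := (g.outer_sameCycle hd).1 hz
    exact ⟨⟨e, he⟩, rfl⟩

theorem card_hole_cycle {h : p.Hole} {x : Fin (u h).n} (hx : x ∉ (u h).rootFace) :
    Nat.card {z // t.SameCycle (g.fromHole h x) z}
      = Nat.card {y // (u h).nxt.SameCycle x y} := by
  refine (Nat.card_congr (Equiv.ofBijective
    (fun e : {e // (u h).nxt.SameCycle x e} => (⟨g.fromHole h e.1,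
      (g.hole_sameCycle hx).2 ⟨e.1, e.2, rfl⟩⟩ : {z // t.SameCycle (g.fromHole h x) z}))
      ⟨?_, ?_⟩)).symm
  · rintro ⟨e, he⟩ ⟨e', he'⟩ h'
    exact Subtype.ext (g.hole_injective h (congrArg Subtype.val h'))
  · rintro ⟨z, hz⟩
    obtain ⟨e, he, rfl⟩ := (g.hole_sameCycle hx).1 hz
    exact ⟨⟨e, he⟩, rfl⟩

end Pasting
end LMap
end QuadHoles

/-! ### Uniqueness of gluings and of fillings, antisymmetry of inclusion -/

namespace QuadHoles
namespace LMap

namespace GlueMaps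

variable {p : LMap} {mk : p.Hole → Fin p.n} {u u' : p.Hole → LMap} {m m' : LMap}

/-- The two families of fillings may differ. By `rigid` the inclusion depends on `p` and `m` only,
which is the source of the uniqueness of the fillings. -/
theorem fromOuter_unique (g : GlueMaps p mk u m) (g' : GlueMaps p mk u' m) :
    g.fromOuter = g'.fromOuter :=
  rigid m.rev.injective m.nxt.injective (g.outer_root.trans g'.outer_root.symm) g.outer_rev
    g'.outer_rev g.outer_nxt g'.outer_nxt

theorem fromHole_unique (g g' : GlueMaps p mk u m) : g.fromHole = g'.fromHole := by
  have ho := g.fromOuter_unique g'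
  have hroot : ∀ h x, x ∈ (u h).rootFace → g.fromHole h x = g'.fromHole h x := by
    intro h x hx
    obtain ⟨i, rfl⟩ := exists_root_pow hx
    rw [← g.glued, ← g'.glued, ho]
  funext h x
  refine (u h).connected_induction (S := fun x => g.fromHole h x = g'.fromHole h x)
    (hroot h _ root_mem_rootFace) (fun x => ?_) (fun x => ?_) x
  · rw [g.hole_rev, g'.hole_rev, m.rev.injective.eq_iff]
  · by_cases hx : x ∈ (u h).rootFace
    · simp only [hroot h _ hx, hroot h _ (nxt_mem_rootFace.2 hx)]
    · rw [g.hole_nxt _ _ hx, g'.hole_nxt _ _ hx, m.nxt.injective.eq_iff]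

instance : Subsingleton (GlueMaps p mk u m) := ⟨fun g g' => by
  have h1 := g.fromOuter_unique g'
  have h2 := g.fromHole_unique g'
  cases g
  cases g'
  simp only at h1 h2
  subst h1 h2
  rfl⟩

theorem root_pow (g : GlueMaps p mk u m) (hmk : ∀ h, mk h ∈ h.1) (i : ℕ) :
    g.fromOuter ((p.nxt ^ i) p.root) = (m.nxt ^ i) m.root := by
  rw [← g.outer_root]
  exact (g.toPasting hmk).outer_pow p.root_notMem_holeDarts i

theorem outer_mem_rootFace (g : GlueMaps p mk u m) (hmk : ∀ h, mk h ∈ h.1) {d : Fin p.n}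
    (hd : d ∉ p.holeDarts) : g.fromOuter d ∈ m.rootFace ↔ d ∈ p.rootFace := by
  rw [mem_rootFace, mem_rootFace, ← g.outer_root]
  exact (g.toPasting hmk).outer_sameCycle_outer p.root_notMem_holeDarts hd

theorem hole_notMem_rootFace (g : GlueMaps p mk u m) (hmk : ∀ h, mk h ∈ h.1) {h : p.Hole}
    {x : Fin (u h).n} (hx : x ∉ (u h).rootFace) : g.fromHole h x ∉ m.rootFace := by
  intro hm
  rw [mem_rootFace, ← g.outer_root] at hm
  obtain ⟨e, he, he'⟩ := ((g.toPasting hmk).outer_sameCycle p.root_notMem_holeDarts).1 hm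
  exact (g.toPasting hmk).outer_ne_hole
    (fun h => p.root_notMem_holeDarts ((mem_holeDarts_of_sameCycle he).2 h)) hx he'

theorem perimeter (g : GlueMaps p mk u m) (hmk : ∀ h, mk h ∈ h.1) :
    m.perimeter = p.perimeter := by
  rw [LMap.perimeter, LMap.perimeter, rootFace, rootFace, card_face, card_face, ← g.outer_root]
  exact (g.toPasting hmk).card_outer_cycle p.root_notMem_holeDarts

/-- A map is determined by its parts. -/
theorem iso_of_gluing (g : GlueMaps p mk u m) (g' : GlueMaps p mk u m') (hmk : ∀ h, mk h ∈ h.1) :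
    m.Iso m' := by
  obtain ⟨γ, h1, h2⟩ := (g.toPasting hmk).exists_desc g'.outer_rev g'.hole_rev g'.glued
  obtain ⟨γ', h1', h2'⟩ := (g'.toPasting hmk).exists_desc g.outer_rev g.hole_rev g.glued
  change ∀ d, γ (g.fromOuter d) = _ at h1
  change ∀ h x, γ (g.fromHole h x) = _ at h2
  change ∀ d, γ' (g'.fromOuter d) = _ at h1'
  change ∀ h x, γ' (g'.fromHole h x) = _ at h2'
  have hc : ∀ z, (∃ d, d ∉ p.holeDarts ∧ g.fromOuter d = z) ∨
    ∃ h x, x ∉ (u h).rootFace ∧ g.fromHole h x = z := (g.toPasting hmk).cases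
  have hc' : ∀ z, (∃ d, d ∉ p.holeDarts ∧ g'.fromOuter d = z) ∨
    ∃ h x, x ∉ (u h).rootFace ∧ g'.fromHole h x = z := (g'.toPasting hmk).cases
  refine ⟨⟨γ, γ', fun z => ?_, fun z => ?_⟩, ?_, fun z => ?_, fun z => ?_, fun z => ?_⟩
  · rcases hc z with ⟨d, -, rfl⟩ | ⟨h, x, -, rfl⟩
    · rw [h1, h1']
    · rw [h2, h2']
  · rcases hc' z with ⟨d, -, rfl⟩ | ⟨h, x, -, rfl⟩
    · rw [h1', h1]
    · rw [h2', h2]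
  · change γ m.root = _
    rw [← g.outer_root, h1, g'.outer_root]
  · change γ (m.rev z) = m'.rev (γ z)
    rcases hc z with ⟨d, -, rfl⟩ | ⟨h, x, -, rfl⟩
    · rw [← g.outer_rev, h1, h1, g'.outer_rev]
    · rw [← g.hole_rev, h2, h2, g'.hole_rev]
  · change γ (m.nxt z) = m'.nxt (γ z)
    rcases hc z with ⟨d, hd, rfl⟩ | ⟨h, x, hx, rfl⟩
    · rw [← g.outer_nxt _ hd, h1, h1, g'.outer_nxt _ hd]
    · rw [← g.hole_nxt _ _ hx, h2, h2, g'.hole_nxt _ _ hx]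
  · change γ z ∈ _ ↔ _
    rcases hc z with ⟨d, hd, rfl⟩ | ⟨h, x, hx, rfl⟩
    · rw [h1]
      exact iff_of_false (g'.outer_notMem _ hd) (g.outer_notMem _ hd)
    · rw [h2, g.hole_mem _ _ hx, g'.hole_mem _ _ hx]

/-- The image of a filling in `m` is generated from its root. Reversal and inner successor are read
in `m`, while successors on the root face are read through the common `fromOuter`. Two fillings of
the same hole thus have the same image. Forward stability of the image suffices, a permutation of a
finite set having finite order. -/
theorem exists_fromHole_eq (g : GlueMaps p mk u m) (g' : GlueMaps p mk u' m)
    (hmk : ∀ h, mk h ∈ h.1) (h : p.Hole) (x : Fin (u h).n) :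
    ∃ x', g'.fromHole h x' = g.fromHole h x := by
  have ho := g.fromOuter_unique g'
  have hrf : ∀ {x : Fin (u h).n} {x' : Fin (u' h).n}, g'.fromHole h x' = g.fromHole h x →
      (x ∈ (u h).rootFace ↔ x' ∈ (u' h).rootFace) := by
    intro x x' hxx
    rw [(g.toPasting hmk).mem_rootFace_iff, (g'.toPasting hmk).mem_rootFace_iff]
    change (∃ d, _ ∧ g.fromOuter d = g.fromHole h x) ↔ ∃ d, _ ∧ g'.fromOuter d = g'.fromHole h x'
    rw [hxx, ho]
  refine (u h).connected_induction (S := fun x => ∃ x', g'.fromHole h x' = g.fromHole h x)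
    ⟨(u' h).root, ?_⟩
    (perm_invariant_iff _ (S := fun x => ∃ x', g'.fromHole h x' = g.fromHole h x) ?_)
    (perm_invariant_iff _ (S := fun x => ∃ x', g'.fromHole h x' = g.fromHole h x) ?_) x
  · have h1 := g.glued h 0
    have h2 := g'.glued h 0
    rw [ho] at h1
    exact h2.symm.trans h1
  · rintro x ⟨x', hx'⟩
    exact ⟨(u' h).rev x', by rw [g'.hole_rev, hx', g.hole_rev]⟩
  · rintro x ⟨x', hx'⟩
    by_cases hx : x ∈ (u h).rootFace
    · obtain ⟨i, rfl⟩ := exists_root_pow hx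
      refine ⟨((u' h).nxt ^ (i + 1)) (u' h).root, ?_⟩
      rw [← Equiv.Perm.mul_apply, ← pow_succ', ← g.glued, ← g'.glued, ho]
    · refine ⟨(u' h).nxt x', ?_⟩
      rw [g.hole_nxt _ _ hx, g'.hole_nxt _ _ ((hrf hx').not.1 hx), hx']

/-- The maps in the holes are determined by the glued map. -/
theorem iso_of_family (g : GlueMaps p mk u m) (g' : GlueMaps p mk u' m)
    (hmk : ∀ h, mk h ∈ h.1) (h : p.Hole) : (u h).Iso (u' h) := by
  have ho := g.fromOuter_unique g'
  have hrf : ∀ {x : Fin (u h).n} {x' : Fin (u' h).n}, g'.fromHole h x' = g.fromHole h x →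
      (x ∈ (u h).rootFace ↔ x' ∈ (u' h).rootFace) := by
    intro x x' hxx
    rw [(g.toPasting hmk).mem_rootFace_iff, (g'.toPasting hmk).mem_rootFace_iff]
    change (∃ d, _ ∧ g.fromOuter d = g.fromHole h x) ↔ ∃ d, _ ∧ g'.fromOuter d = g'.fromHole h x'
    rw [hxx, ho]
  have hi := (g.toPasting hmk).hole_injective h
  have hi' := (g'.toPasting hmk).hole_injective h
  change Function.Injective (g.fromHole h) at hi
  change Function.Injective (g'.fromHole h) at hi'
  choose f hf using g.exists_fromHole_eq g' hmk h
  choose f' hf' using g'.exists_fromHole_eq g hmk h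
  refine ⟨⟨f, f', fun x => hi (by rw [hf', hf]), fun x => hi' (by rw [hf, hf'])⟩,
    hi' ?_, fun x => hi' ?_, fun x => hi' ?_, fun x => ?_⟩
  · have h1 := g.glued h 0
    have h2 := g'.glued h 0
    rw [ho] at h1
    exact (hf _).trans (h1.symm.trans h2)
  · exact (hf _).trans (by rw [g.hole_rev, g'.hole_rev]; exact congrArg _ (hf x).symm)
  · refine (hf _).trans ?_
    change _ = g'.fromHole h ((u' h).nxt (f x))
    by_cases hx : x ∈ (u h).rootFace
    · obtain ⟨i, rfl⟩ := exists_root_pow hx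
      have hfx : f (((u h).nxt ^ i) (u h).root) = ((u' h).nxt ^ i) (u' h).root := hi' (by
        rw [hf, ← g.glued, ← g'.glued, ho])
      rw [hfx, ← Equiv.Perm.mul_apply, ← Equiv.Perm.mul_apply, ← pow_succ', ← pow_succ',
        ← g.glued, ← g'.glued, ho]
    · rw [g.hole_nxt _ _ hx, g'.hole_nxt _ _ ((hrf (hf x)).not.1 hx), hf x]
  · change f x ∈ _ ↔ _
    by_cases hx : x ∈ (u h).rootFace
    · exact iff_of_false (notMem_holeDarts_of_mem_rootFace ((hrf (hf x)).1 hx))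
        (notMem_holeDarts_of_mem_rootFace hx)
    · rw [← g.hole_mem _ _ hx, ← g'.hole_mem _ _ ((hrf (hf x)).not.1 hx), hf x]

end GlueMaps

theorem Iso.exists_equiv {M N : LMap} (h : M.Iso N) : ∃ f : Fin M.n ≃ Fin N.n,
    f M.root = N.root ∧ (∀ d, f (M.rev d) = N.rev (f d)) ∧
    (∀ d, f (M.nxt d) = N.nxt (f d)) ∧ (∀ d, f d ∈ N.holeDarts ↔ d ∈ M.holeDarts) ∧
    (∀ i : ℕ, f ((M.nxt ^ i) M.root) = (N.nxt ^ i) N.root) ∧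
    (∀ d, f d ∈ N.rootFace ↔ d ∈ M.rootFace) ∧ M.perimeter = N.perimeter := by
  obtain ⟨f, h1, h2, h3, h4⟩ := h
  have hpow : ∀ (i : ℕ) d, f ((M.nxt ^ i) d) = (N.nxt ^ i) (f d) := by
    intro i
    induction i with
    | zero => simp
    | succ i ih => intro d; rw [pow_succ, pow_succ, Equiv.Perm.mul_apply, Equiv.Perm.mul_apply,
        ih, h3]
  have hrf : ∀ d, f d ∈ N.rootFace ↔ d ∈ M.rootFace := by
    intro d
    constructor
    · intro h
      obtain ⟨i, hi⟩ := exists_root_pow h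
      rw [← h1, ← hpow, f.injective.eq_iff] at hi
      exact hi ▸ M.root_pow_mem i
    · intro h
      obtain ⟨i, rfl⟩ := exists_root_pow h
      rw [hpow, h1]
      exact N.root_pow_mem i
  refine ⟨f, h1, h2, h3, h4, fun i => by rw [hpow, h1], hrf, ?_⟩
  exact Finset.card_bij (fun d _ => f d) (fun d hd => (hrf d).2 hd)
    (fun _ _ _ _ h => f.injective h)
    (fun e he => ⟨f.symm e, (hrf _).1 (by simpa using he), by simp⟩)

theorem GlueMaps.congr {p : LMap} {mk : p.Hole → Fin p.n} {u u' : p.Hole → LMap} {m m' : LMap}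
    (g : GlueMaps p mk u m) (hu : ∀ h, (u h).Iso (u' h)) (hm : m.Iso m') :
    Nonempty (GlueMaps p mk u' m') := by
  obtain ⟨f, f1, f2, f3, f4, -, -, -⟩ := hm.exists_equiv
  choose e e1 e2 e3 e4 e5 e6 e7 using fun h => (LMap.iso_symm (hu h)).exists_equiv
  refine ⟨⟨fun d => f (g.fromOuter d), fun h x => f (g.fromHole h (e h x)),
    fun h => (e7 h).trans (g.perimeter_eq h), fun d => by rw [g.outer_rev, f2],
    fun h d => by rw [e2, g.hole_rev, f2], fun h i => by rw [e5, g.glued],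
    by rw [g.outer_root, f1], fun d hd => by rw [g.outer_nxt _ hd, f3],
    fun h d hd => by rw [e3, g.hole_nxt _ _ ((e6 h d).not.2 hd), f3],
    fun d hd => by rw [f4]; exact g.outer_notMem _ hd,
    fun h d hd => by rw [f4, g.hole_mem _ _ ((e6 h d).not.2 hd), e4], ?_⟩⟩
  have hb := f.bijective.comp g.bijective
  let E : ({d // d ∉ p.holeDarts} ⊕ Σ h, {d // d ∉ (u' h).rootFace}) ≃
      ({d // d ∉ p.holeDarts} ⊕ Σ h, {d // d ∉ (u h).rootFace}) :=
    Equiv.sumCongr (Equiv.refl _) (Equiv.sigmaCongrRight fun h =>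
      (e h).subtypeEquiv fun d => (e6 h d).not.symm)
  convert hb.comp E.bijective using 1
  funext z
  rcases z with z | ⟨h, z⟩ <;> rfl

/-- If each of two maps is contained in the other one, then they are isomorphic. -/
theorem iso_of_gluing_of_gluing {p m : LMap} {mk : p.Hole → Fin p.n} {u : p.Hole → LMap}
    {mk' : m.Hole → Fin m.n} {u' : m.Hole → LMap} (g : GlueMaps p mk u m)
    (g' : GlueMaps m mk' u' p) : p.Iso m := by
  -- The composite and the identity both preserve the root, the reversal and the successor of
  -- non-hole darts, so `rigid` makes them equal. The two inclusions are therefore inverse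
  -- bijections.
  have h1 : g'.fromOuter ∘ g.fromOuter = id := by
    refine rigid p.rev.injective p.nxt.injective ?_ ?_ (fun _ => rfl) ?_ (fun _ _ => rfl)
    · simp [g.outer_root, g'.outer_root]
    · intro d; simp [g.outer_rev, g'.outer_rev]
    · intro d hd
      simp [g.outer_nxt _ hd, g'.outer_nxt _ (g.outer_notMem _ hd)]
  have h2 : g.fromOuter ∘ g'.fromOuter = id := by
    refine rigid m.rev.injective m.nxt.injective ?_ ?_ (fun _ => rfl) ?_ (fun _ _ => rfl)
    · simp [g.outer_root, g'.outer_root]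
    · intro d; simp [g.outer_rev, g'.outer_rev]
    · intro d hd
      simp [g'.outer_nxt _ hd, g.outer_nxt _ (g'.outer_notMem _ hd)]
  have h1' : ∀ d, g'.fromOuter (g.fromOuter d) = d := congrFun h1
  have hmem : ∀ d, g.fromOuter d ∈ m.holeDarts ↔ d ∈ p.holeDarts := by
    intro d
    constructor
    · intro h
      by_contra hd
      exact g.outer_notMem _ hd h
    · intro h
      by_contra hd
      exact g'.outer_notMem _ hd (by rwa [h1'])
  refine ⟨⟨g.fromOuter, g'.fromOuter, h1', congrFun h2⟩, g.outer_root, g.outer_rev,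
    fun d => ?_, hmem⟩
  change g.fromOuter (p.nxt d) = m.nxt (g.fromOuter d)
  by_cases hd : d ∈ p.holeDarts
  -- For a hole dart a gluing says nothing about the successor. But the two candidates are hole
  -- darts of `m` at the same vertex, by `vertex_walk`, and there is at most one such dart.
  · refine m.holes_simple _ ((hmem _).2 ((p.nxt_mem_holeDarts d).2 hd)) _
      ((m.nxt_mem_holeDarts _).2 ((hmem d).2 hd)) ?_
    have hw := p.vertex_walk (R := fun e e' =>
      (m.nxt * m.rev).SameCycle (g.fromOuter e) (g.fromOuter e'))
      ⟨fun _ => Equiv.Perm.SameCycle.refl _ _, fun h => h.symm, fun h h' => h.trans h'⟩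
      (fun e he => ⟨1, by simp [g.outer_nxt _ he, g.outer_rev]⟩) (p.rev d)
    rw [p.rev_rev] at hw
    refine hw.symm.trans ⟨1, ?_⟩
    simp [g.outer_rev, m.rev_rev]
  · exact g.outer_nxt _ hd

end LMap
end QuadHoles

/-! ### Counting cycles, constructing maps, reflexivity of inclusion -/

namespace QuadHoles

theorem card_quotient_of_label {α β : Type*} (σ : Equiv.Perm α) (f : α → β)
    (hf : Function.Surjective f) (h : ∀ x y, f x = f y ↔ σ.SameCycle x y) :
    Nat.card (Quotient (Equiv.Perm.SameCycle.setoid σ)) = Nat.card β := by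
  refine Nat.card_congr (Equiv.ofBijective (Quotient.lift f fun x y hxy => (h x y).2 hxy) ⟨?_, ?_⟩)
  · rintro ⟨x⟩ ⟨y⟩ hxy
    exact Quotient.sound ((h x y).1 hxy)
  · intro b
    obtain ⟨x, rfl⟩ := hf b
    exact ⟨Quotient.mk _ x, rfl⟩

theorem sameCycle_permCongr {α β : Type*} (e : α ≃ β) (σ : Equiv.Perm α) (x y : α) :
    (e.permCongr σ).SameCycle (e x) (e y) ↔ σ.SameCycle x y := by
  have hz : ∀ i : ℤ, (e.permCongr σ) ^ i = e.permCongr (σ ^ i) := fun i =>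
    (map_zpow e.permCongrHom σ i).symm
  simp only [Equiv.Perm.SameCycle, hz, Equiv.permCongr_apply, Equiv.symm_apply_apply,
    EmbeddingLike.apply_eq_iff_eq]

theorem card_quotient_permCongr {α β : Type*} (e : α ≃ β) (σ : Equiv.Perm α) :
    Nat.card (Quotient (Equiv.Perm.SameCycle.setoid (e.permCongr σ)))
      = Nat.card (Quotient (Equiv.Perm.SameCycle.setoid σ)) :=
  (card_quotient_of_label σ (fun x => (Quotient.mk (Equiv.Perm.SameCycle.setoid _) (e x)))
    (fun q => by
      obtain ⟨y, rfl⟩ := q.exists_rep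
      exact ⟨e.symm y, by simp⟩)
    (fun x y => by
      rw [Quotient.eq]
      exact sameCycle_permCongr e σ x y)).symm

/-- Each cycle receives total mass one when its elements are weighted by the inverse of its length.
The number of faces becomes a sum over darts, which can be split along a gluing. -/
theorem card_quotient_sameCycle {α : Type*} [Fintype α] (σ : Equiv.Perm α) :
    (Nat.card (Quotient (Equiv.Perm.SameCycle.setoid σ)) : ℚ)
      = ∑ x, (Nat.card {y // σ.SameCycle x y} : ℚ)⁻¹ := by
  classical
  rw [← Finset.sum_fiberwise (s := Finset.univ)
    (g := fun x => Quotient.mk (Equiv.Perm.SameCycle.setoid σ) x)]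
  rw [Nat.card_eq_fintype_card, ← Finset.card_univ, Finset.card_eq_sum_ones]
  push_cast
  refine Finset.sum_congr rfl fun q _ => ?_
  obtain ⟨x, rfl⟩ := q.exists_rep
  have hc : ∀ y ∈ Finset.univ.filter (fun y => Quotient.mk (Equiv.Perm.SameCycle.setoid σ) y
      = Quotient.mk _ x), (Nat.card {z // σ.SameCycle y z} : ℚ)⁻¹
      = (Nat.card {z // σ.SameCycle x z} : ℚ)⁻¹ := by
    intro y hy
    have hyx : σ.SameCycle y x := Quotient.exact (Finset.mem_filter.1 hy).2
    congr 2
    exact Nat.card_congr (Equiv.subtypeEquivRight fun z =>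
      ⟨fun h => hyx.symm.trans h, fun h => hyx.trans h⟩)
  rw [Finset.sum_congr rfl hc, Finset.sum_const]
  have hcard : (Finset.univ.filter (fun y => Quotient.mk (Equiv.Perm.SameCycle.setoid σ) y
      = Quotient.mk _ x)).card = Nat.card {z // σ.SameCycle x z} := by
    rw [Nat.card_eq_fintype_card, Fintype.card_subtype]
    congr 1
    ext y
    simp only [Finset.mem_filter, Finset.mem_univ, true_and]
    rw [Quotient.eq]
    exact ⟨fun h => Equiv.Perm.SameCycle.symm h, fun h => Equiv.Perm.SameCycle.symm h⟩
  rw [hcard, nsmul_eq_mul, mul_inv_cancel₀]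
  rw [Nat.cast_ne_zero]
  have : Nonempty {z // σ.SameCycle x z} := ⟨⟨x, Equiv.Perm.SameCycle.refl _ _⟩⟩
  exact Nat.card_pos.ne'

/-- A map whose darts are the elements of an arbitrary finite type. -/
theorem exists_lmap {D : Type*} [Finite D] (r t : Equiv.Perm D) (ρ : D) (K : D → Prop)
    (rr : ∀ z, r (r z) = z) (rne : ∀ z, r z ≠ z)
    (conn : ∀ S : D → Prop, S ρ → (∀ z, S (r z) ↔ S z) → (∀ z, S (t z) ↔ S z) → ∀ z, S z)
    (euler : 2 * (Nat.card (Quotient (Equiv.Perm.SameCycle.setoid (t * r)))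
      + Nat.card (Quotient (Equiv.Perm.SameCycle.setoid t))) = Nat.card D + 4)
    (hK : ∀ z, K (t z) ↔ K z) (hρ : ¬ K ρ)
    (deg : ∀ z, ¬ K z → ¬ t.SameCycle ρ z → Nat.card {y // t.SameCycle z y} = 4)
    (simple : ∀ z, K z → ∀ y, K y → (t * r).SameCycle z y → z = y) :
    ∃ (M : LMap) (e : D ≃ Fin M.n), e ρ = M.root ∧ (∀ z, e (r z) = M.rev (e z)) ∧
      (∀ z, e (t z) = M.nxt (e z)) ∧ ∀ z, e z ∈ M.holeDarts ↔ K z := by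
  classical
  let e := Finite.equivFin D
  have hmul : e.permCongr t * e.permCongr r = e.permCongr (t * r) := by
    ext z
    simp [Equiv.permCongr_apply]
  have hsc : ∀ (σ : Equiv.Perm D) z y, (e.permCongr σ).SameCycle z y
      ↔ σ.SameCycle (e.symm z) (e.symm y) := fun σ z y => by
    rw [← sameCycle_permCongr e σ]; simp
  refine ⟨{ n := Nat.card D
            rev := e.permCongr r
            nxt := e.permCongr t
            root := e ρ
            holeDarts := Finset.univ.filter fun z => K (e.symm z)
            rev_rev := fun d => by simp [Equiv.permCongr_apply, rr]
            rev_ne := fun d h => rne (e.symm d) (by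
              rw [Equiv.permCongr_apply, ← Equiv.eq_symm_apply] at h
              exact h)
            connected := fun d => ?_
            euler := by rw [hmul, card_quotient_permCongr, card_quotient_permCongr, euler]
            nxt_mem_holeDarts := fun d => by simp [Equiv.permCongr_apply, hK]
            root_notMem_holeDarts := by simpa using hρ
            face_degree := fun d hd hr => ?_
            holes_simple := fun d hd d' hd' h => ?_ }, e, rfl, fun z => by
              simp [Equiv.permCongr_apply], fun z => by
              simp [Equiv.permCongr_apply], fun z => by simp⟩
  · set G := Subgroup.closure ({e.permCongr r, e.permCongr t} : Set (Equiv.Perm (Fin (Nat.card D))))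
    have hr : e.permCongr r ∈ G := Subgroup.subset_closure (by simp)
    have ht : e.permCongr t ∈ G := Subgroup.subset_closure (by simp)
    have hiff : ∀ σ : Equiv.Perm D, e.permCongr σ ∈ G → ∀ z,
        (∃ g ∈ G, g (e ρ) = e (σ z)) ↔ ∃ g ∈ G, g (e ρ) = e z := by
      intro σ hσ z
      constructor
      · rintro ⟨g, hg, h⟩
        refine ⟨(e.permCongr σ)⁻¹ * g, G.mul_mem (G.inv_mem hσ) hg, ?_⟩
        rw [Equiv.Perm.mul_apply, h, Equiv.Perm.inv_eq_iff_eq]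
        simp [Equiv.permCongr_apply]
      · rintro ⟨g, hg, h⟩
        refine ⟨e.permCongr σ * g, G.mul_mem hσ hg, ?_⟩
        rw [Equiv.Perm.mul_apply, h]
        simp [Equiv.permCongr_apply]
    have := conn (fun z => ∃ g ∈ G, g (e ρ) = e z) ⟨1, G.one_mem, rfl⟩ (hiff r hr) (hiff t ht)
      (e.symm d)
    simpa using this
  · have h1 := deg (e.symm d) (by simpa using hd) (fun h => hr (by rw [hsc]; simpa using h))
    rw [← h1]
    exact Nat.card_congr (e.symm.subtypeEquiv fun z => hsc t d z)
  · rw [hmul, hsc] at h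
    exact e.symm.injective (simple _ (by simpa using hd) _ (by simpa using hd') h)

namespace LMap

/-- The neutral filling of a hole of degree `k`: a cycle of `k` edges whose outside `(i, true)` is
the root face and whose inside `(i, false)` is again a hole. There are `k` vertices and two faces
for `2 * k` darts, in accordance with Euler's formula. -/
theorem exists_cycle (k : ℕ) [NeZero k] : ∃ (M : LMap) (e : ZMod k × Bool ≃ Fin M.n),
    e (0, true) = M.root ∧ (∀ i b, e (i, !b) = M.rev (e (i, b))) ∧
    (∀ i, e (i + 1, true) = M.nxt (e (i, true))) ∧
    (∀ i, e (i - 1, false) = M.nxt (e (i, false))) ∧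
    (∀ i b, e (i, b) ∈ M.holeDarts ↔ b = false) := by
  let r : Equiv.Perm (ZMod k × Bool) :=
    ⟨fun z => (z.1, !z.2), fun z => (z.1, !z.2), fun z => by simp, fun z => by simp⟩
  let t : Equiv.Perm (ZMod k × Bool) :=
    ⟨fun z => (if z.2 then z.1 + 1 else z.1 - 1, z.2),
      fun z => (if z.2 then z.1 - 1 else z.1 + 1, z.2),
      fun ⟨i, b⟩ => by cases b <;> simp, fun ⟨i, b⟩ => by cases b <;> simp⟩
  have tt : ∀ i, t (i, true) = (i + 1, true) := fun i => by simp [t]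
  have tf : ∀ i, t (i, false) = (i - 1, false) := fun i => by simp [t]
  have hface : ∀ x y : ZMod k × Bool, x.2 = y.2 ↔ t.SameCycle x y := by
    have htrue : ∀ i : ZMod k, t.SameCycle (0, true) (i, true) := by
      intro i
      obtain ⟨n, rfl⟩ := ZMod.natCast_zmod_surjective i
      refine ⟨n, ?_⟩
      induction n with
      | zero => simp
      | succ n ih =>
        push_cast
        rw [zpow_natCast] at ih
        rw [← Nat.cast_succ, zpow_natCast, pow_succ', Equiv.Perm.mul_apply, ih, tt]
    have hfalse : ∀ i : ZMod k, t.SameCycle (0, false) (i, false) := by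
      intro i
      obtain ⟨n, hn⟩ := ZMod.natCast_zmod_surjective (-i)
      obtain rfl : i = -n := by rw [hn, neg_neg]
      clear hn
      refine ⟨n, ?_⟩
      induction n with
      | zero => simp
      | succ n ih =>
        push_cast
        rw [zpow_natCast] at ih
        rw [← Nat.cast_succ, zpow_natCast, pow_succ', Equiv.Perm.mul_apply, ih, tf]
        congr 1
        ring
    rintro ⟨i, b⟩ ⟨j, c⟩
    constructor
    · rintro h
      obtain rfl : b = c := h
      cases b
      · exact (hfalse i).symm.trans (hfalse j)
      · exact (htrue i).symm.trans (htrue j)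
    · intro h
      have := (invariant_of_sameCycle (σ := t) (S := fun z => z.2 = b) (fun z => Iff.rfl) h).1 rfl
      exact this.symm
  -- The starting vertex of a dart: `(i, true)` goes from `i` to `i + 1`, and `(i, false)` goes
  -- back.
  let lab : ZMod k × Bool → ZMod k := fun z => if z.2 then z.1 else z.1 + 1
  have hlab : ∀ x y : ZMod k × Bool, lab x = lab y ↔ (t * r).SameCycle x y := by
    have hflip : ∀ i : ZMod k, (t * r).SameCycle (i, false) (i + 1, true) := fun i =>
      ⟨1, by simp [r, tt]⟩
    rintro ⟨i, b⟩ ⟨j, c⟩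
    constructor
    · intro h
      cases b <;> cases c <;> simp only [lab, if_true, Bool.false_eq_true, if_false] at h
      · rw [add_right_cancel h]
      · rw [← h]; exact hflip i
      · rw [h]; exact (hflip j).symm
      · rw [h]
    · intro h
      have := (invariant_of_sameCycle (σ := t * r) (S := fun z => lab z = lab (i, b)) (fun z => ?_)
        h).1 rfl
      · exact this.symm
      · rcases z with ⟨i, b⟩
        cases b <;> simp [lab, r, tt, tf]
  have hk : 0 < k := Nat.pos_of_ne_zero (NeZero.ne k)
  obtain ⟨M, e, h1, h2, h3, h4⟩ := exists_lmap r t (0, true) (fun z => z.2 = false)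
    (fun z => by simp [r]) (fun z h => by
      have := congrArg Prod.snd h
      simp [r] at this)
    (fun S h0 hr ht => by
      have htrue : ∀ n : ℕ, S ((n : ZMod k), true) := by
        intro n
        induction n with
        | zero => simpa using h0
        | succ n ih => push_cast; rw [← tt, ht]; exact ih
      rintro ⟨i, b⟩
      obtain ⟨n, rfl⟩ := ZMod.natCast_zmod_surjective i
      cases b
      · exact (hr _).2 (htrue n)
      · exact htrue n)
    (by
      rw [card_quotient_of_label (t * r) lab (fun i => ⟨(i, true), rfl⟩) hlab,
        card_quotient_of_label t Prod.snd (fun b => ⟨(0, b), rfl⟩) hface]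
      have hB : Nat.card Bool = 2 := by simp
      rw [Nat.card_prod, Nat.card_zmod, hB]
      ring)
    (fun z => Iff.rfl) (by simp)
    (fun z hz hz' => absurd ((hface _ _).1 (by simpa using hz)) hz')
    (fun z hz y hy h => by
      rcases z with ⟨i, b⟩
      rcases y with ⟨j, c⟩
      simp only at hz hy
      subst hz hy
      have := (hlab _ _).2 h
      simp only [lab, Bool.false_eq_true, if_false] at this
      rw [add_right_cancel this])
  refine ⟨M, e, h1, fun i b => h2 (i, b), fun i => ?_, fun i => ?_, fun i b => h4 (i, b)⟩
  · rw [← tt, h3]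
  · rw [← tf, h3]

theorem Hole.degree_pos {p : LMap} (h : p.Hole) : 0 < h.degree := by
  obtain ⟨d, _, hd⟩ := h.2
  exact Finset.card_pos.2 ⟨d, hd ▸ mem_face_self d⟩

/-- Every map is obtained from itself by gluing a cycle into each hole. -/
theorem exists_gluing_self (p : LMap) (mk : p.Hole → Fin p.n) (hmk : ∀ h, mk h ∈ h.1) :
    ∃ u, Nonempty (GlueMaps p mk u p) := by
  have : ∀ h : p.Hole, NeZero h.degree := fun h => ⟨h.degree_pos.ne'⟩
  choose u e e1 e2 e3 e4 e5 using fun h : p.Hole => exists_cycle h.degree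
  have epow : ∀ h (i : ℕ), ((u h).nxt ^ i) (u h).root = e h (i, true) := by
    intro h i
    induction i with
    | zero => simp [e1]
    | succ i ih => rw [pow_succ', Equiv.Perm.mul_apply, ih, ← e3]; push_cast; rfl
  have hroot : ∀ h i b, e h (i, b) ∈ (u h).rootFace ↔ b = true := by
    intro h i b
    constructor
    · intro hx
      have := notMem_holeDarts_of_mem_rootFace hx
      rw [e5] at this
      simpa using this
    · rintro rfl
      obtain ⟨n, rfl⟩ := ZMod.natCast_zmod_surjective i
      rw [← epow]
      exact root_pow_mem _ _
  have hmod : ∀ h (i j : ℕ), (i : ZMod h.degree) = j →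
      (p.nxt⁻¹ ^ i) (mk h) = (p.nxt⁻¹ ^ j) (mk h) := fun h i j hij => by
    rw [h.pow_eq_iff (hmk h)]
    exact (ZMod.natCast_eq_natCast_iff _ _ _).1 hij
  let a : ∀ h : p.Hole, ZMod h.degree → Fin p.n := fun h i => (p.nxt⁻¹ ^ i.val) (mk h)
  have ha : ∀ h (i : ℕ), a h i = (p.nxt⁻¹ ^ i) (mk h) := fun h i => hmod _ _ _ (by simp)
  have hamem : ∀ h i, a h i ∈ h.1 := fun h i => h.pow_mem (hmk h) _
  -- The cycle is laid along the boundary of the hole, its inside on the hole darts and its outside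
  -- on their reversals.
  let φ : ∀ h : p.Hole, ZMod h.degree × Bool → Fin p.n := fun h z =>
    if z.2 then p.rev (a h z.1) else a h z.1
  have hφ : ∀ h z, φ h (z.1, !z.2) = p.rev (φ h z) := by
    rintro h ⟨i, b⟩
    cases b <;> simp [φ, p.rev_rev]
  refine ⟨u, ⟨⟨id, fun h x => φ h ((e h).symm x), fun h => ?_, fun _ => rfl, fun h d => ?_,
    fun h i => ?_, rfl, fun _ _ => rfl, fun h d hd => ?_, fun _ h => h, fun h d hd => ?_, ?_, ?_⟩⟩⟩
  · have hbij := Finset.card_bij (s := (Finset.univ : Finset (ZMod h.degree)))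
      (t := (u h).rootFace) (fun i _ => e h (i, true)) (fun i _ => (hroot h i true).2 rfl)
      (fun i _ j _ hij => by simpa using (e h).injective hij)
      (fun x hx => by
        obtain ⟨⟨i, b⟩, rfl⟩ := (e h).surjective x
        rw [hroot] at hx
        subst hx
        exact ⟨i, Finset.mem_univ _, rfl⟩)
    rw [Finset.card_univ, ZMod.card] at hbij
    exact hbij.symm
  · obtain ⟨⟨i, b⟩, rfl⟩ := (e h).surjective d
    rw [← e2, Equiv.symm_apply_apply, Equiv.symm_apply_apply]
    exact hφ h (i, b)
  · rw [epow, Equiv.symm_apply_apply]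
    simp [φ, ha]
  · obtain ⟨⟨i, b⟩, rfl⟩ := (e h).surjective d
    rw [hroot] at hd
    obtain rfl : b = false := by simpa using hd
    rw [← e4, Equiv.symm_apply_apply, Equiv.symm_apply_apply]
    have : a h i = p.nxt⁻¹ (a h (i - 1)) := by
      obtain ⟨n, hn⟩ := ZMod.natCast_zmod_surjective (i - 1)
      obtain rfl : i = ((n + 1 : ℕ) : ZMod h.degree) := by push_cast; rw [hn]; ring
      rw [← hn, ha, ha, pow_succ', Equiv.Perm.mul_apply]
    simp only [φ, Bool.false_eq_true, if_false, this]
    simp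
  · obtain ⟨⟨i, b⟩, rfl⟩ := (e h).surjective d
    rw [hroot] at hd
    obtain rfl : b = false := by simpa using hd
    rw [e5, Equiv.symm_apply_apply]
    simpa [φ] using h.mem_holeDarts (hamem h i)
  · rintro (⟨d, hd⟩ | ⟨h, x, hx⟩) (⟨d', hd'⟩ | ⟨h', x', hx'⟩) hdd
    · exact congrArg _ (Subtype.ext hdd)
    · obtain ⟨⟨i, b⟩, rfl⟩ := (e h').surjective x'
      rw [hroot] at hx'
      obtain rfl : b = false := by simpa using hx'
      simp only [Sum.elim_inl, Sum.elim_inr, id_eq, Equiv.symm_apply_apply] at hdd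
      exact absurd (h'.mem_holeDarts (hamem h' i)) (by simpa [φ, hdd] using hd)
    · obtain ⟨⟨i, b⟩, rfl⟩ := (e h).surjective x
      rw [hroot] at hx
      obtain rfl : b = false := by simpa using hx
      simp only [Sum.elim_inl, Sum.elim_inr, id_eq, Equiv.symm_apply_apply] at hdd
      exact absurd (h.mem_holeDarts (hamem h i)) (by simpa [φ, ← hdd] using hd')
    · obtain ⟨⟨i, b⟩, rfl⟩ := (e h).surjective x
      rw [hroot] at hx
      obtain rfl : b = false := by simpa using hx
      obtain ⟨⟨i', b'⟩, rfl⟩ := (e h').surjective x'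
      rw [hroot] at hx'
      obtain rfl : b' = false := by simpa using hx'
      simp only [Sum.elim_inr, Equiv.symm_apply_apply, φ, Bool.false_eq_true, if_false] at hdd
      obtain rfl : h = h' := Hole.ext_of_mem (hamem h i) (hdd ▸ hamem h' i')
      obtain rfl : i = i' := by
        have := (h.pow_eq_iff (hmk h) _ _).1 hdd
        have := (ZMod.natCast_eq_natCast_iff _ _ _).2 this
        simpa using this
      rfl
  · intro d
    by_cases hd : d ∈ p.holeDarts
    · obtain ⟨h, hh⟩ := exists_hole hd
      obtain ⟨i, hi⟩ := h.exists_pow (hmk h) hh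
      refine ⟨Sum.inr ⟨h, e h (i, false), by rw [hroot]; simp⟩, ?_⟩
      simp only [Sum.elim_inr, Equiv.symm_apply_apply]
      exact (ha h i).trans hi
    · exact ⟨Sum.inl ⟨d, hd⟩, rfl⟩

end LMap
end QuadHoles

/-! ### Existence of gluings, through Euler's formula -/

namespace QuadHoles
namespace LMap

/-- The carrier is the disjoint union demanded by the field `bijective`, and the successor acts on
each piece separately. Only the reversal mixes pieces: it passes between the outer map and the
fillings through the boundary edges. -/
theorem exists_pasting {p : LMap} {mk : p.Hole → Fin p.n} {u : p.Hole → LMap}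
    (hmk : ∀ h, mk h ∈ h.1) (hper : ∀ h, (u h).perimeter = h.degree) :
    ∃ (D : Type) (_ : Finite D) (r t : Equiv.Perm D), Nonempty (Pasting p mk u D r t) := by
  classical
  let D : Type := {d // d ∉ p.holeDarts} ⊕ Σ h, {d // d ∉ (u h).rootFace}
  have hrn : ∀ h (i : ℕ), p.rev ((p.nxt⁻¹ ^ i) (mk h)) ∉ p.holeDarts := fun h i =>
    rev_notMem_holeDarts (h.mem_holeDarts (h.pow_mem (hmk h) i))
  -- Equality of perimeter and degree enters here. It makes the definitions of `fH` and `fO`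
  -- independent of the chosen indices `idx` and `num`.
  have hmod : ∀ h (i j : ℕ), (p.nxt⁻¹ ^ i) (mk h) = (p.nxt⁻¹ ^ j) (mk h) ↔
      ((u h).nxt ^ i) (u h).root = ((u h).nxt ^ j) (u h).root := fun h i j => by
    rw [h.pow_eq_iff (hmk h), root_pow_eq_iff, hper]
  have hri : ∀ h (x : (u h).rootFace), ∃ i : ℕ, ((u h).nxt ^ i) (u h).root = x.1 :=
    fun h x => exists_root_pow x.2
  choose idx hidx using hri
  let fH : ∀ h, Fin (u h).n → D := fun h x =>
    if hx : x ∈ (u h).rootFace then Sum.inl ⟨_, hrn h (idx h ⟨x, hx⟩)⟩ else Sum.inr ⟨h, x, hx⟩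
  have fH_root : ∀ h (i : ℕ), fH h (((u h).nxt ^ i) (u h).root) = Sum.inl ⟨_, hrn h i⟩ := by
    intro h i
    simp only [fH, dif_pos (root_pow_mem _ i)]
    congr 2
    refine congrArg _ ((hmod _ _ _).2 ?_)
    rw [hidx]
  have fH_not : ∀ h x (hx : x ∉ (u h).rootFace), fH h x = Sum.inr ⟨h, x, hx⟩ := fun h x hx =>
    dif_neg hx
  have hexh : ∀ d : p.holeDarts, ∃ (h : p.Hole) (i : ℕ), (p.nxt⁻¹ ^ i) (mk h) = d.1 := fun d => by
    obtain ⟨h, hh⟩ := exists_hole d.2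
    obtain ⟨i, hi⟩ := h.exists_pow (hmk h) hh
    exact ⟨h, i, hi⟩
  choose hol num hnum using hexh
  let fO : Fin p.n → D := fun d =>
    if hd : d ∈ p.holeDarts then
      fH (hol ⟨d, hd⟩) ((u _).rev (((u _).nxt ^ (num ⟨d, hd⟩)) (u _).root))
    else Sum.inl ⟨d, hd⟩
  have fO_not : ∀ d (hd : d ∉ p.holeDarts), fO d = Sum.inl ⟨d, hd⟩ := fun d hd => dif_neg hd
  have fO_hole : ∀ h (i : ℕ), fO ((p.nxt⁻¹ ^ i) (mk h))
      = fH h ((u h).rev (((u h).nxt ^ i) (u h).root)) := by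
    intro h i
    have hd : (p.nxt⁻¹ ^ i) (mk h) ∈ p.holeDarts := h.mem_holeDarts (h.pow_mem (hmk h) i)
    simp only [fO, dif_pos hd]
    have h1 := hnum ⟨_, hd⟩
    simp only at h1
    have h2 : hol ⟨_, hd⟩ = h := by
      refine Hole.ext_of_mem (Hole.pow_mem _ (hmk _) (num ⟨_, hd⟩)) ?_
      rw [h1]
      exact h.pow_mem (hmk h) i
    generalize num ⟨_, hd⟩ = j at h1
    generalize hol ⟨_, hd⟩ = k at h1 h2
    subst h2
    rw [(hmod _ _ _).1 h1]
  let r : D → D := Sum.elim (fun d => fO (p.rev d.1)) (fun x => fH x.1 ((u x.1).rev x.2.1))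
  have hrev : ∀ h x, fH h ((u h).rev x) = r (fH h x) := by
    intro h x
    by_cases hx : x ∈ (u h).rootFace
    · obtain ⟨i, rfl⟩ := exists_root_pow hx
      rw [fH_root]
      simp only [r, Sum.elim_inl, p.rev_rev, fO_hole]
    · rw [fH_not h x hx]; rfl
  have orev : ∀ d, fO (p.rev d) = r (fO d) := by
    intro d
    by_cases hd : d ∈ p.holeDarts
    · obtain ⟨h, i, rfl⟩ : ∃ h i, (p.nxt⁻¹ ^ i) (mk h) = d := ⟨_, _, hnum ⟨d, hd⟩⟩
      rw [fO_hole, ← hrev, (u h).rev_rev, fH_root, fO_not _ (hrn h i)]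
    · rw [fO_not d hd]; rfl
  have rr : ∀ z, r (r z) = z := by
    rintro (⟨d, hd⟩ | ⟨h, x, hx⟩)
    · rw [← fO_not d hd, ← orev, ← orev, p.rev_rev]
    · rw [← fH_not h x hx, ← hrev, ← hrev, (u h).rev_rev]
  let t : Equiv.Perm D := Equiv.sumCongr
    (p.nxt.subtypeEquiv fun d => (p.nxt_mem_holeDarts d).not.symm)
    (Equiv.sigmaCongrRight fun h => (u h).nxt.subtypeEquiv fun d => nxt_mem_rootFace.not.symm)
  refine ⟨D, inferInstance, ⟨r, r, rr, rr⟩, t, ⟨⟨fO, fH, hmk, hper, orev, hrev, fun h i => ?_,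
    fun d hd => ?_, fun h x hx => ?_, ?_⟩⟩⟩
  · rw [fH_root, fO_not _ (hrn h i)]
  · rw [fO_not d hd, fO_not _ ((p.nxt_mem_holeDarts d).not.2 hd)]; rfl
  · rw [fH_not h x hx, fH_not h _ (nxt_mem_rootFace.not.2 hx)]; rfl
  · have hid : Sum.elim (fun d : {d // d ∉ p.holeDarts} => fO d.1)
        (fun x : Σ h, {d // d ∉ (u h).rootFace} => fH x.1 x.2.1) = id := by
      funext z
      rcases z with ⟨d, hd⟩ | ⟨h, x, hx⟩
      · exact fO_not d hd
      · exact fH_not h x hx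
    rw [hid]
    exact Function.bijective_id

/-- The number of vertices of a map, which are the cycles of `nxt * rev`. -/
noncomputable def numVertices (M : LMap) : ℕ :=
  Nat.card (Quotient (Equiv.Perm.SameCycle.setoid (M.nxt * M.rev)))

/-- The number of faces of a map, which are the cycles of `nxt`. -/
noncomputable def numFaces (M : LMap) : ℕ :=
  Nat.card (Quotient (Equiv.Perm.SameCycle.setoid M.nxt))

/-- The darts of holes. -/
noncomputable def holeDartEquiv (p : LMap) :
    (Σ h : p.Hole, {d // d ∈ h.1}) ≃ {d // d ∈ p.holeDarts} :=
  Equiv.ofBijective (fun x => ⟨x.2.1, x.1.mem_holeDarts x.2.2⟩) ⟨by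
    rintro ⟨h, d, hd⟩ ⟨h', d', hd'⟩ hdd
    obtain rfl : d = d' := congrArg Subtype.val hdd
    obtain rfl := Hole.ext_of_mem hd hd'
    rfl, by
    rintro ⟨d, hd⟩
    obtain ⟨h, hh⟩ := exists_hole hd
    exact ⟨⟨h, d, hh⟩, rfl⟩⟩

theorem sum_holeDarts {p : LMap} {A : Type*} [AddCommMonoid A] (w : Fin p.n → A) :
    ∑ d : {d // d ∈ p.holeDarts}, w d.1 = ∑ h : p.Hole, ∑ d ∈ h.1, w d := by
  rw [← (holeDartEquiv p).sum_comp, Fintype.sum_sigma]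
  refine Finset.sum_congr rfl fun h _ => ?_
  exact Finset.sum_coe_sort h.1 w

theorem card_holeDarts (p : LMap) : p.holeDarts.card = ∑ h : p.Hole, h.degree := by
  have := sum_holeDarts (p := p) (fun _ => 1)
  simpa [Hole.degree] using this

namespace Pasting

variable {p : LMap} {mk : p.Hole → Fin p.n} {u : p.Hole → LMap} {D : Type*}
  {r t : Equiv.Perm D} (g : Pasting p mk u D r t)

include g

theorem sum_darts [Fintype D] {A : Type*} [AddCommMonoid A] (w : D → A) :
    ∑ z, w z = ∑ d : {d // d ∉ p.holeDarts}, w (g.fromOuter d.1)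
      + ∑ h, ∑ x : {x // x ∉ (u h).rootFace}, w (g.fromHole h x.1) := by
  classical
  rw [← (Equiv.ofBijective _ g.bijective).sum_comp, Fintype.sum_sum_type, Fintype.sum_sigma]
  rfl

/-- What disappears is the set of hole darts of `p` and the root-face darts of the fillings, so the
degree of each hole is lost twice. -/
theorem card_darts [Finite D] :
    Nat.card D + 2 * ∑ h : p.Hole, h.degree = p.n + ∑ h, (u h).n := by
  classical
  have := Fintype.ofFinite D
  have h1 := g.sum_darts (fun _ => 1)
  have h2 : ∀ h : p.Hole, Fintype.card {x // x ∉ (u h).rootFace} + h.degree = (u h).n := by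
    intro h
    have h3 := Fintype.card_subtype_compl (fun x => x ∈ (u h).rootFace)
    have h4 : Fintype.card {x // x ∈ (u h).rootFace} = h.degree := by
      rw [← g.perimeter_eq, Fintype.card_coe]; rfl
    have h5 := Fintype.card_subtype_le (fun x => x ∈ (u h).rootFace)
    rw [Fintype.card_fin] at h3 h5
    omega
  have h6 : Fintype.card {x // x ∉ p.holeDarts} + ∑ h : p.Hole, h.degree = p.n := by
    have h3 := Fintype.card_subtype_compl (fun x => x ∈ p.holeDarts)
    have h4 : Fintype.card {x // x ∈ p.holeDarts} = ∑ h : p.Hole, h.degree := by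
      rw [← card_holeDarts, Fintype.card_coe]
    have h5 := Fintype.card_subtype_le (fun x => x ∈ p.holeDarts)
    rw [Fintype.card_fin] at h3 h5
    omega
  simp only [Finset.sum_const, Finset.card_univ, smul_eq_mul, mul_one] at h1
  have h7 := Finset.sum_congr (rfl : (Finset.univ : Finset p.Hole) = _) fun h _ => h2 h
  rw [Finset.sum_add_distrib] at h7
  rw [Nat.card_eq_fintype_card]
  omega

/-- Each hole disappears together with the root face of its filling, and all other faces keep their
degrees. Counted by inverse degrees, each of these lost faces weighs exactly one. -/
theorem card_faces [Finite D] :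
    Nat.card (Quotient (Equiv.Perm.SameCycle.setoid t)) + 2 * Fintype.card p.Hole
      = p.numFaces + ∑ h, (u h).numFaces := by
  classical
  have := Fintype.ofFinite D
  have hsplit : ∀ {n : ℕ} (s : Finset (Fin n)) (w : Fin n → ℚ),
      ∑ x, w x = ∑ x : {x // x ∈ s}, w x.1 + ∑ x : {x // x ∉ s}, w x.1 := fun s w => by
    convert (Fintype.sum_subtype_add_sum_subtype (fun x => x ∈ s) w).symm
  have hp : (p.numFaces : ℚ) = Fintype.card p.Hole
      + ∑ d : {d // d ∉ p.holeDarts}, (Nat.card {e // p.nxt.SameCycle d.1 e} : ℚ)⁻¹ := by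
    rw [numFaces, card_quotient_sameCycle, hsplit p.holeDarts,
      sum_holeDarts (fun d => (Nat.card {e // p.nxt.SameCycle d e} : ℚ)⁻¹)]
    congr 1
    have : ∀ h : p.Hole, ∑ d ∈ h.1, (Nat.card {e // p.nxt.SameCycle d e} : ℚ)⁻¹ = 1 := by
      intro h
      rw [Finset.sum_congr rfl fun d hd => by rw [← card_face, h.face_eq hd], Finset.sum_const,
        nsmul_eq_mul, mul_inv_cancel₀ (by exact_mod_cast h.degree_pos.ne')]
    rw [Finset.sum_congr rfl fun h _ => this h]
    simp
  have hu : ∀ h, ((u h).numFaces : ℚ) = 1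
      + ∑ d : {d // d ∉ (u h).rootFace}, (Nat.card {e // (u h).nxt.SameCycle d.1 e} : ℚ)⁻¹ := by
    intro h
    rw [numFaces, card_quotient_sameCycle, hsplit (u h).rootFace]
    congr 1
    rw [Finset.sum_coe_sort (u h).rootFace
      (fun d => (Nat.card {e // (u h).nxt.SameCycle d e} : ℚ)⁻¹),
      Finset.sum_congr rfl fun d hd => by
      rw [← card_face, ← face_eq_face_iff.2 (mem_rootFace.1 hd)], Finset.sum_const,
      nsmul_eq_mul]
    refine mul_inv_cancel₀ ?_
    exact_mod_cast (Finset.card_pos.2 ⟨(u h).root, root_mem_rootFace⟩).ne'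
  have ht := card_quotient_sameCycle t
  rw [g.sum_darts, Finset.sum_congr rfl fun d _ => by rw [g.card_outer_cycle d.2],
    Finset.sum_congr rfl fun h _ => Finset.sum_congr rfl fun x _ => by
      rw [g.card_hole_cycle x.2]] at ht
  have : ((Nat.card (Quotient (Equiv.Perm.SameCycle.setoid t)) + 2 * Fintype.card p.Hole : ℕ) : ℚ)
      = (p.numFaces + ∑ h, (u h).numFaces : ℕ) := by
    push_cast
    rw [ht, hp, Finset.sum_congr rfl fun h _ => hu h, Finset.sum_add_distrib]
    simp only [Finset.sum_const, Finset.card_univ, nsmul_eq_mul, mul_one]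
    ring
  exact_mod_cast this

theorem rev_ne (z : D) : r z ≠ z := by
  intro h
  rcases g.cases z with ⟨d, hd, rfl⟩ | ⟨k, x, hx, rfl⟩
  · rw [← g.outer_rev] at h
    by_cases hr : p.rev d ∈ p.holeDarts
    · obtain ⟨k, hk⟩ := exists_hole hr
      obtain ⟨i, hi⟩ := k.exists_pow (g.mk_mem k) hk
      have hd' : d = p.rev ((p.nxt⁻¹ ^ i) (mk k)) := by rw [hi, p.rev_rev]
      rw [← hi, hd', g.outer_hole, g.glued] at h
      exact (u k).rev_ne _ (g.hole_injective k h)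
    · exact p.rev_ne _ (g.outer_inj hr hd h)
  · rw [← g.hole_rev] at h
    exact (u k).rev_ne _ (g.hole_injective k h)

/-- Every vertex of the glued map comes either from a vertex of the outer map that does not belong
to a hole, or from a vertex of a map in a hole. -/
theorem exists_vertex_label : ∃ v : D →
      {c : Quotient (Equiv.Perm.SameCycle.setoid (p.nxt * p.rev)) //
        ¬ ∃ a ∈ p.holeDarts, Quotient.mk _ a = c} ⊕
      Σ h, Quotient (Equiv.Perm.SameCycle.setoid ((u h).nxt * (u h).rev)),
    Function.Surjective v ∧ (∀ z z', v z = v z' ↔ (t * r).SameCycle z z') ∧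
    ∀ h x, v (g.fromHole h x) = Sum.inr ⟨h, Quotient.mk _ x⟩ := by
  classical
  let T := {c : Quotient (Equiv.Perm.SameCycle.setoid (p.nxt * p.rev)) //
        ¬ ∃ a ∈ p.holeDarts, Quotient.mk _ a = c} ⊕
      Σ h, Quotient (Equiv.Perm.SameCycle.setoid ((u h).nxt * (u h).rev))
  let vu : ∀ h, Fin (u h).n → T := fun h x => Sum.inr ⟨h, Quotient.mk _ x⟩
  have hvu : ∀ h x, vu h ((u h).nxt ((u h).rev x)) = vu h x := by
    intro h x
    simp only [vu]
    congr 2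
    refine Quotient.sound ?_
    exact Equiv.Perm.SameCycle.symm ⟨1, by simp⟩
  have hdich : ∀ e, (∃ h, ∃ i : ℕ, (p.nxt * p.rev).SameCycle e ((p.nxt⁻¹ ^ i) (mk h))) ∨
      ¬ ∃ a ∈ p.holeDarts, Quotient.mk (Equiv.Perm.SameCycle.setoid (p.nxt * p.rev)) a
        = Quotient.mk _ e := by
    intro e
    rw [or_iff_not_imp_right, not_not]
    rintro ⟨a, ha, hae⟩
    obtain ⟨h, hh⟩ := exists_hole ha
    obtain ⟨i, hi⟩ := h.exists_pow (g.mk_mem h) hh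
    exact ⟨h, i, hi ▸ (Quotient.exact hae : (p.nxt * p.rev).SameCycle a e).symm⟩
  -- A vertex on the boundary of a hole takes its label from the filling. The hole dart at position
  -- `i` is glued to the reversal of the boundary dart `i` of the filling, which starts where the
  -- boundary dart `i + 1` starts; hence the shift.
  have hexv : ∀ e, ∃ τ : T,
      (∀ h (i : ℕ), (p.nxt * p.rev).SameCycle e ((p.nxt⁻¹ ^ i) (mk h)) →
        τ = vu h (((u h).nxt ^ (i + 1)) (u h).root)) ∧
      (∀ hc : ¬ ∃ a ∈ p.holeDarts, Quotient.mk _ a = Quotient.mk _ e,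
        τ = Sum.inl ⟨Quotient.mk _ e, hc⟩) := by
    intro e
    rcases hdich e with ⟨h, i, hi⟩ | hc
    · refine ⟨vu h (((u h).nxt ^ (i + 1)) (u h).root), fun h' j hj => ?_, fun hc => ?_⟩
      · have heq := p.holes_simple _ (h.mem_holeDarts (g.pow_mk_mem h i)) _
          (h'.mem_holeDarts (g.pow_mk_mem h' j)) (hi.symm.trans hj)
        obtain rfl : h = h' := Hole.ext_of_mem (g.pow_mk_mem h i) (heq ▸ g.pow_mk_mem h' j)
        rw [h.pow_eq_iff (g.mk_mem h), ← g.perimeter_eq, ← root_pow_eq_iff] at heq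
        rw [pow_succ', pow_succ', Equiv.Perm.mul_apply, Equiv.Perm.mul_apply, heq]
      · exact absurd ⟨_, h.mem_holeDarts (g.pow_mk_mem h i),
          Quotient.sound (show (p.nxt * p.rev).SameCycle _ _ from hi.symm)⟩ hc
    · refine ⟨Sum.inl ⟨_, hc⟩, fun h i hi => ?_, fun _ => rfl⟩
      exact absurd ⟨_, h.mem_holeDarts (g.pow_mk_mem h i),
          Quotient.sound (show (p.nxt * p.rev).SameCycle _ _ from hi.symm)⟩ hc
  choose vp hvp1 hvp2 using hexv
  have hvp : ∀ e, vp (p.nxt (p.rev e)) = vp e := by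
    intro e
    have hs : (p.nxt * p.rev).SameCycle e (p.nxt (p.rev e)) := ⟨1, by simp⟩
    have hq : Quotient.mk (Equiv.Perm.SameCycle.setoid (p.nxt * p.rev)) (p.nxt (p.rev e))
        = Quotient.mk _ e := Quotient.sound (show (p.nxt * p.rev).SameCycle _ _ from hs.symm)
    rcases hdich e with ⟨h, i, hi⟩ | hc
    · rw [hvp1 e h i hi, hvp1 _ h i (hs.symm.trans hi)]
    · rw [hvp2 e hc, hvp2 (p.nxt (p.rev e)) (by rw [hq]; exact hc)]
      simp only [hq]
  have hva : ∀ h (i : ℕ), vp ((p.nxt⁻¹ ^ i) (mk h)) = vu h (((u h).nxt ^ (i + 1)) (u h).root) :=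
    fun h i => hvp1 _ h i (Equiv.Perm.SameCycle.refl _ _)
  have hvra : ∀ h (i : ℕ), vp (p.rev ((p.nxt⁻¹ ^ i) (mk h)))
      = vu h (((u h).nxt ^ i) (u h).root) := by
    intro h i
    have h1 : ∃ j, (p.nxt⁻¹ ^ i) (mk h) = (p.nxt⁻¹ ^ (j + 1)) (mk h) ∧
        ((u h).nxt ^ i) (u h).root = ((u h).nxt ^ (j + 1)) (u h).root := by
      -- The predecessor of `i` modulo the degree; adding the degree makes the subtraction harmless
      -- for `i = 0`.
      refine ⟨i + h.degree - 1, ?_⟩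
      have hpos := h.degree_pos
      rw [Nat.sub_add_cancel (by omega), h.pow_eq_iff (g.mk_mem h), root_pow_eq_iff,
        g.perimeter_eq]
      simp [Nat.ModEq]
    obtain ⟨j, h1, h2⟩ := h1
    rw [← hvp, p.rev_rev, h1, h2, ← hva, pow_succ', Equiv.Perm.mul_apply]
    simp
  -- The pushout property requires a target with a reversal. Recording the labels of both ends of an
  -- edge, with reversal the swap, provides one; the label of a dart is the first component.
  obtain ⟨γ, hγ1, hγ2⟩ := g.exists_desc (N := T × T) (rN := Prod.swap)
    (α := fun d => (vp d, vp (p.rev d))) (β := fun h x => (vu h x, vu h ((u h).rev x)))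
    (fun d => by simp [p.rev_rev]) (fun h x => by simp [(u h).rev_rev])
    (fun h i => by
      rw [p.rev_rev, hvra, hva, pow_succ', Equiv.Perm.mul_apply]
      have := hvu h ((u h).rev (((u h).nxt ^ i) (u h).root))
      rw [(u h).rev_rev] at this
      rw [this])
  let v : D → T := fun z => (γ z).1
  have hv1 : ∀ d, v (g.fromOuter d) = vp d := fun d => by simp [v, hγ1]
  have hv2 : ∀ h x, v (g.fromHole h x) = vu h x := fun h x => by simp [v, hγ2]
  have hn1 : ∀ d, d ∉ p.holeDarts → v (t (g.fromOuter d)) = vp (p.nxt d) := fun d hd => by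
    rw [← g.outer_nxt d hd, hv1]
  have hn2 : ∀ h x, v (t (g.fromHole h x)) = vu h ((u h).nxt x) := by
    intro h x
    by_cases hx : x ∈ (u h).rootFace
    · obtain ⟨i, rfl⟩ := exists_root_pow hx
      rw [← g.glued, hn1 _ (g.rev_pow_mk_notMem h i), hvp, hva, pow_succ', Equiv.Perm.mul_apply]
    · rw [← g.hole_nxt _ _ hx, hv2]
  have hinv : ∀ z, v ((t * r) z) = v z := by
    intro z
    rw [Equiv.Perm.mul_apply]
    rcases g.cases z with ⟨d, -, rfl⟩ | ⟨h, x, -, rfl⟩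
    · rw [← g.outer_rev, hv1]
      by_cases hd : p.rev d ∈ p.holeDarts
      · obtain ⟨h, hh⟩ := exists_hole hd
        obtain ⟨i, hi⟩ := h.exists_pow (g.mk_mem h) hh
        have hd' : d = p.rev ((p.nxt⁻¹ ^ i) (mk h)) := by rw [hi, p.rev_rev]
        rw [← hi, hd', g.outer_hole, hn2, hvra, hvu]
      · rw [hn1 _ hd, hvp]
    · rw [← g.hole_rev, hn2, hvu, hv2]
  have hR : Equivalence (fun z z' => (t * r).SameCycle z z') :=
    ⟨fun _ => Equiv.Perm.SameCycle.refl _ _, fun h => h.symm, fun h h' => h.trans h'⟩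
  have hstep : ∀ z, (t * r).SameCycle z (t (r z)) := fun z => ⟨1, by simp⟩
  have houter : ∀ d d', (p.nxt * p.rev).SameCycle d d' →
      (t * r).SameCycle (g.fromOuter d) (g.fromOuter d') := fun d d' h =>
    (invariant_of_sameCycle (S := fun e => (t * r).SameCycle (g.fromOuter d) (g.fromOuter e))
      (fun e => by
        have := g.outer_vertex hR hstep e
        exact ⟨fun h => h.trans this.symm, fun h => h.trans this⟩) h).1
      (Equiv.Perm.SameCycle.refl _ _)
  have hhole : ∀ h x x', ((u h).nxt * (u h).rev).SameCycle x x' →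
      (t * r).SameCycle (g.fromHole h x) (g.fromHole h x') := fun h x x' hx =>
    (invariant_of_sameCycle (S := fun e => (t * r).SameCycle (g.fromHole h x) (g.fromHole h e))
      (fun e => by
        have := g.hole_vertex hR hstep h e
        exact ⟨fun h => h.trans this.symm, fun h => h.trans this⟩) hx).1
      (Equiv.Perm.SameCycle.refl _ _)
  -- One representative dart for each label. Every dart lies at the vertex of the representative of
  -- its own label, so darts with equal labels are at the same vertex.
  let s : T → D := Sum.elim (fun c => g.fromOuter c.1.out) (fun c => g.fromHole c.1 c.2.out)
  have hs : ∀ τ, v (s τ) = τ := by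
    rintro (⟨c, hc⟩ | ⟨h, c⟩)
    · simp only [s, Sum.elim_inl, hv1]
      rw [hvp2 c.out (by rw [Quotient.out_eq]; exact hc)]
      simp only [Quotient.out_eq]
    · simp only [s, Sum.elim_inr, hv2, vu, Quotient.out_eq]
  have hout : ∀ h x, (t * r).SameCycle (g.fromHole h x) (s (vu h x)) := fun h x =>
    hhole h x _ (Quotient.exact (s := Equiv.Perm.SameCycle.setoid _) (Quotient.out_eq _).symm)
  have hsv : ∀ z, (t * r).SameCycle z (s (v z)) := by
    intro z
    rcases g.cases z with ⟨d, -, rfl⟩ | ⟨h, x, -, rfl⟩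
    · rw [hv1]
      rcases hdich d with ⟨h, i, hi⟩ | hc
      · rw [hvp1 d h i hi]
        refine (houter _ _ hi).trans ?_
        rw [g.outer_hole]
        exact (g.outer_hole_vertex hR hstep h i).trans (hout h _)
      · rw [hvp2 d hc]
        exact houter _ _
          (Quotient.exact (s := Equiv.Perm.SameCycle.setoid _) (Quotient.out_eq _).symm)
    · rw [hv2]
      exact hout h x
  refine ⟨v, fun τ => ⟨s τ, hs τ⟩, fun z z' => ⟨fun h => ?_, fun h => ?_⟩, hv2⟩
  · exact (hsv z).trans (h ▸ (hsv z').symm)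
  · exact ((invariant_of_sameCycle (S := fun y => v y = v z) (fun y => by rw [hinv]) h).1
      rfl).symm

/-- The hole boundaries being simple and disjoint, the vertices of `p` on holes are as many as the
hole darts. They are absorbed by the vertices of the fillings, even when a non-simple filling
identifies some of them, and the other vertices are kept. -/
theorem card_vertices : Nat.card (Quotient (Equiv.Perm.SameCycle.setoid (t * r)))
      + ∑ h : p.Hole, h.degree = p.numVertices + ∑ h, (u h).numVertices := by
  classical
  obtain ⟨v, hv, hv', -⟩ := g.exists_vertex_label
  have : ∀ h, Finite (Quotient (Equiv.Perm.SameCycle.setoid ((u h).nxt * (u h).rev))) :=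
    fun h => Quotient.finite _
  rw [card_quotient_of_label _ v hv hv', Nat.card_sum, Nat.card_sigma]
  let C := Quotient (Equiv.Perm.SameCycle.setoid (p.nxt * p.rev))
  have h1 : Nat.card {c : C // ∃ a ∈ p.holeDarts, Quotient.mk _ a = c}
      = ∑ h : p.Hole, h.degree := by
    rw [← card_holeDarts, ← Fintype.card_coe, ← Nat.card_eq_fintype_card]
    refine (Nat.card_congr (Equiv.ofBijective
      (fun a : p.holeDarts => ⟨Quotient.mk _ a.1, a.1, a.2, rfl⟩) ⟨?_, ?_⟩)).symm
    · rintro ⟨a, ha⟩ ⟨b, hb⟩ hab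
      exact Subtype.ext (p.holes_simple a ha b hb (Quotient.exact (congrArg Subtype.val hab)))
    · rintro ⟨c, a, ha, rfl⟩
      exact ⟨⟨a, ha⟩, rfl⟩
  have h2 : p.numVertices = Nat.card {c : C // ∃ a ∈ p.holeDarts, Quotient.mk _ a = c}
      + Nat.card {c : C // ¬ ∃ a ∈ p.holeDarts, Quotient.mk _ a = c} := by
    rw [numVertices, ← Nat.card_sum]
    exact Nat.card_congr (Equiv.sumCompl _).symm
  rw [h2, h1]
  simp only [numVertices]
  ring

end Pasting

/-- Any family of maps with the right perimeters can be glued into the holes of a map. -/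
theorem exists_gluing {p : LMap} {mk : p.Hole → Fin p.n} {u : p.Hole → LMap}
    (hmk : ∀ h, mk h ∈ h.1) (hper : ∀ h, (u h).perimeter = h.degree) :
    ∃ m, Nonempty (GlueMaps p mk u m) := by
  obtain ⟨D, _, r, t, ⟨g⟩⟩ := exists_pasting hmk hper
  let K : D → Prop := fun z => ∃ h x, x ∈ (u h).holeDarts ∧ g.fromHole h x = z
  have hKo : ∀ d, d ∉ p.holeDarts → ¬ K (g.fromOuter d) := by
    rintro d hd ⟨h, x, hx, he⟩
    exact notMem_holeDarts_of_mem_rootFace (g.mem_rootFace_iff.2 ⟨d, hd, he.symm⟩) hx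
  have hKh : ∀ h x, K (g.fromHole h x) ↔ x ∈ (u h).holeDarts := by
    intro h x
    constructor
    · rintro ⟨h', x', hx', he⟩
      have := g.hole_inj he
      cases this
      exact hx'
    · exact fun hx => ⟨h, x, hx, rfl⟩
  obtain ⟨m, e, e1, e2, e3, e4⟩ := exists_lmap r t (g.fromOuter p.root) K g.rev_rev g.rev_ne
    (fun S h0 hr ht => g.induction h0 hr ht) (by
      -- In passing from the parts to the glued map, twice the number of vertices and faces drops by
      -- twice the total degree plus four per hole, and the number of darts by twice the total
      -- degree. The surplus of four per hole is the constant in Euler's formula of the fillings.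
      have h1 := g.card_darts
      have h2 := g.card_faces
      have h3 := g.card_vertices
      have h4 : 2 * (p.numVertices + p.numFaces) = p.n + 4 := p.euler
      have h5 : 2 * (∑ h, (u h).numVertices + ∑ h, (u h).numFaces)
          = ∑ h, (u h).n + 4 * Fintype.card p.Hole := by
        have : ∀ h, 2 * ((u h).numVertices + (u h).numFaces) = (u h).n + 4 := fun h => (u h).euler
        rw [← Finset.sum_add_distrib, Finset.mul_sum, Finset.sum_congr rfl fun h _ => this h,
          Finset.sum_add_distrib]
        simp [mul_comm]
      omega)
    (by
      intro z
      rcases g.cases z with ⟨d, hd, rfl⟩ | ⟨h, x, hx, rfl⟩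
      · rw [← g.outer_nxt d hd]
        exact iff_of_false (hKo _ ((p.nxt_mem_holeDarts d).not.2 hd)) (hKo d hd)
      · rw [← g.hole_nxt h x hx, hKh, hKh, (u h).nxt_mem_holeDarts])
    (hKo _ p.root_notMem_holeDarts)
    (by
      intro z hz hr
      rcases g.cases z with ⟨d, hd, rfl⟩ | ⟨h, x, hx, rfl⟩
      · rw [g.card_outer_cycle hd]
        exact p.face_degree d hd
          fun h => hr ((g.outer_sameCycle_outer p.root_notMem_holeDarts hd).2 h)
      · rw [g.card_hole_cycle hx]
        exact (u h).face_degree x (fun h' => hz ((hKh h x).2 h')) fun h' => hx (mem_rootFace.2 h'))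
    (by
      -- The label of a vertex of a filling remembers both the filling and the vertex, so two hole
      -- darts at one vertex come from the same filling, whose own holes are simple and disjoint.
      obtain ⟨v, -, hv, hv'⟩ := g.exists_vertex_label
      rintro z ⟨h, x, hx, rfl⟩ z' ⟨h', x', hx', rfl⟩ hzz
      rw [← hv, hv', hv', Sum.inr.injEq, Sigma.mk.injEq] at hzz
      obtain ⟨rfl, hq⟩ := hzz
      rw [(u h).holes_simple x hx x' hx' (Quotient.exact (eq_of_heq hq))])
  refine ⟨m, ⟨⟨fun d => e (g.fromOuter d), fun h x => e (g.fromHole h x), hper,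
    fun d => by rw [g.outer_rev, e2], fun h x => by rw [g.hole_rev, e2],
    fun h i => by rw [g.glued], e1, fun d hd => by rw [g.outer_nxt d hd, e3],
    fun h x hx => by rw [g.hole_nxt h x hx, e3],
    fun d hd => by rw [e4]; exact hKo d hd, fun h x _ => by rw [e4, hKh], ?_⟩⟩⟩
  convert e.bijective.comp g.bijective using 1
  funext z
  rcases z with z | z <;> rfl

end LMap
end QuadHoles

/-! ### Transitivity of inclusion -/

namespace QuadHoles
namespace LMap

/-- A hole of a filling is disjoint from the root face of the filling, so it survives as a face of
the glued map, and as a hole. -/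
theorem GlueMaps.hole_of_hole {A B : LMap} {mk : A.Hole → Fin A.n} {v : A.Hole → LMap}
    (g : GlueMaps A mk v B) (hmk : ∀ h, mk h ∈ h.1) (h : A.Hole) (h' : (v h).Hole) :
    ∃ k : B.Hole, k.degree = h'.degree ∧ (∀ x ∈ h'.1, g.fromHole h x ∈ k.1) ∧
      ∀ y ∈ k.1, ∃ x ∈ h'.1, g.fromHole h x = y := by
  obtain ⟨x, hx, hf⟩ := h'.2
  have hxr : x ∉ (v h).rootFace := fun hr => notMem_holeDarts_of_mem_rootFace hr hx
  have hxm : x ∈ h'.1 := hf ▸ mem_face_self x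
  refine ⟨⟨B.face (g.fromHole h x), _, (g.hole_mem h x hxr).2 hx, rfl⟩, ?_, fun x' hx' => ?_,
    fun y hy => ?_⟩
  · simp only [Hole.degree]
    rw [card_face, ← hf, card_face]
    exact (g.toPasting hmk).card_hole_cycle hxr
  · rw [mem_face]
    exact ((g.toPasting hmk).hole_sameCycle hxr).2 ⟨x', (h'.mem_iff hxm).1 hx', rfl⟩
  · rw [mem_face] at hy
    obtain ⟨x', h1, h2⟩ := ((g.toPasting hmk).hole_sameCycle hxr).1 hy
    exact ⟨x', (h'.mem_iff hxm).2 h1, h2⟩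

theorem GlueMaps.hole_inv_pow {A B : LMap} {mk : A.Hole → Fin A.n} {v : A.Hole → LMap}
    (g : GlueMaps A mk v B) (h : A.Hole) {x : Fin (v h).n} (hx : x ∉ (v h).rootFace) (i : ℕ) :
    g.fromHole h (((v h).nxt⁻¹ ^ i) x) = (B.nxt⁻¹ ^ i) (g.fromHole h x) := by
  induction i with
  | zero => simp
  | succ i ih =>
    have hn : ((v h).nxt⁻¹ ^ (i + 1)) x ∉ (v h).rootFace :=
      (invariant_of_sameCycle (S := (· ∈ (v h).rootFace)) (fun _ => nxt_mem_rootFace)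
        (sameCycle_inv_pow _ x (i + 1))).not.1 hx
    apply B.nxt.injective
    rw [← g.hole_nxt _ _ hn, pow_succ', pow_succ', Equiv.Perm.mul_apply, Equiv.Perm.mul_apply, ← ih]
    simp

/-- Gluing maps into the holes of a glued map amounts to gluing them first into the holes of its
parts. -/
theorem exists_gluing_trans {A B C : LMap} {mkA : A.Hole → Fin A.n} {v : A.Hole → LMap}
    {mkB : B.Hole → Fin B.n} {U : B.Hole → LMap} (g₁ : GlueMaps A mkA v B)
    (g₂ : GlueMaps B mkB U C) (hA : ∀ h, mkA h ∈ h.1) (hB : ∀ h, mkB h ∈ h.1) :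
    ∃ w, Nonempty (GlueMaps A mkA w C) := by
  let G₁ := g₁.toPasting hA
  let G₂ := g₂.toPasting hB
  choose κ hκd hκ1 hκ2 using g₁.hole_of_hole hA
  -- The marked dart of each hole of `v h` is pulled back from `B`, so that both gluings read the
  -- boundary from the same edge. The map `w h` to be put into the hole `h` of `A` is then `v h`
  -- with its own holes filled.
  choose mk hmk hmk' using fun h h' => hκ2 h h' _ (hB (κ h h'))
  choose w hw using fun h => exists_gluing (p := v h) (mk := mk h) (u := fun h' => U (κ h h'))
    (hmk h) (fun h' => (g₂.perimeter_eq _).trans (hκd h h'))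
  have gw : ∀ h, GlueMaps (v h) (mk h) (fun h' => U (κ h h')) (w h) := fun h => (hw h).some
  have hnr : ∀ h {x}, x ∈ (v h).holeDarts → x ∉ (v h).rootFace := fun h x hx hr =>
    notMem_holeDarts_of_mem_rootFace hr hx
  -- The pushout property of `w h` sends it into `C`, compatibly with `v h` placed in `B` and with
  -- the fillings placed in `C`.
  choose γ hγo hγh using fun h => ((gw h).toPasting (hmk h)).exists_desc (N := Fin C.n)
    (rN := C.rev) (α := fun x => g₂.fromOuter (g₁.fromHole h x))
    (β := fun h' z => g₂.fromHole (κ h h') z)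
    (fun d => by rw [g₁.hole_rev, g₂.outer_rev]) (fun h' z => g₂.hole_rev _ _)
    (fun h' i => by
      rw [g₁.hole_rev, g₁.hole_inv_pow h (hnr h (h'.mem_holeDarts (hmk h h'))), hmk', g₂.glued])
  change ∀ h d, γ h ((gw h).fromOuter d) = _ at hγo
  change ∀ h h' z, γ h ((gw h).fromHole h' z) = _ at hγh
  have hcases : ∀ h y, y ∉ (w h).rootFace →
      (∃ x, x ∉ (v h).holeDarts ∧ x ∉ (v h).rootFace ∧ (gw h).fromOuter x = y) ∨
      ∃ h' z, z ∉ (U (κ h h')).rootFace ∧ (gw h).fromHole h' z = y := by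
    intro h y hy
    rcases ((gw h).toPasting (hmk h)).cases y with ⟨x, hx, rfl⟩ | ⟨h', z, hz, rfl⟩
    · exact Or.inl ⟨x, hx, (((gw h).outer_mem_rootFace (hmk h) hx).not).1 hy, rfl⟩
    · exact Or.inr ⟨h', z, hz, rfl⟩
  have hknot : ∀ h {x}, x ∉ (v h).holeDarts → x ∉ (v h).rootFace →
      g₁.fromHole h x ∉ B.holeDarts := fun h x hx hx' => (g₁.hole_mem h x hx').not.2 hx
  refine ⟨w, ⟨⟨fun d => g₂.fromOuter (g₁.fromOuter d), γ, fun h => ?_, fun d => ?_, fun h y => ?_,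
    fun h i => ?_, ?_, fun d hd => ?_, fun h y hy => ?_, fun d hd => ?_, fun h y hy => ?_,
    ?_, ?_⟩⟩⟩
  · rw [(gw h).perimeter (hmk h), g₁.perimeter_eq]
  · rw [g₁.outer_rev, g₂.outer_rev]
  · rcases ((gw h).toPasting (hmk h)).cases y with ⟨x, -, rfl⟩ | ⟨h', z, -, rfl⟩
    · change γ h ((w h).rev ((gw h).fromOuter x)) = C.rev (γ h ((gw h).fromOuter x))
      rw [← (gw h).outer_rev, hγo, hγo, g₁.hole_rev, g₂.outer_rev]
    · change γ h ((w h).rev ((gw h).fromHole h' z)) = C.rev (γ h ((gw h).fromHole h' z))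
      rw [← (gw h).hole_rev, hγh, hγh, g₂.hole_rev]
  · rw [g₁.glued, ← (gw h).root_pow (hmk h), hγo]
  · rw [g₁.outer_root, g₂.outer_root]
  · rw [g₁.outer_nxt d hd, g₂.outer_nxt _ (g₁.outer_notMem d hd)]
  · rcases hcases h y hy with ⟨x, hx, hx', rfl⟩ | ⟨h', z, hz, rfl⟩
    · rw [← (gw h).outer_nxt x hx, hγo, hγo, g₁.hole_nxt h x hx', g₂.outer_nxt _ (hknot h hx hx')]
    · rw [← (gw h).hole_nxt h' z hz, hγh, hγh, g₂.hole_nxt _ z hz]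
  · exact g₂.outer_notMem _ (g₁.outer_notMem d hd)
  · rcases hcases h y hy with ⟨x, hx, hx', rfl⟩ | ⟨h', z, hz, rfl⟩
    · rw [hγo]
      exact iff_of_false (g₂.outer_notMem _ (hknot h hx hx')) ((gw h).outer_notMem x hx)
    · rw [hγh, g₂.hole_mem _ z hz, (gw h).hole_mem h' z hz]
  · rintro (⟨d, hd⟩ | ⟨h, y, hy⟩) (⟨d', hd'⟩ | ⟨k, y', hy'⟩) hdd
    · have h1 := G₂.outer_inj (g₁.outer_notMem d hd) (g₁.outer_notMem d' hd') hdd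
      have h2 := G₁.outer_inj hd hd' h1
      subst h2
      rfl
    · exfalso
      simp only [Sum.elim_inl, Sum.elim_inr] at hdd
      rcases hcases k y' hy' with ⟨x, hx, hx', rfl⟩ | ⟨h', z, hz, rfl⟩
      · rw [hγo] at hdd
        exact G₁.outer_ne_hole hd hx'
          (G₂.outer_inj (g₁.outer_notMem d hd) (hknot k hx hx') hdd)
      · rw [hγh] at hdd
        exact G₂.outer_ne_hole (g₁.outer_notMem d hd) hz hdd
    · exfalso
      simp only [Sum.elim_inl, Sum.elim_inr] at hdd
      rcases hcases h y hy with ⟨x, hx, hx', rfl⟩ | ⟨h', z, hz, rfl⟩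
      · rw [hγo] at hdd
        exact G₁.outer_ne_hole hd' hx'
          (G₂.outer_inj (g₁.outer_notMem d' hd') (hknot h hx hx') hdd.symm)
      · rw [hγh] at hdd
        exact G₂.outer_ne_hole (g₁.outer_notMem d' hd') hz hdd.symm
    · simp only [Sum.elim_inr] at hdd
      rcases hcases h y hy with ⟨x, hx, hx', rfl⟩ | ⟨h', z, hz, rfl⟩ <;>
        rcases hcases k y' hy' with ⟨x₂, hx₂, hx₂', rfl⟩ | ⟨k', z₂, hz₂, rfl⟩
      · rw [hγo, hγo] at hdd
        have h1 := G₁.hole_inj (G₂.outer_inj (hknot h hx hx') (hknot k hx₂ hx₂') hdd)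
        cases h1
        rfl
      · rw [hγo, hγh] at hdd
        exact absurd hdd (G₂.outer_ne_hole (hknot h hx hx') hz₂)
      · rw [hγo, hγh] at hdd
        exact absurd hdd.symm (G₂.outer_ne_hole (hknot k hx₂ hx₂') hz)
      · rw [hγh, hγh] at hdd
        have h1 := G₂.hole_inj hdd
        have h2 : κ h h' = κ k k' := congrArg Sigma.fst h1
        obtain ⟨x, hx⟩ : ∃ x, x ∈ h'.1 := ⟨_, hmk h h'⟩
        obtain ⟨x₂, hx₂, he⟩ := hκ2 k k' _ (h2 ▸ hκ1 h h' x hx)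
        have h3 := G₁.hole_inj he
        cases h3
        obtain rfl : h' = k' := Hole.ext_of_mem hx hx₂
        rw [Sigma.mk.injEq] at h1
        cases eq_of_heq h1.2
        rfl
  · intro c
    rcases G₂.cases c with ⟨b, hb, rfl⟩ | ⟨k, z, hz, rfl⟩
    · rcases G₁.cases b with ⟨a, ha, rfl⟩ | ⟨h, x, hx, rfl⟩
      · exact ⟨Sum.inl ⟨a, ha⟩, rfl⟩
      · have hx' : x ∉ (v h).holeDarts := (g₁.hole_mem h x hx).not.1 hb
        refine ⟨Sum.inr ⟨h, (gw h).fromOuter x,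
          ((gw h).outer_mem_rootFace (hmk h) hx').not.2 hx⟩, ?_⟩
        exact hγo h x
    · have hkm := k.mem_holeDarts (hB k)
      rcases G₁.cases (mkB k) with ⟨a, ha, he⟩ | ⟨h, x, hx, he⟩
      · change g₁.fromOuter a = _ at he
        rw [← he] at hkm
        exact absurd hkm (g₁.outer_notMem a ha)
      · have hxh : x ∈ (v h).holeDarts := (g₁.hole_mem h x hx).1 (by
          change g₁.fromHole h x = _ at he
          rwa [he])
        obtain ⟨h', hh'⟩ := exists_hole hxh
        obtain rfl : κ h h' = k := Hole.ext_of_mem (hκ1 h h' x hh') (by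
          change g₁.fromHole h x = _ at he
          rw [he]; exact hB k)
        refine ⟨Sum.inr ⟨h, (gw h).fromHole h' z,
          (gw h).hole_notMem_rootFace (hmk h) hz⟩, ?_⟩
        exact hγh h h' z

end LMap
end QuadHoles

/-! ### Faces and edges of a glued map -/

namespace QuadHoles

/-- The inner face to the right of a dart. -/
noncomputable def LMap.innerFace {M : LMap} {d : Fin M.n} (hd : M.IsInner d) : M.InnerFace :=
  ⟨M.face d, d, hd, rfl⟩

theorem LMap.innerFace_eq_iff {M : LMap} {d e : Fin M.n} {hd : M.IsInner d} {he : M.IsInner e} :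
    innerFace hd = innerFace he ↔ M.nxt.SameCycle d e :=
  Subtype.ext_iff.trans face_eq_face_iff

theorem LMap.exists_innerFace {M : LMap} (f : M.InnerFace) :
    ∃ (d : _) (hd : M.IsInner d), innerFace hd = f := by
  obtain ⟨_, d, hd, rfl⟩ := f
  exact ⟨d, hd, rfl⟩

namespace LMap.GlueMaps

variable {p : LMap} {mk : p.Hole → Fin p.n} {u : p.Hole → LMap} {m : LMap}

theorem isInner_outer_iff (g : GlueMaps p mk u m) (hmk : ∀ h, mk h ∈ h.1) {d : Fin p.n}
    (hd : d ∉ p.holeDarts) : m.IsInner (g.fromOuter d) ↔ p.IsInner d := by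
  rw [IsInner, IsInner, g.outer_mem_rootFace hmk hd]
  exact and_congr_left' (iff_of_true (g.outer_notMem d hd) hd)

theorem isInner_outer (g : GlueMaps p mk u m) (hmk : ∀ h, mk h ∈ h.1) {d : Fin p.n}
    (hd : p.IsInner d) : m.IsInner (g.fromOuter d) := (g.isInner_outer_iff hmk hd.1).2 hd

theorem isInner_hole (g : GlueMaps p mk u m) (hmk : ∀ h, mk h ∈ h.1) {h : p.Hole}
    {x : Fin (u h).n} (hx : (u h).IsInner x) : m.IsInner (g.fromHole h x) :=
  ⟨(g.hole_mem h x hx.2).not.2 hx.1, g.hole_notMem_rootFace hmk hx.2⟩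

/-- The face of the glued map which corresponds to a face of the outer map. -/
noncomputable def outerFace (g : GlueMaps p mk u m) (hmk : ∀ h, mk h ∈ h.1) (f : p.InnerFace) :
    m.InnerFace :=
  innerFace (g.isInner_outer hmk (exists_innerFace f).choose_spec.choose)

/-- The face of the glued map which corresponds to a face of the map in a hole. -/
noncomputable def holeFace (g : GlueMaps p mk u m) (hmk : ∀ h, mk h ∈ h.1) (h : p.Hole)
    (f : (u h).InnerFace) : m.InnerFace :=
  innerFace (g.isInner_hole hmk (exists_innerFace f).choose_spec.choose)

theorem outerFace_innerFace (g : GlueMaps p mk u m) (hmk : ∀ h, mk h ∈ h.1) {d : Fin p.n}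
    (hd : p.IsInner d) : g.outerFace hmk (innerFace hd) = innerFace (g.isInner_outer hmk hd) := by
  have hex := (exists_innerFace (innerFace hd)).choose_spec
  refine innerFace_eq_iff.2 ?_
  exact ((g.toPasting hmk).outer_sameCycle_outer hex.choose.1 hd.1).2
    (innerFace_eq_iff.1 hex.choose_spec)

theorem holeFace_innerFace (g : GlueMaps p mk u m) (hmk : ∀ h, mk h ∈ h.1) {h : p.Hole}
    {x : Fin (u h).n} (hx : (u h).IsInner x) :
    g.holeFace hmk h (innerFace hx) = innerFace (g.isInner_hole hmk hx) := by
  have hex := (exists_innerFace (innerFace hx)).choose_spec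
  refine innerFace_eq_iff.2 ?_
  exact ((g.toPasting hmk).hole_sameCycle hex.choose.2).2
    ⟨x, innerFace_eq_iff.1 hex.choose_spec, rfl⟩

theorem outerFace_ne_holeFace (g : GlueMaps p mk u m) (hmk : ∀ h, mk h ∈ h.1) (f : p.InnerFace)
    (h : p.Hole) (f' : (u h).InnerFace) : g.outerFace hmk f ≠ g.holeFace hmk h f' := by
  obtain ⟨d, hd, rfl⟩ := exists_innerFace f
  obtain ⟨x, hx, rfl⟩ := exists_innerFace f'
  rw [outerFace_innerFace, holeFace_innerFace, ne_eq, innerFace_eq_iff]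
  intro h1
  obtain ⟨y, hy, hy'⟩ := ((g.toPasting hmk).outer_sameCycle hd.1).1 h1
  exact (g.toPasting hmk).outer_ne_hole
    (fun h => hd.1 ((mem_holeDarts_of_sameCycle hy).2 h)) hx.2 hy'

theorem outerFace_injective (g : GlueMaps p mk u m) (hmk : ∀ h, mk h ∈ h.1) :
    Function.Injective (g.outerFace hmk) := by
  intro f f' he
  obtain ⟨d, hd, rfl⟩ := exists_innerFace f
  obtain ⟨d', hd', rfl⟩ := exists_innerFace f'
  rw [outerFace_innerFace, outerFace_innerFace, innerFace_eq_iff] at he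
  exact innerFace_eq_iff.2 (((g.toPasting hmk).outer_sameCycle_outer hd.1 hd'.1).1 he)

theorem holeFace_injective (g : GlueMaps p mk u m) (hmk : ∀ h, mk h ∈ h.1) :
    Function.Injective (fun x : Σ h, (u h).InnerFace => g.holeFace hmk x.1 x.2) := by
  rintro ⟨h, f⟩ ⟨h', f'⟩ he
  obtain ⟨x, hx, rfl⟩ := exists_innerFace f
  obtain ⟨x', hx', rfl⟩ := exists_innerFace f'
  simp only [holeFace_innerFace] at he
  rw [innerFace_eq_iff] at he
  obtain ⟨y, hy, hy'⟩ := ((g.toPasting hmk).hole_sameCycle hx.2).1 he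
  have h2 := (g.toPasting hmk).hole_inj hy'
  cases h2
  rw [innerFace_eq_iff.2 hy]

theorem faces_bijective (g : GlueMaps p mk u m) (hmk : ∀ h, mk h ∈ h.1) :
    Function.Bijective (Sum.elim (g.outerFace hmk)
      (fun x : Σ h, (u h).InnerFace => g.holeFace hmk x.1 x.2)) := by
  constructor
  · exact Function.Injective.sumElim (g.outerFace_injective hmk) (g.holeFace_injective hmk)
      fun f x => g.outerFace_ne_holeFace hmk f x.1 x.2
  · intro f
    obtain ⟨z, hz, rfl⟩ := exists_innerFace f
    rcases (g.toPasting hmk).cases z with ⟨d, hd, rfl⟩ | ⟨h, x, hx, rfl⟩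
    · have hd' := (g.isInner_outer_iff hmk hd).1 hz
      exact ⟨Sum.inl (innerFace hd'), g.outerFace_innerFace hmk hd'⟩
    · have hx' : (u h).IsInner x := ⟨(g.hole_mem h x hx).not.1 hz.1, hx⟩
      exact ⟨Sum.inr ⟨h, innerFace hx'⟩, g.holeFace_innerFace hmk hx'⟩

/-- The inner faces of a glued map. -/
noncomputable def faceEquiv (g : GlueMaps p mk u m) (hmk : ∀ h, mk h ∈ h.1) :
    p.InnerFace ⊕ (Σ h, (u h).InnerFace) ≃ m.InnerFace :=
  Equiv.ofBijective _ (g.faces_bijective hmk)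

theorem card_innerFace (g : GlueMaps p mk u m) (hmk : ∀ h, mk h ∈ h.1) :
    Fintype.card m.InnerFace
      = Fintype.card p.InnerFace + ∑ h, Fintype.card (u h).InnerFace := by
  rw [← Fintype.card_congr (g.faceEquiv hmk), Fintype.card_sum, Fintype.card_sigma]

/-- A boundary edge of a hole belongs both to `p` and to a filling, and is attributed to the
filling. A non-hole dart that faces a hole reappears as a root-face dart of the filling, so the
outer sum keeps only the edges with no side in a hole. -/
theorem sum_darts {A : Type*} [AddCommMonoid A] (g : GlueMaps p mk u m) (hmk : ∀ h, mk h ∈ h.1)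
    (w : Fin m.n → A) :
    ∑ z, w z = ∑ d with d ∉ p.holeDarts ∧ p.rev d ∉ p.holeDarts, w (g.fromOuter d)
      + ∑ h, ∑ x, w (g.fromHole h x) := by
  classical
  have h1 := (g.toPasting hmk).sum_darts w
  change _ = ∑ d : {d // d ∉ p.holeDarts}, w (g.fromOuter d.1)
      + ∑ h, ∑ x : {x // x ∉ (u h).rootFace}, w (g.fromHole h x.1) at h1
  have h2 : ∑ d : {d // d ∉ p.holeDarts}, w (g.fromOuter d.1)
      = ∑ d with d ∉ p.holeDarts ∧ p.rev d ∉ p.holeDarts, w (g.fromOuter d)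
        + ∑ h : p.Hole, ∑ a ∈ h.1, w (g.fromOuter (p.rev a)) := by
    rw [← sum_holeDarts (fun a => w (g.fromOuter (p.rev a))),
      Finset.sum_coe_sort p.holeDarts (fun a => w (g.fromOuter (p.rev a)))]
    have h3 : ∑ d : {d // d ∉ p.holeDarts}, w (g.fromOuter d.1)
        = ∑ d with d ∉ p.holeDarts, w (g.fromOuter d) :=
      (Finset.sum_subtype (Finset.univ.filter fun d => d ∉ p.holeDarts) (by simp)
        (fun d => w (g.fromOuter d))).symm
    rw [h3,
      ← Finset.sum_filter_add_sum_filter_not _ (fun d => p.rev d ∉ p.holeDarts),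
      Finset.filter_filter]
    congr 1
    refine Finset.sum_nbij' p.rev p.rev ?_ ?_ (fun _ _ => p.rev_rev _) (fun _ _ => p.rev_rev _) ?_
    · intro d hd
      simp only [Finset.mem_filter, not_not] at hd
      exact hd.2
    · intro a ha
      simp only [Finset.mem_filter, Finset.mem_univ, true_and, p.rev_rev, not_not]
      exact ⟨rev_notMem_holeDarts ha, ha⟩
    · intro d _
      rw [p.rev_rev]
  have h4 : ∀ h : p.Hole, ∑ a ∈ h.1, w (g.fromOuter (p.rev a))
      = ∑ x ∈ (u h).rootFace, w (g.fromHole h x) := by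
    intro h
    have hi : Set.InjOn (fun a => g.fromOuter (p.rev a)) h.1 := fun a ha b hb hab =>
      p.rev.injective ((g.toPasting hmk).outer_inj (rev_notMem_holeDarts (h.mem_holeDarts ha))
        (rev_notMem_holeDarts (h.mem_holeDarts hb)) hab)
    have hj : Set.InjOn (g.fromHole h) (u h).rootFace :=
      ((g.toPasting hmk).hole_injective h).injOn
    rw [← Finset.sum_image hi (f := w), ← Finset.sum_image hj (f := w)]
    congr 1
    ext z
    simp only [Finset.mem_image]
    constructor
    · rintro ⟨a, ha, rfl⟩
      obtain ⟨i, rfl⟩ := h.exists_pow (hmk h) ha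
      exact ⟨_, root_pow_mem _ i, (g.glued h i).symm⟩
    · rintro ⟨x, hx, rfl⟩
      obtain ⟨i, rfl⟩ := exists_root_pow hx
      exact ⟨_, h.pow_mem (hmk h) i, g.glued h i⟩
  rw [h1, h2, add_assoc, ← Finset.sum_add_distrib]
  congr 1
  refine Finset.sum_congr rfl fun h _ => ?_
  rw [h4, ← Finset.sum_filter_add_sum_filter_not Finset.univ (fun x => x ∈ (u h).rootFace)]
  congr 1
  · congr 1
    ext x
    simp
  · exact (Finset.sum_subtype (Finset.univ.filter fun x => x ∉ (u h).rootFace) (by simp)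
      (fun x => w (g.fromHole h x))).symm

end LMap.GlueMaps

/-! ### Gluing and inclusion on the countable set of unlabelled maps -/

open LMap

namespace QH

theorem eq_of_iso {p m : QH} (h : p.rep.Iso m.rep) : p = m := by
  have h1 : (Quotient.mk LMap.isoSetoid p.rep) = p := Quotient.out_eq p
  have h2 : (Quotient.mk LMap.isoSetoid m.rep) = m := Quotient.out_eq m
  rw [← h1, ← h2]
  exact Quotient.sound h

/-- The map with a given labelled representative. -/
def of (M : LMap) : QH := Quotient.mk LMap.isoSetoid M

theorem iso_rep_of (M : LMap) : M.Iso (of M).rep := LMap.iso_symm (Quotient.mk_out M)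

end QH

instance : Countable LMap := by
  let f : LMap → Σ n : ℕ, Equiv.Perm (Fin n) × Equiv.Perm (Fin n) × Fin n × Finset (Fin n) :=
    fun M => ⟨M.n, M.rev, M.nxt, M.root, M.holeDarts⟩
  refine Function.Injective.countable (f := f) ?_
  rintro ⟨n, a, b, c, d, _, _, _, _, _, _, _, _⟩ ⟨n', a', b', c', d', _, _, _, _, _, _, _, _⟩ h
  simp only [f] at h
  cases h
  rfl

instance : Countable QH := inferInstanceAs (Countable (Quotient LMap.isoSetoid))

variable {mk : Marking} {p p' m m' : QH}

theorem Marking.mem (mk : Marking) (p : QH) (h : p.Hole) : (mk p h).1 ∈ h.1 := (mk p h).2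

theorem IsGluing.unique {u : p.Hole → QH} (h : IsGluing mk p u m) (h' : IsGluing mk p u m') :
    m = m' := by
  obtain ⟨g⟩ := h
  obtain ⟨g'⟩ := h'
  exact QH.eq_of_iso (g.iso_of_gluing g' (mk.mem p))

theorem IsGluing.family_unique {u u' : p.Hole → QH} (h : IsGluing mk p u m)
    (h' : IsGluing mk p u' m) : u = u' := by
  obtain ⟨g⟩ := h
  obtain ⟨g'⟩ := h'
  funext k
  exact QH.eq_of_iso (g.iso_of_family g' (mk.mem p) k)

theorem exists_isGluing (mk : Marking) {u : p.Hole → QH}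
    (hu : ∀ h, (u h).rep.perimeter = h.degree) : ∃ m, IsGluing mk p u m := by
  obtain ⟨M, ⟨g⟩⟩ := exists_gluing (mk.mem p) hu
  exact ⟨QH.of M, g.congr (fun h => LMap.iso_refl _) (QH.iso_rep_of M)⟩

theorem Sub.refl (mk : Marking) (p : QH) : Sub mk p p := by
  obtain ⟨u, ⟨g⟩⟩ := exists_gluing_self p.rep _ (mk.mem p)
  exact ⟨fun h => QH.of (u h), g.congr (fun h => QH.iso_rep_of _) (LMap.iso_refl _)⟩

theorem Sub.antisymm (h : Sub mk p m) (h' : Sub mk m p) : p = m := by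
  obtain ⟨u, ⟨g⟩⟩ := h
  obtain ⟨u', ⟨g'⟩⟩ := h'
  exact QH.eq_of_iso (iso_of_gluing_of_gluing g g')

theorem Sub.trans (h : Sub mk p p') (h' : Sub mk p' m) : Sub mk p m := by
  obtain ⟨u, ⟨g⟩⟩ := h
  obtain ⟨u', ⟨g'⟩⟩ := h'
  obtain ⟨w, ⟨gw⟩⟩ := exists_gluing_trans g g' (mk.mem p) (mk.mem p')
  exact ⟨fun h => QH.of (w h), gw.congr (fun h => QH.iso_rep_of _) (LMap.iso_refl _)⟩

theorem IsGluing.isQuad_iff {u : p.Hole → QH} (h : IsGluing mk p u m) (N : ℕ) :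
    m.IsQuad N ↔ p.rep.perimeter = N ∧ ∀ h, (u h).IsQuad h.degree := by
  obtain ⟨g⟩ := h
  rw [QH.IsQuad, g.perimeter (mk.mem p), and_comm]
  refine and_congr_right fun _ => ?_
  constructor
  · intro hm h
    refine ⟨Finset.eq_empty_of_forall_notMem fun x hx => ?_, g.perimeter_eq h⟩
    have hr : x ∉ (u h).rep.rootFace := fun hr => notMem_holeDarts_of_mem_rootFace hr hx
    have := (g.hole_mem h x hr).2 hx
    rw [hm] at this
    exact absurd this (Finset.notMem_empty _)
  · intro hu
    refine Finset.eq_empty_of_forall_notMem fun z hz => ?_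
    rcases (g.toPasting (mk.mem p)).cases z with ⟨d, hd, rfl⟩ | ⟨h, x, hx, rfl⟩
    · exact g.outer_notMem d hd hz
    · have := (g.hole_mem h x hx).1 hz
      rw [(hu h).1] at this
      exact absurd this (Finset.notMem_empty _)

end QuadHoles

namespace QuadHoles
open LMap

/-! ### The strong Markov property -/

section Undecorated

variable {Ω : Type*} [mΩ : MeasurableSpace Ω] {P : Measure Ω} {mk : Marking}
  {F : QH → MeasurableSpace Ω} {X Y : Ω → QH}

/-- By antisymmetry, `Y = p` means that `Y` is contained in `p` but in no `p'` strictly below `p`.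
There are countably many such `p'`, and `F p'` is contained in `F p`. -/
theorem IsStoppingMap.measurableSet_eq (hF : IsFiltration mk F) (hY : IsStoppingMap P mk F X Y)
    (p : QH) : MeasurableSet[F p] {ω | Y ω = p} := by
  have h : {ω | Y ω = p} = {ω | Sub mk (Y ω) p} \
      ⋃ p' : {p' : QH // Sub mk p' p ∧ p' ≠ p}, {ω | Sub mk (Y ω) p'.1} := by
    ext ω
    simp only [Set.mem_ofPred_eq, Set.mem_sdiff, Set.mem_iUnion, not_exists, Subtype.forall]
    constructor
    · rintro rfl
      exact ⟨Sub.refl mk _, fun p' hp' h => hp'.2 (hp'.1.antisymm h)⟩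
    · rintro ⟨h1, h2⟩
      by_contra hne
      exact h2 (Y ω) ⟨h1, hne⟩ (Sub.refl mk _)
  rw [h]
  exact (hY.measurable p).diff
    (MeasurableSet.iUnion fun p' => hF.mono _ _ p'.2.1 _ (hY.measurable p'.1))

theorem IsStoppingMap.measurable_sigma (hF : IsFiltration mk F) (hY : IsStoppingMap P mk F X Y) :
    Measurable[hY.sigma] Y := by
  refine @measurable_to_countable' QH Ω _ _ hY.sigma Y fun p => ⟨?_, fun p' => ?_⟩
  · exact le_iSup F p _ (hY.measurableSet_eq hF p)
  · by_cases hp : Sub mk p p'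
    · have h : Y ⁻¹' {p} ∩ {ω | Sub mk (Y ω) p'} = {ω | Y ω = p} := by
        ext ω
        simp only [Set.mem_inter_iff, Set.mem_preimage, Set.mem_singleton_iff, Set.mem_ofPred_eq,
          and_iff_left_iff_imp]
        rintro rfl
        exact hp
      rw [h]
      exact hF.mono _ _ hp _ (hY.measurableSet_eq hF p)
    · have h : Y ⁻¹' {p} ∩ {ω | Sub mk (Y ω) p'} = ∅ := by
        ext ω
        simp only [Set.mem_inter_iff, Set.mem_preimage, Set.mem_singleton_iff, Set.mem_ofPred_eq,
          Set.mem_empty_iff_false, iff_false, not_and]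
        rintro rfl
        exact hp
      rw [h]
      exact @MeasurableSet.empty _ (F p')

/-- Splitting the measure of an arbitrary set according to the values of a discrete random
variable. -/
theorem measure_eq_tsum_fiber {β : Type*} [Countable β] [MeasurableSpace β]
    [MeasurableSingletonClass β] {Y : Ω → β} (hY : Measurable Y) (S : Set Ω) :
    P S = ∑' p, P (S ∩ {ω | Y ω = p}) := by
  have hm : ∀ p, MeasurableSet {ω | Y ω = p} := fun p => hY (measurableSet_singleton p)
  have h := measure_iUnion (μ := P.restrict S) (f := fun p => {ω | Y ω = p})
    (fun p p' hne => Set.disjoint_left.2 fun ω h1 h2 => hne (h1.symm.trans h2)) hm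
  have hu : ⋃ p, {ω | Y ω = p} = Set.univ := by ext ω; simp
  rw [hu, Measure.restrict_apply_univ] at h
  rw [h]
  congr 1
  funext p
  rw [Measure.restrict_apply (hm p), Set.inter_comm]

/-- The fillings of `Y` are those provided by the Markov property at the value of `Y`. Events about
them need not be measurable, so they are split along `{Y = p}`, which only uses the measurability of
`Y`. -/
theorem markovDecomposition_of_isStoppingMap {q : ℝ} {ℓ : ℕ} (hF : IsFiltration mk F)
    (hX : IsFBoltzmann P mk F q ℓ X) (hY : IsStoppingMap P mk F X Y) :
    MarkovDecomposition P mk q hY.sigma X Y := by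
  choose U hU1 hU2 using hX.increments
  have hYm : Measurable Y := measurable_to_countable' fun p =>
    hF.le p _ (hY.measurableSet_eq hF p)
  refine ⟨fun ω => U (Y ω) ω, hY.sub.mono fun ω h => hU1 _ ω h, fun A hA B => ?_⟩
  have hAm : MeasurableSet A := (iSup_le hF.le : ⨆ p, F p ≤ mΩ) _ hA.1
  rw [measure_eq_tsum_fiber hYm, ← lintegral_indicator hAm]
  have hae : ∀ p, P (A ∩ {ω | ∀ h, U (Y ω) ω h ∈ B (Y ω) h} ∩ {ω | Y ω = p})
      = P (A ∩ {ω | Y ω = p}) * ∏ h, boltzmann q h.degree (B p h) := by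
    intro p
    have hAp : MeasurableSet[F p] (A ∩ {ω | Y ω = p}) := by
      have h : A ∩ {ω | Y ω = p} = A ∩ {ω | Sub mk (Y ω) p} ∩ {ω | Y ω = p} := by
        ext ω
        simp only [Set.mem_inter_iff, Set.mem_ofPred_eq]
        constructor
        · rintro ⟨h1, rfl⟩
          exact ⟨⟨h1, Sub.refl mk _⟩, rfl⟩
        · rintro ⟨⟨h1, -⟩, h2⟩
          exact ⟨h1, h2⟩
      rw [h]
      exact (hA.2 p).inter (hY.measurableSet_eq hF p)
    -- Since `Y` is almost surely contained in `X`, the event that `p` is contained in `X` costs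
    -- nothing on `{Y = p}`.
    have hsub : (A ∩ {ω | Y ω = p} : Set Ω) =ᵐ[P]
        (A ∩ {ω | Y ω = p} ∩ {ω | Sub mk p (X ω)} : Set Ω) := by
      filter_upwards [hY.sub] with ω hω
      simp only [eq_iff_iff]
      change ω ∈ A ∩ {ω | Y ω = p} ↔ ω ∈ A ∩ {ω | Y ω = p} ∩ {ω | Sub mk p (X ω)}
      simp only [Set.mem_inter_iff, Set.mem_ofPred_eq]
      constructor
      · rintro ⟨h1, rfl⟩
        exact ⟨⟨h1, rfl⟩, hω⟩
      · exact fun h => h.1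
    have h1 : A ∩ {ω | ∀ h, U (Y ω) ω h ∈ B (Y ω) h} ∩ {ω | Y ω = p}
        = A ∩ {ω | Y ω = p} ∩ {ω | ∀ h, U p ω h ∈ B p h} := by
      ext ω
      simp only [Set.mem_inter_iff, Set.mem_ofPred_eq]
      constructor
      · rintro ⟨⟨h1, h2⟩, rfl⟩
        exact ⟨⟨h1, rfl⟩, h2⟩
      · rintro ⟨⟨h1, rfl⟩, h2⟩
        exact ⟨⟨h1, h2⟩, rfl⟩
    rw [h1, measure_congr (hsub.inter (Filter.EventuallyEq.refl _ {ω | ∀ h, U p ω h ∈ B p h})),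
      hU2 p _ hAp, ← measure_congr hsub]
  rw [tsum_congr hae]
  have hm : ∀ p, MeasurableSet {ω | Y ω = p} := fun p => hYm (measurableSet_singleton p)
  have hpt : ∀ ω, A.indicator (fun ω => ∏ h : (Y ω).Hole, boltzmann q h.degree (B (Y ω) h)) ω
      = ∑' p : QH, (A ∩ {ω | Y ω = p}).indicator
        (fun _ => ∏ h : p.Hole, boltzmann q h.degree (B p h)) ω := by
    intro ω
    rw [tsum_eq_single (Y ω)]
    · by_cases hω : ω ∈ A <;> simp [hω]
    · intro p hp
      rw [Set.indicator_of_notMem]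
      rintro ⟨-, h⟩
      exact hp h.symm
  simp_rw [hpt]
  rw [lintegral_tsum fun p => (measurable_const.indicator (hAm.inter (hm p))).aemeasurable]
  congr 1
  funext p
  rw [lintegral_indicator_const (hAm.inter (hm p)), mul_comm]

theorem MarkovDecomposition.mono {q : ℝ} {G G' : MeasurableSpace Ω} (hG : G ≤ G')
    (h : @MarkovDecomposition Ω mΩ P mk q G' X Y) : @MarkovDecomposition Ω mΩ P mk q G X Y := by
  obtain ⟨U, h1, h2⟩ := h
  exact ⟨U, h1, fun A hA B => h2 A (hG A hA) B⟩

end Undecorated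

/-! ### Decorations of glued maps -/

section Decorated

variable {k : ℕ}

theorem faceValue_of_isInner (m : QH) (σ : m.InnerFace → EuclideanSpace ℝ (Fin k))
    {d : Fin m.rep.n} (hd : m.rep.IsInner d) : faceValue m σ d = σ (innerFace hd) := dif_pos hd

theorem faceValue_of_not_isInner (m : QH) (σ : m.InnerFace → EuclideanSpace ℝ (Fin k))
    {d : Fin m.rep.n} (hd : ¬ m.rep.IsInner d) : faceValue m σ d = 0 := dif_neg hd

theorem sideValue_of_notMem (m : QH) {N : ℕ} (b : Fin N → EuclideanSpace ℝ (Fin k))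
    (σ : m.InnerFace → EuclideanSpace ℝ (Fin k)) {d : Fin m.rep.n} (hd : d ∉ m.rep.rootFace) :
    sideValue m b σ d = faceValue m σ d := if_neg hd

theorem measurable_sideValue (m : QH) {N : ℕ} (d : Fin m.rep.n) :
    Measurable (fun x : (Fin N → EuclideanSpace ℝ (Fin k)) ×
      (m.InnerFace → EuclideanSpace ℝ (Fin k)) => sideValue m x.1 x.2 d) := by
  unfold sideValue faceValue
  split_ifs <;> fun_prop

theorem measurable_energy (β : ℝ) (m : QH) {N : ℕ} :
    Measurable (fun x : (Fin N → EuclideanSpace ℝ (Fin k)) ×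
      (m.InnerFace → EuclideanSpace ℝ (Fin k)) => energy β m x.1 x.2) := by
  unfold energy
  refine Measurable.const_mul (Measurable.div_const (Finset.measurable_sum _ fun d _ => ?_) _) _
  exact ((measurable_sideValue m d).sub (measurable_sideValue m _)).norm.pow_const 2

theorem measurable_holeBoundary (mk : Marking) (p : QH) {N : ℕ}
    (b : Fin N → EuclideanSpace ℝ (Fin k)) (h : p.Hole) :
    Measurable (fun τ : p.InnerFace → EuclideanSpace ℝ (Fin k) => holeBoundary mk p b τ h) :=
  measurable_pi_lambda _ fun _ => (measurable_sideValue p _).comp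
    (measurable_const.prodMk measurable_id)

/-- The contribution to the energy of the edges of a map that do not belong to a hole. -/
noncomputable def outerEnergy (β : ℝ) (m : QH) {N : ℕ} (b : Fin N → EuclideanSpace ℝ (Fin k))
    (σ : m.InnerFace → EuclideanSpace ℝ (Fin k)) : ℝ :=
  β / 2 * ((∑ d with d ∉ m.rep.holeDarts ∧ m.rep.rev d ∉ m.rep.holeDarts,
    ‖sideValue m b σ d - sideValue m b σ (m.rep.rev d)‖ ^ 2) / 2)

theorem measurable_outerEnergy (β : ℝ) (m : QH) {N : ℕ} (b : Fin N → EuclideanSpace ℝ (Fin k)) :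
    Measurable (fun σ : m.InnerFace → EuclideanSpace ℝ (Fin k) => outerEnergy β m b σ) := by
  unfold outerEnergy
  refine Measurable.const_mul (Measurable.div_const (Finset.measurable_sum _ fun d _ => ?_) _) _
  exact (((measurable_sideValue m d).comp (measurable_const.prodMk measurable_id)).sub
    ((measurable_sideValue m _).comp (measurable_const.prodMk measurable_id))).norm.pow_const 2

variable {mk : Marking} {p m : QH} {v : p.Hole → QH}
  (g : GlueMaps p.rep (fun h => (mk p h).1) (fun h => (v h).rep) m.rep)

include g

/-- Gluing data between given maps are unique, so any gluing may be replaced by `g`. -/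
theorem isDecGluing_iff (τ : p.InnerFace → EuclideanSpace ℝ (Fin k))
    (s : ∀ h, (v h).InnerFace → EuclideanSpace ℝ (Fin k))
    (σ : m.InnerFace → EuclideanSpace ℝ (Fin k)) :
    IsDecGluing mk p τ (fun h => ⟨v h, s h⟩) ⟨m, σ⟩ ↔
      τ = σ ∘ g.outerFace (mk.mem p) ∧ ∀ h, s h = σ ∘ g.holeFace (mk.mem p) h := by
  constructor
  · rintro ⟨g', h1, h2⟩
    obtain rfl : g' = g := Subsingleton.elim _ _
    refine ⟨funext fun f => ?_, fun h => funext fun f => ?_⟩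
    · obtain ⟨d, hd, rfl⟩ := exists_innerFace f
      have := h1 d hd
      rw [faceValue_of_isInner p τ hd, faceValue_of_isInner m σ (g'.isInner_outer (mk.mem p) hd)]
        at this
      rw [← this, Function.comp_apply, g'.outerFace_innerFace]
    · obtain ⟨x, hx, rfl⟩ := exists_innerFace f
      have := h2 h x hx.2
      simp only at this
      rw [faceValue_of_isInner (v h) (s h) hx,
        faceValue_of_isInner m σ (g'.isInner_hole (mk.mem p) hx)] at this
      rw [← this, Function.comp_apply, g'.holeFace_innerFace]
  · rintro ⟨rfl, h2⟩
    refine ⟨g, fun d hd => ?_, fun h x hx => ?_⟩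
    · simp only
      rw [faceValue_of_isInner p _ hd, faceValue_of_isInner m σ (g.isInner_outer (mk.mem p) hd),
        Function.comp_apply, g.outerFace_innerFace]
    · simp only [h2 h]
      by_cases hx' : (v h).rep.IsInner x
      · rw [faceValue_of_isInner (v h) _ hx',
          faceValue_of_isInner m σ (g.isInner_hole (mk.mem p) hx'),
          Function.comp_apply, g.holeFace_innerFace]
      · rw [faceValue_of_not_isInner _ _ hx', faceValue_of_not_isInner]
        exact fun h' => hx' ⟨(g.hole_mem h x hx).not.1 h'.1, hx⟩

theorem sideValue_outer {N : ℕ} (b : Fin N → EuclideanSpace ℝ (Fin k))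
    (σ : m.InnerFace → EuclideanSpace ℝ (Fin k)) {d : Fin p.rep.n} (hd : d ∉ p.rep.holeDarts) :
    sideValue m b σ (g.fromOuter d) = sideValue p b (σ ∘ g.outerFace (mk.mem p)) d := by
  by_cases hr : d ∈ p.rep.rootFace
  · have hs : ∀ i : ℕ, (m.rep.nxt ^ i) m.rep.root = g.fromOuter d ↔
        (p.rep.nxt ^ i) p.rep.root = d := by
      intro i
      rw [← g.root_pow (mk.mem p)]
      exact ⟨(g.toPasting (mk.mem p)).outer_inj
        (notMem_holeDarts_of_mem_rootFace (root_pow_mem _ i)) hd, fun h => congrArg _ h⟩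
    simp only [sideValue, if_pos hr, if_pos ((g.outer_mem_rootFace (mk.mem p) hd).2 hr), hs]
  · have hi : p.rep.IsInner d := ⟨hd, hr⟩
    rw [sideValue_of_notMem _ _ _ hr,
      sideValue_of_notMem _ _ _ ((g.outer_mem_rootFace (mk.mem p) hd).not.2 hr),
      faceValue_of_isInner _ _ hi, faceValue_of_isInner _ _ (g.isInner_outer (mk.mem p) hi),
      Function.comp_apply, g.outerFace_innerFace]

/-- On the root face of the filling the value is given by the boundary condition, and `holeBoundary`
reads it at the outer dart that is glued to the same position. Elsewhere both sides are the value of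
the same face. -/
theorem sideValue_hole {N : ℕ} (b : Fin N → EuclideanSpace ℝ (Fin k))
    (σ : m.InnerFace → EuclideanSpace ℝ (Fin k)) (h : p.Hole) (x : Fin (v h).rep.n) :
    sideValue m b σ (g.fromHole h x)
      = sideValue (v h) (holeBoundary mk p b (σ ∘ g.outerFace (mk.mem p)) h)
        (σ ∘ g.holeFace (mk.mem p) h) x := by
  by_cases hr : x ∈ (v h).rep.rootFace
  · obtain ⟨i, rfl⟩ := exists_root_pow hr
    -- `sideValue` reads the boundary condition at the least position of the dart. This position is
    -- below the degree by periodicity, and it leads to the same dart as `i`.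
    set S := {j : ℕ | ((v h).rep.nxt ^ j) (v h).rep.root = ((v h).rep.nxt ^ i) (v h).rep.root}
      with hS
    have hmem : sInf S ∈ S := Nat.sInf_mem ⟨i, rfl⟩
    have hper : (v h).rep.perimeter = h.degree := g.perimeter_eq h
    have hlt : sInf S < h.degree := by
      have h1 : i % h.degree ∈ S := by
        change _ = _
        rw [root_pow_eq_iff, hper]
        exact Nat.mod_modEq _ _
      exact lt_of_le_of_lt (Nat.sInf_le h1) (Nat.mod_lt _ h.degree_pos)
    have hb : sideValue (v h) (holeBoundary mk p b (σ ∘ g.outerFace (mk.mem p)) h)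
        (σ ∘ g.holeFace (mk.mem p) h) (((v h).rep.nxt ^ i) (v h).rep.root)
        = holeBoundary mk p b (σ ∘ g.outerFace (mk.mem p)) h ⟨sInf S, hlt⟩ := by
      rw [sideValue, if_pos hr, dif_pos hlt]
    have hmem' : ((v h).rep.nxt ^ sInf S) (v h).rep.root
      = ((v h).rep.nxt ^ i) (v h).rep.root := hmem
    rw [hb, ← hmem', ← g.glued, sideValue_outer g b σ
      ((g.toPasting (mk.mem p)).rev_pow_mk_notMem h _)]
    rfl
  · rw [sideValue_of_notMem _ _ _ hr, sideValue_of_notMem _ _ _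
      (g.hole_notMem_rootFace (mk.mem p) hr)]
    by_cases hx' : (v h).rep.IsInner x
    · rw [faceValue_of_isInner (v h) _ hx',
        faceValue_of_isInner m σ (g.isInner_hole (mk.mem p) hx'),
        Function.comp_apply, g.holeFace_innerFace]
    · rw [faceValue_of_not_isInner _ _ hx', faceValue_of_not_isInner]
      exact fun h' => hx' ⟨(g.hole_mem h x hr).not.1 h'.1, hr⟩

/-- Each edge is attributed to exactly one part, and interaction with the outside is carried by the
boundary conditions. Given the outer decoration, the energy is a sum of independent terms, whence
the conditional independence. -/
theorem energy_gluing (β : ℝ) {N : ℕ} (b : Fin N → EuclideanSpace ℝ (Fin k))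
    (σ : m.InnerFace → EuclideanSpace ℝ (Fin k)) :
    energy β m b σ = outerEnergy β p b (σ ∘ g.outerFace (mk.mem p))
      + ∑ h, energy β (v h) (holeBoundary mk p b (σ ∘ g.outerFace (mk.mem p)) h)
        (σ ∘ g.holeFace (mk.mem p) h) := by
  unfold energy outerEnergy
  rw [g.sum_darts (mk.mem p), ← Finset.mul_sum, ← mul_add, ← Finset.sum_div, ← add_div]
  refine congrArg (fun x => β / 2 * (x / 2)) (congrArg₂ (· + ·) ?_ ?_)
  · refine Finset.sum_congr rfl fun d hd => ?_
    simp only [Finset.mem_filter, Finset.mem_univ, true_and] at hd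
    rw [← g.outer_rev, sideValue_outer g b σ hd.1, sideValue_outer g b σ hd.2]
  · refine Finset.sum_congr rfl fun h _ => Finset.sum_congr rfl fun x _ => ?_
    rw [← g.hole_rev, sideValue_hole, sideValue_hole]

end Decorated
end QuadHoles

namespace QuadHoles

/-! ### Measure-theoretic tools -/

theorem lintegral_pi_prod {ι : Type*} [Fintype ι] {α : ι → Type*} [∀ i, MeasurableSpace (α i)]
    (μ : ∀ i, Measure (α i)) [∀ i, SigmaFinite (μ i)] {f : ∀ i, α i → ℝ≥0∞}
    (hf : ∀ i, Measurable (f i)) :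
    ∫⁻ x, ∏ i, f i (x i) ∂(Measure.pi μ) = ∏ i, ∫⁻ a, f i a ∂(μ i) := by
  classical
  have hF : Measurable (fun x : ∀ i, α i => ∏ i, f i (x i)) :=
    Finset.measurable_prod _ fun i _ => (hf i).comp (measurable_pi_apply i)
  have key : ∀ s : Finset ι, ∀ x, lmarginal μ s (fun x => ∏ i, f i (x i)) x
      = (∏ i ∈ s, ∫⁻ a, f i a ∂(μ i)) * ∏ i ∈ sᶜ, f i (x i) := by
    intro s
    induction s using Finset.induction_on with
    | empty => intro x; simp
    | insert i s hi ih =>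
      intro x
      rw [lmarginal_insert _ hF hi]
      simp only [ih]
      have h1 : ∀ a : α i, ∏ j ∈ sᶜ, f j (Function.update x i a j)
          = f i a * ∏ j ∈ (insert i s)ᶜ, f j (x j) := by
        intro a
        have hins : sᶜ = insert i (insert i s)ᶜ := by
          ext j
          simp only [Finset.mem_compl, Finset.mem_insert]
          by_cases h : j = i
          · simp [h, hi]
          · simp [h]
        rw [hins, Finset.prod_insert (by simp)]
        congr 1
        · simp
        · refine Finset.prod_congr rfl fun j hj => ?_
          rw [Function.update_of_ne]
          rintro rfl
          simp at hj
      simp only [h1]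
      rw [Finset.prod_insert hi, lintegral_const_mul _ ((hf i).mul_const _),
        lintegral_mul_const _ (hf i)]
      ring
  have := key Finset.univ
  rcases isEmpty_or_nonempty (∀ i, α i) with he | ⟨⟨x⟩⟩
  · rw [lintegral_of_isEmpty]
    obtain ⟨i, hi⟩ : ∃ i, IsEmpty (α i) := by
      by_contra hne
      push Not at hne
      exact he.elim fun i => (hne i).some
    exact (Finset.prod_eq_zero (Finset.mem_univ i) (lintegral_of_isEmpty _ _)).symm
  · rw [lintegral_eq_lmarginal_univ x, this]
    simp

/-- Tonelli for counting measures. It factorizes the sum over families of fillings. -/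
theorem tsum_pi_prod {ι α : Type*} [Fintype ι] [Countable α] (f : ι → α → ℝ≥0∞) :
    ∑' u : ι → α, ∏ i, f i (u i) = ∏ i, ∑' a, f i a := by
  let _ : MeasurableSpace α := ⊤
  have h := lintegral_pi_prod (fun _ : ι => (Measure.count : Measure α))
    (f := f) (fun i => measurable_from_top)
  rw [lintegral_countable'] at h
  simp only [Measure.pi_singleton, Measure.count_singleton, Finset.prod_const_one, mul_one,
    lintegral_count] at h
  exact h

/-- Dividing each weight by its normalising constant and multiplying back. A vanishing constant
forces its weight to vanish; if none vanishes, finiteness of the product makes each of them finite.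
-/
theorem prod_eq_prod_inv_mul_mul_prod {ι : Type*} [Fintype ι] {a Z : ι → ℝ≥0∞}
    (haZ : ∀ i, a i ≤ Z i) (hZ : ∏ i, Z i ≠ ∞) :
    ∏ i, a i = (∏ i, (Z i)⁻¹ * a i) * ∏ i, Z i := by
  classical
  by_cases h0 : ∃ i, Z i = 0
  · obtain ⟨i, hi⟩ := h0
    rw [Finset.prod_eq_zero (Finset.mem_univ i) hi, mul_zero]
    exact Finset.prod_eq_zero (Finset.mem_univ i) (le_antisymm (hi ▸ haZ i) zero_le)
  · push Not at h0
    have htop : ∀ i, Z i ≠ ∞ := by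
      intro i hi
      refine hZ ?_
      rw [← Finset.mul_prod_erase _ _ (Finset.mem_univ i), hi, ENNReal.top_mul]
      exact Finset.prod_ne_zero_iff.2 fun j _ => h0 j
    rw [← Finset.prod_mul_distrib]
    refine Finset.prod_congr rfl fun i _ => ?_
    rw [mul_comm _ (a i), mul_assoc, ENNReal.inv_mul_cancel (h0 i) (htop i), mul_one]

section Sigma

variable {ι : Type*} {α : ι → Type*} [∀ i, MeasurableSpace (α i)]

theorem measurableSet_sigma_iff {s : Set (Σ i, α i)} :
    MeasurableSet s ↔ ∀ i, MeasurableSet (Sigma.mk i ⁻¹' s) :=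
  MeasurableSpace.measurableSet_iInf

theorem measurable_sigma_iff {β : Type*} [MeasurableSpace β] {f : (Σ i, α i) → β} :
    Measurable f ↔ ∀ i, Measurable fun a => f ⟨i, a⟩ := by
  constructor
  · intro hf i s hs
    exact measurableSet_sigma_iff.1 (hf hs) i
  · intro hf s hs
    exact measurableSet_sigma_iff.2 fun i => hf i hs

theorem measurable_sigmaMk (i : ι) : Measurable (Sigma.mk i : α i → Σ i, α i) :=
  fun _ hs => measurableSet_sigma_iff.1 hs i

theorem measurable_sigma_fst [MeasurableSpace ι] : Measurable (Sigma.fst : (Σ i, α i) → ι) :=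
  measurable_sigma_iff.2 fun _ => measurable_const

theorem measurableEmbedding_sigmaMk (i : ι) :
    MeasurableEmbedding (Sigma.mk i : α i → Σ i, α i) where
  injective := sigma_mk_injective
  measurable := measurable_sigmaMk i
  measurableSet_image' s hs := by
    rw [measurableSet_sigma_iff]
    intro j
    by_cases h : i = j
    · subst h
      rwa [Set.preimage_image_eq _ sigma_mk_injective]
    · convert MeasurableSet.empty
      ext a
      simp only [Set.mem_preimage, Set.mem_image, Set.mem_empty_iff_false, iff_false, not_exists]
      rintro b ⟨-, hb⟩
      exact h (congrArg Sigma.fst hb)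

/-- On each of the countably many summands the boxes form a generating π-system. -/
theorem ext_sigma_of_box [Countable ι] {κ : ι → Type*} [∀ i, Fintype (κ i)] {E : Type*}
    [MeasurableSpace E] {ν ν' : Measure (Σ i, (κ i → E))} [IsFiniteMeasure ν]
    (h : ∀ i (A : κ i → Set E), (∀ f, MeasurableSet (A f)) →
      ν (Sigma.mk i '' Set.univ.pi A) = ν' (Sigma.mk i '' Set.univ.pi A)) : ν = ν' := by
  have hi : ∀ i, ν.comap (Sigma.mk i) = ν'.comap (Sigma.mk i) := by
    intro i
    have hemb := measurableEmbedding_sigmaMk (α := fun i => κ i → E) i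
    have : IsFiniteMeasure (ν.comap (Sigma.mk i)) := ⟨by
      rw [hemb.comap_apply]; exact measure_lt_top _ _⟩
    refine ext_of_generate_finite _ generateFrom_pi.symm isPiSystem_pi ?_ ?_
    · rintro _ ⟨A, hA, rfl⟩
      rw [hemb.comap_apply, hemb.comap_apply]
      exact h i A fun f => hA f (Set.mem_univ f)
    · rw [hemb.comap_apply, hemb.comap_apply, ← Set.pi_univ Set.univ]
      exact h i _ fun f => MeasurableSet.univ
  ext s hs
  have hs' : s = ⋃ i, Sigma.mk i '' (Sigma.mk i ⁻¹' s) := by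
    ext x
    simp only [Set.mem_iUnion, Set.mem_image, Set.mem_preimage]
    exact ⟨fun h => ⟨x.1, x.2, h, rfl⟩, fun ⟨_, _, h, hx⟩ => hx ▸ h⟩
  have hd : Pairwise (Function.onFun Disjoint fun i => Sigma.mk i '' (Sigma.mk i ⁻¹' s)) := by
    intro i j hij
    refine Set.disjoint_left.2 ?_
    rintro _ ⟨a, -, rfl⟩ ⟨b, -, hb⟩
    exact hij (congrArg Sigma.fst hb).symm
  have hm : ∀ i, MeasurableSet (Sigma.mk i '' (Sigma.mk i ⁻¹' s)) := fun i =>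
    (measurableEmbedding_sigmaMk i).measurableSet_image.2 (measurableSet_sigma_iff.1 hs i)
  rw [hs', measure_iUnion hd hm, measure_iUnion hd hm]
  refine tsum_congr fun i => ?_
  have hemb := measurableEmbedding_sigmaMk (α := fun i => κ i → E) i
  rw [← hemb.comap_apply, ← hemb.comap_apply, hi]

end Sigma

/-- Splitting a product measure according to a partition of the index set. -/
theorem measurePreserving_split {A I C : Type*} {J : I → Type*} {E : Type*} [Fintype A]
    [Fintype I] [∀ i, Fintype (J i)] [Fintype C] [MeasurableSpace E] (μ : Measure E)
    [SigmaFinite μ] (e : A ⊕ (Σ i, J i) ≃ C) :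
    MeasurePreserving (fun (σ : C → E) => ((fun a => σ (e (Sum.inl a)),
        fun i j => σ (e (Sum.inr ⟨i, j⟩))) : (A → E) × (∀ i, J i → E)))
      (Measure.pi fun _ => μ)
      ((Measure.pi fun _ => μ).prod (Measure.pi fun i => Measure.pi fun _ : J i => μ)) := by
  let join : (A → E) × (∀ i, J i → E) → (C → E) := fun x c =>
    Sum.elim x.1 (fun y => x.2 y.1 y.2) (e.symm c)
  have hjoin : Measurable join := by
    refine measurable_pi_lambda _ fun c => ?_
    obtain ⟨z, rfl⟩ := e.surjective c
    rcases z with a | ⟨i, j⟩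
    · simp only [join, Equiv.symm_apply_apply, Sum.elim_inl]
      fun_prop
    · simp only [join, Equiv.symm_apply_apply, Sum.elim_inr]
      exact (measurable_pi_apply j).comp ((measurable_pi_apply i).comp measurable_snd)
  have hsplit : Measurable (fun (σ : C → E) => ((fun a => σ (e (Sum.inl a)),
        fun i j => σ (e (Sum.inr ⟨i, j⟩))) : (A → E) × (∀ i, J i → E))) := by
    fun_prop
  refine ⟨hsplit, ?_⟩
  have hpi : Measure.pi (fun _ : C => μ) = Measure.map join
      ((Measure.pi fun _ => μ).prod (Measure.pi fun i => Measure.pi fun _ : J i => μ)) := by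
    refine Measure.pi_eq fun s hs => ?_
    rw [Measure.map_apply hjoin (MeasurableSet.univ_pi hs)]
    have hpre : join ⁻¹' Set.univ.pi s
        = (Set.univ.pi fun a => s (e (Sum.inl a))) ×ˢ
          (Set.univ.pi fun i => Set.univ.pi fun j => s (e (Sum.inr ⟨i, j⟩))) := by
      ext x
      simp only [Set.mem_preimage, Set.mem_pi, Set.mem_univ, true_implies, Set.mem_prod]
      constructor
      · intro h
        exact ⟨fun a => by simpa [join] using h (e (Sum.inl a)),
          fun i j => by simpa [join] using h (e (Sum.inr ⟨i, j⟩))⟩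
      · rintro ⟨h1, h2⟩ c
        obtain ⟨z, rfl⟩ := e.surjective c
        rcases z with a | ⟨i, j⟩
        · simpa [join] using h1 a
        · simpa [join] using h2 i j
    rw [hpre, Measure.prod_prod, Measure.pi_pi, Measure.pi_pi]
    simp only [Measure.pi_pi]
    rw [← e.prod_comp, Fintype.prod_sum_type, Fintype.prod_sigma]
  rw [hpi, Measure.map_map hsplit hjoin]
  convert Measure.map_id
  funext x
  simp [join]

end QuadHoles

namespace QuadHoles
open LMap

/-! ### The decomposition of a decorated map along a map with holes -/

section Decomposition

variable {k : ℕ} {mk : Marking} {p p' m : QH}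

/-- The family of maps in the holes of `p`, for a map that contains `p`. -/
noncomputable def Sub.family (h : Sub mk p m) : p.Hole → QH := h.choose

theorem Sub.isGluing (h : Sub mk p m) : IsGluing mk p h.family m := h.choose_spec

/-- The gluing of a map from a map `p` that it contains. -/
noncomputable def Sub.glue (h : Sub mk p m) :
    GlueMaps p.rep (fun h => (mk p h).1) (fun k => (h.family k).rep) m.rep := h.isGluing.some

open Classical in
/-- The restriction to `p` of the decoration of a map that contains `p`. -/
noncomputable def restrict (mk : Marking) (p : QH) (M : DecMap k) :
    p.InnerFace → EuclideanSpace ℝ (Fin k) :=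
  if h : Sub mk p M.1 then M.2 ∘ h.glue.outerFace (mk.mem p) else 0

open Classical in
/-- The decorated maps in the holes of `p`, for a map that contains `p`. -/
noncomputable def parts (mk : Marking) (p : QH) (M : DecMap k) : p.Hole → DecMap k := fun i =>
  if h : Sub mk p M.1 then ⟨h.family i, M.2 ∘ h.glue.holeFace (mk.mem p) i⟩ else ⟨p, 0⟩

theorem restrict_of_sub {M : DecMap k} (h : Sub mk p M.1) :
    restrict mk p M = M.2 ∘ h.glue.outerFace (mk.mem p) := dif_pos h

theorem restrict_of_not_sub {M : DecMap k} (h : ¬ Sub mk p M.1) : restrict mk p M = 0 := dif_neg h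

theorem parts_of_sub {M : DecMap k} (h : Sub mk p M.1) :
    parts mk p M = fun i => ⟨h.family i, M.2 ∘ h.glue.holeFace (mk.mem p) i⟩ :=
  funext fun _ => dif_pos h

theorem isDecGluing_restrict_parts {M : DecMap k} (h : Sub mk p M.1) :
    IsDecGluing mk p (restrict mk p M) (parts mk p M) M := by
  rw [restrict_of_sub h, parts_of_sub h]
  exact (isDecGluing_iff h.glue _ _ _).2 ⟨rfl, fun _ => rfl⟩

theorem IsDecGluing.sub {M : DecMap k} {τ : p.InnerFace → EuclideanSpace ℝ (Fin k)}
    {U : p.Hole → DecMap k} (h : IsDecGluing mk p τ U M) : Sub mk p M.1 := by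
  obtain ⟨g, -⟩ := h
  exact ⟨fun i => (U i).1, ⟨g⟩⟩

theorem IsDecGluing.unique {M : DecMap k} {τ : p.InnerFace → EuclideanSpace ℝ (Fin k)}
    {U : p.Hole → DecMap k} (h : IsDecGluing mk p τ U M) :
    τ = restrict mk p M ∧ U = parts mk p M := by
  have hs := h.sub
  obtain ⟨v, s, rfl⟩ : ∃ (v : p.Hole → QH)
      (s : ∀ i, (v i).InnerFace → EuclideanSpace ℝ (Fin k)), U = fun i => ⟨v i, s i⟩ :=
    ⟨fun i => (U i).1, fun i => (U i).2, rfl⟩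
  have hv : v = hs.family := by
    obtain ⟨g, -⟩ := h
    exact IsGluing.family_unique ⟨g⟩ hs.isGluing
  subst hv
  obtain ⟨h1, h2⟩ := (isDecGluing_iff hs.glue _ _ _).1 h
  rw [restrict_of_sub hs, parts_of_sub hs]
  exact ⟨h1, funext fun i => congrArg _ (h2 i)⟩

theorem measurable_restrict (mk : Marking) (p : QH) :
    Measurable (restrict (k := k) mk p) := by
  rw [measurable_sigma_iff]
  intro m
  by_cases h : Sub mk p m
  · have : (fun σ => restrict (k := k) mk p ⟨m, σ⟩)
        = fun σ => σ ∘ h.glue.outerFace (mk.mem p) := funext fun σ => restrict_of_sub h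
    rw [this]
    exact measurable_pi_lambda _ fun f => measurable_pi_apply _
  · have : (fun σ => restrict (k := k) mk p ⟨m, σ⟩) = fun _ => 0 :=
      funext fun σ => restrict_of_not_sub h
    rw [this]
    exact measurable_const

theorem measurable_parts (mk : Marking) (p : QH) : Measurable (parts (k := k) mk p) := by
  rw [measurable_sigma_iff]
  intro m
  by_cases h : Sub mk p m
  · have : (fun σ => parts (k := k) mk p ⟨m, σ⟩)
        = fun σ i => ⟨h.family i, σ ∘ h.glue.holeFace (mk.mem p) i⟩ :=
      funext fun σ => parts_of_sub (M := ⟨m, σ⟩) h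
    rw [this]
    exact measurable_pi_lambda _ fun i => (measurable_sigmaMk _).comp
      (measurable_pi_lambda _ fun f => measurable_pi_apply _)
  · have : (fun σ => parts (k := k) mk p ⟨m, σ⟩) = fun _ _ => ⟨p, 0⟩ :=
      funext fun σ => funext fun i => dif_neg h
    rw [this]
    exact measurable_const

theorem measurableSet_sub (mk : Marking) (p : QH) :
    MeasurableSet {M : DecMap k | Sub mk p M.1} :=
  measurable_sigma_fst (show MeasurableSet {m | Sub mk p m} from trivial)

/-- By rigidity the inclusion of `p` into a map factors through `p'`, so the faces of `p` are found
among those of `p'`. -/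
theorem exists_restrict_eq (h : Sub mk p p') : ∃ r : (p'.InnerFace → EuclideanSpace ℝ (Fin k)) →
    (p.InnerFace → EuclideanSpace ℝ (Fin k)), Measurable r ∧
    ∀ M : DecMap k, Sub mk p' M.1 → restrict mk p M = r (restrict mk p' M) := by
  refine ⟨fun τ => τ ∘ h.glue.outerFace (mk.mem p),
    measurable_pi_lambda _ fun f => measurable_pi_apply _, fun M h' => ?_⟩
  rw [restrict_of_sub (h.trans h'), restrict_of_sub h']
  funext f
  change M.2 _ = M.2 _
  obtain ⟨d, hd, rfl⟩ := exists_innerFace f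
  have hr : (h.trans h').glue.fromOuter = fun d => h'.glue.fromOuter (h.glue.fromOuter d) := by
    refine rigid M.1.rep.rev.injective M.1.rep.nxt.injective ?_ (h.trans h').glue.outer_rev ?_
      (h.trans h').glue.outer_nxt ?_
    · rw [(h.trans h').glue.outer_root, h.glue.outer_root, h'.glue.outer_root]
    · intro d
      rw [h.glue.outer_rev, h'.glue.outer_rev]
    · intro d hd
      rw [h.glue.outer_nxt d hd, h'.glue.outer_nxt _ (h.glue.outer_notMem d hd)]
  refine congrArg M.2 ?_
  simp only [GlueMaps.outerFace_innerFace, hr]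

end Decomposition

/-! ### The Markov property of Boltzmann decorated maps -/

section Markov

variable {k : ℕ} {mk : Marking} {p m : QH} {q β : ℝ} {μ : Measure (EuclideanSpace ℝ (Fin k))}
  {N : ℕ}

open Classical in
/-- The measure on decorated maps whose normalization is the law of the Boltzmann decorated map. -/
noncomputable def decWeight (q β : ℝ) (μ : Measure (EuclideanSpace ℝ (Fin k)))
    (N : ℕ) (b : Fin N → EuclideanSpace ℝ (Fin k)) : Measure (DecMap k) :=
  Measure.sum fun m : QH =>
    if m.IsQuad N then
      ENNReal.ofReal q ^ Fintype.card m.InnerFace •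
        ((Measure.pi fun _ : m.InnerFace => μ).withDensity
          fun σ => ENNReal.ofReal (Real.exp (-energy β m b σ))).map (Sigma.mk m)
    else 0

theorem decBoltzmann_eq (b : Fin N → EuclideanSpace ℝ (Fin k)) : decBoltzmann q β μ N b
    = (decWeight q β μ N b Set.univ)⁻¹ • decWeight q β μ N b := rfl

theorem measurable_exp_energy (β : ℝ) (m : QH) :
    Measurable (fun x : (Fin N → EuclideanSpace ℝ (Fin k)) ×
      (m.InnerFace → EuclideanSpace ℝ (Fin k)) =>
        ENNReal.ofReal (Real.exp (-energy β m x.1 x.2))) :=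
  (Real.measurable_exp.comp (measurable_energy β m).neg).ennreal_ofReal

theorem measurable_exp_energy_right (β : ℝ) (m : QH) (b : Fin N → EuclideanSpace ℝ (Fin k)) :
    Measurable (fun σ : m.InnerFace → EuclideanSpace ℝ (Fin k) =>
        ENNReal.ofReal (Real.exp (-energy β m b σ))) := by
  have h : Measurable fun σ : m.InnerFace → EuclideanSpace ℝ (Fin k) => (b, σ) :=
    measurable_const.prodMk measurable_id
  have h' := (measurable_exp_energy (N := N) β m).comp h
  exact h'

open Classical in
theorem lintegral_decWeight (b : Fin N → EuclideanSpace ℝ (Fin k)) {f : DecMap k → ℝ≥0∞}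
    (hf : Measurable f) : ∫⁻ M, f M ∂(decWeight q β μ N b)
      = ∑' m : QH, if m.IsQuad N then ENNReal.ofReal q ^ Fintype.card m.InnerFace *
          ∫⁻ σ, ENNReal.ofReal (Real.exp (-energy β m b σ)) * f ⟨m, σ⟩
            ∂(Measure.pi fun _ : m.InnerFace => μ) else 0 := by
  rw [decWeight, lintegral_sum_measure]
  refine tsum_congr fun m => ?_
  split_ifs with h
  · rw [lintegral_smul_measure, lintegral_map hf (measurable_sigmaMk m),
      lintegral_withDensity_eq_lintegral_mul _ (measurable_exp_energy_right β m b)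
        (g := fun σ => f ⟨m, σ⟩) (hf.comp (measurable_sigmaMk m))]
    rfl
  · simp

/-- The contribution of the undecorated map `m` to the weight of a set of decorated maps. -/
noncomputable def mapWeight (q β : ℝ) (μ : Measure (EuclideanSpace ℝ (Fin k))) (m : QH)
    (b : Fin N → EuclideanSpace ℝ (Fin k)) (B : Set (DecMap k)) : ℝ≥0∞ := by
  classical exact
  if m.IsQuad N then ENNReal.ofReal q ^ Fintype.card m.InnerFace *
    ∫⁻ σ, ENNReal.ofReal (Real.exp (-energy β m b σ)) * B.indicator 1 (⟨m, σ⟩ : DecMap k)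
      ∂(Measure.pi fun _ : m.InnerFace => μ) else 0

theorem decWeight_apply (b : Fin N → EuclideanSpace ℝ (Fin k)) {B : Set (DecMap k)}
    (hB : MeasurableSet B) : decWeight q β μ N b B = ∑' m, mapWeight q β μ m b B := by
  rw [← lintegral_indicator_one hB, lintegral_decWeight b (measurable_one.indicator hB)]
  rfl

theorem measurable_mapWeight [SigmaFinite μ] (m : QH) {B : Set (DecMap k)}
    (hB : MeasurableSet B) : Measurable
      (fun b : Fin N → EuclideanSpace ℝ (Fin k) => mapWeight q β μ m b B) := by
  unfold mapWeight
  split_ifs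
  · refine Measurable.const_mul ?_ _
    refine Measurable.lintegral_prod_right' (f := fun x : (Fin N → EuclideanSpace ℝ (Fin k)) ×
      (m.InnerFace → EuclideanSpace ℝ (Fin k)) => ENNReal.ofReal (Real.exp (-energy β m x.1 x.2))
        * B.indicator 1 (⟨m, x.2⟩ : DecMap k)) ?_
    exact (measurable_exp_energy β m).mul
      ((measurable_one.indicator hB).comp ((measurable_sigmaMk m).comp measurable_snd))
  · exact measurable_const

theorem measurable_decWeight [SigmaFinite μ] {B : Set (DecMap k)} (hB : MeasurableSet B) :
    Measurable (fun b : Fin N → EuclideanSpace ℝ (Fin k) => decWeight q β μ N b B) := by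
  simp only [decWeight_apply _ hB]
  exact Measurable.tsum fun m => measurable_mapWeight m hB

theorem measurable_decBoltzmann [SigmaFinite μ] {B : Set (DecMap k)} (hB : MeasurableSet B) :
    Measurable (fun b : Fin N → EuclideanSpace ℝ (Fin k) => decBoltzmann q β μ N b B) := by
  simp only [decBoltzmann_eq, Measure.smul_apply, smul_eq_mul]
  exact (measurable_decWeight MeasurableSet.univ).inv.mul (measurable_decWeight hB)

/-- The conditional law of the decorated maps in the holes of `p`. -/
noncomputable def holesLaw (mk : Marking) (q β : ℝ) (μ : Measure (EuclideanSpace ℝ (Fin k)))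
    (p : QH) (b : Fin N → EuclideanSpace ℝ (Fin k)) (B : p.Hole → Set (DecMap k))
    (τ : p.InnerFace → EuclideanSpace ℝ (Fin k)) : ℝ≥0∞ :=
  ∏ h, decBoltzmann q β μ h.degree (holeBoundary mk p b τ h) (B h)

theorem measurable_holesLaw [SigmaFinite μ] (b : Fin N → EuclideanSpace ℝ (Fin k))
    {B : p.Hole → Set (DecMap k)} (hB : ∀ h, MeasurableSet (B h)) :
    Measurable (holesLaw mk q β μ p b B) :=
  Finset.measurable_prod _ fun h _ => (measurable_decBoltzmann (hB h)).comp
    (measurable_holeBoundary mk p b h)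

theorem _root_.Measurable.mul_prod_apply {α ι : Type*} [Fintype ι] {γ : ι → Type*}
    [MeasurableSpace α] [∀ i, MeasurableSpace (γ i)] {G : α → ℝ≥0∞} (hG : Measurable G)
    {φ : ∀ i, α → γ i → ℝ≥0∞} (hφ : ∀ i, Measurable fun x : α × γ i => φ i x.1 x.2) :
    Measurable fun x : α × (∀ i, γ i) => G x.1 * ∏ i, φ i x.1 (x.2 i) :=
  (hG.comp measurable_fst).mul (Finset.measurable_prod _ fun i _ =>
    (hφ i).comp (measurable_fst.prodMk ((measurable_pi_apply i).comp measurable_snd)))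

theorem lintegral_prod_mul_prod_apply {α ι : Type*} [Fintype ι] {γ : ι → Type*}
    [MeasurableSpace α] [∀ i, MeasurableSpace (γ i)] {G : α → ℝ≥0∞} (hG : Measurable G)
    {φ : ∀ i, α → γ i → ℝ≥0∞} (hφ : ∀ i, Measurable fun x : α × γ i => φ i x.1 x.2)
    (κ : Measure α) (ρ : ∀ i, Measure (γ i)) [∀ i, SigmaFinite (ρ i)] :
    ∫⁻ x, G x.1 * ∏ i, φ i x.1 (x.2 i) ∂(κ.prod (Measure.pi ρ))
      = ∫⁻ a, G a * ∏ i, ∫⁻ s, φ i a s ∂(ρ i) ∂κ := by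
  have hφ' : ∀ a i, Measurable (φ i a) := fun a i =>
    (hφ i).comp (measurable_const.prodMk measurable_id)
  rw [lintegral_prod _ (hG.mul_prod_apply hφ).aemeasurable]
  refine lintegral_congr fun a => ?_
  have hm : Measurable fun x : ∀ i, γ i => ∏ i, φ i a (x i) :=
    Finset.measurable_prod _ fun i _ => (hφ' a i).comp (measurable_pi_apply i)
  rw [← lintegral_pi_prod ρ (hφ' a), ← lintegral_const_mul _ hm]

/-- The contribution of a map that contains `p`, in terms of its parts. -/
theorem lintegral_gluing [SigmaFinite μ] {v : p.Hole → QH}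
    (g : GlueMaps p.rep (fun h => (mk p h).1) (fun h => (v h).rep) m.rep)
    (b : Fin N → EuclideanSpace ℝ (Fin k))
    {G : (p.InnerFace → EuclideanSpace ℝ (Fin k)) → ℝ≥0∞} (hG : Measurable G)
    {B : p.Hole → Set (DecMap k)} (hB : ∀ h, MeasurableSet (B h)) :
    ∫⁻ σ, ENNReal.ofReal (Real.exp (-energy β m b σ)) * (G (σ ∘ g.outerFace (mk.mem p)) *
        ∏ h, (B h).indicator 1 (⟨v h, σ ∘ g.holeFace (mk.mem p) h⟩ : DecMap k))
          ∂(Measure.pi fun _ : m.InnerFace => μ)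
      = ∫⁻ τ, G τ * ENNReal.ofReal (Real.exp (-outerEnergy β p b τ)) *
          ∏ h, ∫⁻ s, ENNReal.ofReal (Real.exp (-energy β (v h) (holeBoundary mk p b τ h) s)) *
            (B h).indicator 1 (⟨v h, s⟩ : DecMap k) ∂(Measure.pi fun _ : (v h).InnerFace => μ)
          ∂(Measure.pi fun _ : p.InnerFace => μ) := by
  let φ : ∀ h, (p.InnerFace → EuclideanSpace ℝ (Fin k)) →
      ((v h).InnerFace → EuclideanSpace ℝ (Fin k)) → ℝ≥0∞ := fun h τ s =>
    ENNReal.ofReal (Real.exp (-energy β (v h) (holeBoundary mk p b τ h) s)) *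
      (B h).indicator 1 (⟨v h, s⟩ : DecMap k)
  have hφ : ∀ h, Measurable fun x : (p.InnerFace → EuclideanSpace ℝ (Fin k)) ×
      ((v h).InnerFace → EuclideanSpace ℝ (Fin k)) => φ h x.1 x.2 := fun h =>
    ((measurable_exp_energy β (v h)).comp
      (((measurable_holeBoundary mk p b h).comp measurable_fst).prodMk measurable_snd)).mul
      ((measurable_one.indicator (hB h)).comp ((measurable_sigmaMk _).comp measurable_snd))
  have hGo : Measurable fun τ => G τ * ENNReal.ofReal (Real.exp (-outerEnergy β p b τ)) :=
    hG.mul (ENNReal.measurable_ofReal.comp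
      (Real.measurable_exp.comp (measurable_outerEnergy β p b).neg))
  have hmp := measurePreserving_split μ (g.faceEquiv (mk.mem p))
  have hpt : ∀ σ : m.InnerFace → EuclideanSpace ℝ (Fin k),
      ENNReal.ofReal (Real.exp (-energy β m b σ)) * (G (σ ∘ g.outerFace (mk.mem p)) *
        ∏ h, (B h).indicator 1 (⟨v h, σ ∘ g.holeFace (mk.mem p) h⟩ : DecMap k))
      = G (σ ∘ g.outerFace (mk.mem p))
        * ENNReal.ofReal (Real.exp (-outerEnergy β p b (σ ∘ g.outerFace (mk.mem p))))
        * ∏ h, φ h (σ ∘ g.outerFace (mk.mem p)) (σ ∘ g.holeFace (mk.mem p) h) := by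
    intro σ
    rw [energy_gluing g, neg_add, Real.exp_add, ENNReal.ofReal_mul (Real.exp_nonneg _),
      ← Finset.sum_neg_distrib, Real.exp_sum, ENNReal.ofReal_prod_of_nonneg
      fun _ _ => Real.exp_nonneg _]
    simp only [φ, Finset.prod_mul_distrib]
    ring
  rw [lintegral_congr hpt]
  exact (hmp.lintegral_comp (hGo.mul_prod_apply hφ)).trans
    (lintegral_prod_mul_prod_apply hGo hφ _ _)

/-- The quadrangulations containing `p` correspond to the families of quadrangulations with the
perimeters of its holes. Weights being multiplicative, the sum over families becomes a product of
total weights, one for each hole. -/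
theorem lintegral_decWeight_sub [SigmaFinite μ] (hp : p.rep.perimeter = N)
    (b : Fin N → EuclideanSpace ℝ (Fin k))
    {G : (p.InnerFace → EuclideanSpace ℝ (Fin k)) → ℝ≥0∞} (hG : Measurable G)
    {B : p.Hole → Set (DecMap k)} (hB : ∀ h, MeasurableSet (B h)) :
    ∫⁻ M in {M | Sub mk p M.1}, G (restrict mk p M) * ∏ h, (B h).indicator 1 (parts mk p M h)
        ∂(decWeight q β μ N b)
      = ENNReal.ofReal q ^ Fintype.card p.InnerFace *
        ∫⁻ τ, G τ * ENNReal.ofReal (Real.exp (-outerEnergy β p b τ)) *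
          ∏ h, decWeight q β μ h.degree (holeBoundary mk p b τ h) (B h)
          ∂(Measure.pi fun _ : p.InnerFace => μ) := by
  classical
  have hGo : Measurable fun τ => G τ * ENNReal.ofReal (Real.exp (-outerEnergy β p b τ)) :=
    hG.mul (ENNReal.measurable_ofReal.comp
      (Real.measurable_exp.comp (measurable_outerEnergy β p b).neg))
  let w : (p.Hole → QH) → (p.InnerFace → EuclideanSpace ℝ (Fin k)) → ℝ≥0∞ := fun v τ =>
    G τ * ENNReal.ofReal (Real.exp (-outerEnergy β p b τ)) *
      ∏ h, mapWeight q β μ (v h) (holeBoundary mk p b τ h) (B h)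
  have hw : ∀ v, Measurable (w v) := fun v => hGo.mul (Finset.measurable_prod _ fun h _ =>
    (measurable_mapWeight (v h) (hB h)).comp (measurable_holeBoundary mk p b h))
  let Ψ : (p.Hole → QH) → ℝ≥0∞ := fun v => ENNReal.ofReal q ^ Fintype.card p.InnerFace *
    ∫⁻ τ, w v τ ∂(Measure.pi fun _ : p.InnerFace => μ)
  have hΨ0 : ∀ v, (¬ ∀ h, (v h).IsQuad h.degree) → Ψ v = 0 := by
    intro v hv
    push Not at hv
    obtain ⟨h, hh⟩ := hv
    have : w v = 0 := by
      funext τ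
      simp only [w]
      rw [Finset.prod_eq_zero (Finset.mem_univ h), mul_zero]
      · rfl
      · simp [mapWeight, hh]
    simp [Ψ, this]
  have hf : Measurable fun M : DecMap k => G (restrict mk p M)
      * ∏ h, (B h).indicator 1 (parts mk p M h) :=
    (hG.comp (measurable_restrict mk p)).mul (Finset.measurable_prod _ fun h _ =>
      (measurable_one.indicator (hB h)).comp
        ((measurable_pi_apply h).comp (measurable_parts mk p)))
  rw [← lintegral_indicator (measurableSet_sub mk p), lintegral_decWeight b
    (hf.indicator (measurableSet_sub mk p))]
  -- Each `m` that contains `p` is the gluing of exactly one family, and every admissible family has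
  -- exactly one gluing. The double sum over families and maps can thus be evaluated in either
  -- order.
  have hterm : ∀ m : QH, (if m.IsQuad N then ENNReal.ofReal q ^ Fintype.card m.InnerFace *
          ∫⁻ σ, ENNReal.ofReal (Real.exp (-energy β m b σ)) *
            Set.indicator {M : DecMap k | Sub mk p M.1} (fun M => G (restrict mk p M)
              * ∏ h, (B h).indicator 1 (parts mk p M h)) ⟨m, σ⟩
            ∂(Measure.pi fun _ : m.InnerFace => μ) else 0)
      = ∑' v, if IsGluing mk p v m then Ψ v else 0 := by
    intro m
    by_cases hs : Sub mk p m
    · rw [tsum_eq_single hs.family (fun v hv => if_neg fun h =>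
        hv (h.family_unique hs.isGluing)), if_pos hs.isGluing]
      by_cases hquad : m.IsQuad N
      · rw [if_pos hquad]
        have hv := ((hs.isGluing.isQuad_iff N).1 hquad).2
        have h1 := lintegral_gluing (β := β) (μ := μ) hs.glue b hG hB
        have h2 : ∀ σ, Set.indicator {M : DecMap k | Sub mk p M.1} (fun M => G (restrict mk p M)
              * ∏ h, (B h).indicator 1 (parts mk p M h)) ⟨m, σ⟩
            = G (σ ∘ hs.glue.outerFace (mk.mem p)) * ∏ h, (B h).indicator 1
              (⟨hs.family h, σ ∘ hs.glue.holeFace (mk.mem p) h⟩ : DecMap k) := by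
          intro σ
          rw [Set.indicator_of_mem (show (⟨m, σ⟩ : DecMap k) ∈ {M : DecMap k | Sub mk p M.1}
            from hs), restrict_of_sub (M := ⟨m, σ⟩) hs, parts_of_sub (M := ⟨m, σ⟩) hs]
        simp only [h2]
        rw [h1, hs.glue.card_innerFace (mk.mem p), pow_add, mul_assoc]
        simp only [Ψ]
        congr 1
        rw [← Finset.prod_pow_eq_pow_sum, ← lintegral_const_mul']
        · refine lintegral_congr fun τ => ?_
          simp only [w, mapWeight, if_pos (hv _), Finset.prod_mul_distrib]
          simp only [QH.InnerFace]
          ring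
        · exact ENNReal.prod_ne_top fun h _ => ENNReal.pow_ne_top ENNReal.ofReal_ne_top
      · rw [if_neg hquad, hΨ0]
        exact fun hv => hquad ((hs.isGluing.isQuad_iff N).2 ⟨hp, hv⟩)
    · have h2 : ∀ σ, Set.indicator {M : DecMap k | Sub mk p M.1} (fun M => G (restrict mk p M)
              * ∏ h, (B h).indicator 1 (parts mk p M h)) ⟨m, σ⟩ = 0 := fun σ =>
        Set.indicator_of_notMem (show (⟨m, σ⟩ : DecMap k) ∉ {M : DecMap k | Sub mk p M.1}
            from hs) _
      have h3 : ∀ v, ¬ IsGluing mk p v m := fun v hv => hs ⟨v, hv⟩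
      simp [h2, h3]
  rw [tsum_congr hterm, ENNReal.tsum_comm]
  have hsum : ∀ v, ∑' m, (if IsGluing mk p v m then Ψ v else 0) = Ψ v := by
    intro v
    by_cases hv : ∀ h, (v h).IsQuad h.degree
    · obtain ⟨m, hm⟩ := exists_isGluing mk (u := v) fun h => (hv h).2
      rw [tsum_eq_single m (fun m' hm' => if_neg fun h => hm' (h.unique hm)), if_pos hm]
    · simp [hΨ0 v hv]
  rw [tsum_congr hsum, ENNReal.tsum_mul_left, ← lintegral_tsum fun v => (hw v).aemeasurable]
  congr 1
  refine lintegral_congr fun τ => ?_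
  simp only [w]
  rw [ENNReal.tsum_mul_left, tsum_pi_prod (fun h m =>
    mapWeight q β μ m (holeBoundary mk p b τ h) (B h))]
  congr 1
  exact Finset.prod_congr rfl fun h _ => (decWeight_apply _ (hB h)).symm

/-- The Markov property of Boltzmann decorated maps. -/
theorem lintegral_decBoltzmann_sub [SigmaFinite μ] (b : Fin N → EuclideanSpace ℝ (Fin k))
    {G : (p.InnerFace → EuclideanSpace ℝ (Fin k)) → ℝ≥0∞} (hG : Measurable G)
    {B : p.Hole → Set (DecMap k)} (hB : ∀ h, MeasurableSet (B h)) :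
    ∫⁻ M in {M | Sub mk p M.1}, G (restrict mk p M) * ∏ h, (B h).indicator 1 (parts mk p M h)
        ∂(decBoltzmann q β μ N b)
      = ∫⁻ M in {M | Sub mk p M.1}, G (restrict mk p M)
          * holesLaw mk q β μ p b B (restrict mk p M) ∂(decBoltzmann q β μ N b) := by
  classical
  rw [decBoltzmann_eq, Measure.restrict_smul, lintegral_smul_measure, lintegral_smul_measure]
  -- With infinite total weight `normalize` yields the zero measure.
  by_cases htop : decWeight q β μ N b Set.univ = ∞
  · simp [htop]
  congr 1
  by_cases hp : p.rep.perimeter = N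
  · have h1 := lintegral_decWeight_sub (mk := mk) (q := q) (β := β) (μ := μ) hp b hG hB
    have h2 := lintegral_decWeight_sub (mk := mk) (q := q) (β := β) (μ := μ) hp b
      (hG.mul (measurable_holesLaw (mk := mk) (q := q) (β := β) (μ := μ) b hB)) (B := fun _ => Set.univ) (fun _ => MeasurableSet.univ)
    have h3 := lintegral_decWeight_sub (mk := mk) (q := q) (β := β) (μ := μ) hp b
      (G := 1) measurable_one (B := fun _ => Set.univ) (fun _ => MeasurableSet.univ)
    simp only [Set.indicator_univ, Pi.one_apply, Finset.prod_const_one, mul_one, one_mul,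
      Pi.mul_apply] at h2 h3
    rw [h1, h2]
    by_cases hq : ENNReal.ofReal q ^ Fintype.card p.InnerFace = 0
    · rw [hq, zero_mul, zero_mul]
    congr 1
    have hfin : ∫⁻ τ, ENNReal.ofReal (Real.exp (-outerEnergy β p b τ)) *
          ∏ h, decWeight q β μ h.degree (holeBoundary mk p b τ h) Set.univ
          ∂(Measure.pi fun _ : p.InnerFace => μ) ≠ ∞ := by
      intro h
      rw [h, ENNReal.mul_top hq, lintegral_one, Measure.restrict_apply MeasurableSet.univ,
        Set.univ_inter] at h3
      exact htop (top_le_iff.1 (h3 ▸ measure_mono (Set.subset_univ _)))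
    have hmeas : Measurable fun τ => ENNReal.ofReal (Real.exp (-outerEnergy β p b τ)) *
          ∏ h, decWeight q β μ h.degree (holeBoundary mk p b τ h) Set.univ :=
      (ENNReal.measurable_ofReal.comp
        (Real.measurable_exp.comp (measurable_outerEnergy β p b).neg)).mul
        (Finset.measurable_prod _ fun h _ => (measurable_decWeight MeasurableSet.univ).comp
          (measurable_holeBoundary mk p b h))
    refine lintegral_congr_ae ?_
    -- The normalising constants of the holes depend on `τ`. Their product is finite for almost
    -- every `τ`, because its integral against the positive outer weight is.
    filter_upwards [ae_lt_top hmeas hfin] with τ hτ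
    have hZ : ∏ h, decWeight q β μ h.degree (holeBoundary mk p b τ h) Set.univ ≠ ∞ := by
      intro h
      rw [h, ENNReal.mul_top (by simp [Real.exp_pos])] at hτ
      exact lt_irrefl _ hτ
    rw [prod_eq_prod_inv_mul_mul_prod
      (fun h => measure_mono (Set.subset_univ (B h))) hZ]
    simp only [holesLaw, decBoltzmann_eq, Measure.smul_apply, smul_eq_mul]
    ring
  -- Gluing preserves the perimeter, so for another perimeter the event has no weight.
  · have h0 : decWeight q β μ N b {M | Sub mk p M.1} = 0 := by
      rw [decWeight_apply b (measurableSet_sub mk p)]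
      refine ENNReal.tsum_eq_zero.2 fun m => ?_
      rw [mapWeight]
      split_ifs with hquad
      · have : ∀ σ, Set.indicator {M : DecMap k | Sub mk p M.1} (1 : DecMap k → ℝ≥0∞) ⟨m, σ⟩
            = 0 := fun σ => Set.indicator_of_notMem
          (show (⟨m, σ⟩ : DecMap k) ∉ {M : DecMap k | Sub mk p M.1} from fun hs => hp
          ((((show Sub mk p m from hs).isGluing).isQuad_iff N).1 hquad).1) _
        simp [this]
      · rfl
    rw [Measure.restrict_eq_zero.2 h0]
    simp

end Markov
end QuadHoles

namespace QuadHoles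
open LMap

/-! ### Measures with the Markov property along a map with holes -/

section HasMarkov

variable {k : ℕ} {mk : Marking} {p y : QH} {q β : ℝ} {μ : Measure (EuclideanSpace ℝ (Fin k))}
  {N : ℕ} {b : Fin N → EuclideanSpace ℝ (Fin k)} {κ : Measure (DecMap k)}

/-- On the event that a map contains `p`, and given its restriction to `p`, its parts are, under
the measure `κ`, independent Boltzmann decorated maps. -/
def HasMarkov (mk : Marking) (q β : ℝ) (μ : Measure (EuclideanSpace ℝ (Fin k)))
    (b : Fin N → EuclideanSpace ℝ (Fin k)) (κ : Measure (DecMap k)) (p : QH) : Prop :=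
  ∀ C : Set (p.InnerFace → EuclideanSpace ℝ (Fin k)), MeasurableSet C →
    ∀ B : p.Hole → Set (DecMap k), (∀ h, MeasurableSet (B h)) →
      κ ({M | Sub mk p M.1} ∩ restrict mk p ⁻¹' C ∩ {M | ∀ h, parts mk p M h ∈ B h})
        = ∫⁻ M in {M | Sub mk p M.1} ∩ restrict mk p ⁻¹' C,
            holesLaw mk q β μ p b B (restrict mk p M) ∂κ

theorem prod_indicator_one {ι α : Type*} [Fintype ι] (B : ι → Set α) (x : ι → α) :
    ∏ i, (B i).indicator (1 : α → ℝ≥0∞) (x i)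
      = {x : ι → α | ∀ i, x i ∈ B i}.indicator 1 x := by
  by_cases h : ∀ i, x i ∈ B i
  · rw [Set.indicator_of_mem (show x ∈ {x : ι → α | ∀ i, x i ∈ B i} from h)]
    exact Finset.prod_eq_one fun i _ => Set.indicator_of_mem (h i) _
  · rw [Set.indicator_of_notMem (show x ∉ {x : ι → α | ∀ i, x i ∈ B i} from h)]
    push Not at h
    obtain ⟨i, hi⟩ := h
    exact Finset.prod_eq_zero (Finset.mem_univ i) (Set.indicator_of_notMem hi _)

theorem measurableSet_parts {B : p.Hole → Set (DecMap k)} (hB : ∀ h, MeasurableSet (B h)) :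
    MeasurableSet {M : DecMap k | ∀ h, parts mk p M h ∈ B h} := by
  have : MeasurableSet {x : p.Hole → DecMap k | ∀ h, x h ∈ B h} := by
    rw [Set.ofPred_forall]
    exact MeasurableSet.iInter fun h => (measurable_pi_apply h) (hB h)
  exact measurable_parts mk p this

/-- Where `p` is contained in the map, so is `y`, and the density is a function of the restriction
to `p`. It can then be absorbed into the test function `G` of `lintegral_decBoltzmann_sub`. -/
theorem hasMarkov_withDensity [SigmaFinite μ] (hyp : Sub mk y p)
    {g : (y.InnerFace → EuclideanSpace ℝ (Fin k)) → ℝ≥0∞} (hg : Measurable g) :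
    HasMarkov mk q β μ b (((decBoltzmann q β μ N b).restrict {M | Sub mk y M.1}).withDensity
      fun M => g (restrict mk y M)) p := by
  intro C hC B hB
  obtain ⟨r, hr, hrM⟩ := exists_restrict_eq (k := k) hyp
  have hS := measurableSet_sub (k := k) mk p
  have hSC : MeasurableSet ({M : DecMap k | Sub mk p M.1} ∩ restrict mk p ⁻¹' C) :=
    hS.inter (measurable_restrict mk p hC)
  have hgy : Measurable fun M : DecMap k => g (restrict mk y M) :=
    hg.comp (measurable_restrict mk y)
  have hG : Measurable (C.indicator (g ∘ r)) := (hg.comp hr).indicator hC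
  have key := lintegral_decBoltzmann_sub (mk := mk) (q := q) (β := β) (μ := μ) b hG hB
  have hle : ({M : DecMap k | Sub mk p M.1} ∩ restrict mk p ⁻¹' C) ⊆ {M | Sub mk y M.1} :=
    fun M hM => hyp.trans hM.1
  have hL : Measurable fun M : DecMap k => holesLaw mk q β μ p b B (restrict mk p M) :=
    (measurable_holesLaw b hB).comp (measurable_restrict mk p)
  rw [withDensity_apply _ (hSC.inter (measurableSet_parts hB)),
    Measure.restrict_restrict (hSC.inter (measurableSet_parts hB)),
    Set.inter_eq_left.2 (Set.inter_subset_left.trans hle),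
    setLIntegral_withDensity_eq_setLIntegral_mul _ hgy hL hSC,
    Measure.restrict_restrict hSC, Set.inter_eq_left.2 hle]
  rw [← lintegral_indicator hS, ← lintegral_indicator hS] at key
  rw [← lintegral_indicator hSC, ← lintegral_indicator (hSC.inter (measurableSet_parts hB))]
  refine Eq.trans (lintegral_congr fun M => ?_) (key.trans (lintegral_congr fun M => ?_))
  · simp only [prod_indicator_one]
    by_cases hM : Sub mk p M.1
    · by_cases hc : restrict mk p M ∈ C <;>
        by_cases hb : ∀ h, parts mk p M h ∈ B h <;>
        simp [hM, hc, hb, hrM M hM]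
    · simp [hM]
  · by_cases hM : Sub mk p M.1
    · by_cases hc : restrict mk p M ∈ C <;>
        simp [hM, hc, hrM M hM]
    · simp [hM]

theorem hasMarkov_decBoltzmann [SigmaFinite μ] :
    HasMarkov mk q β μ b (decBoltzmann q β μ N b) p := by
  have h := hasMarkov_withDensity (mk := mk) (q := q) (β := β) (μ := μ) (b := b)
    (Sub.refl mk p) (g := 1) measurable_one
  intro C hC B hB
  have hSC : MeasurableSet ({M : DecMap k | Sub mk p M.1} ∩ restrict mk p ⁻¹' C) :=
    (measurableSet_sub mk p).inter (measurable_restrict mk p hC)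
  have h' := h C hC B hB
  simp only [Pi.one_apply] at h'
  rw [show (fun _ : DecMap k => (1 : ℝ≥0∞)) = 1 from rfl, withDensity_one,
    Measure.restrict_apply (hSC.inter (measurableSet_parts hB)),
    Measure.restrict_restrict hSC,
    Set.inter_eq_left.2 (Set.inter_subset_left.trans Set.inter_subset_left),
    Set.inter_eq_left.2 Set.inter_subset_left] at h'
  exact h'

/-- A box of decorations of `m` is a rectangle in the restriction to `y` and the parts, exactly the
type of event that `HasMarkov` describes. -/
theorem image_box_of_sub {m : QH} (hs : Sub mk y m)
    (A : m.InnerFace → Set (EuclideanSpace ℝ (Fin k))) :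
    (Sigma.mk m '' Set.univ.pi A : Set (DecMap k))
      = {M | Sub mk y M.1}
        ∩ restrict mk y ⁻¹' (Set.univ.pi fun f => A (hs.glue.outerFace (mk.mem y) f))
        ∩ {M | ∀ h, parts mk y M h ∈ Sigma.mk (hs.family h) ''
            Set.univ.pi fun f => A (hs.glue.holeFace (mk.mem y) h f)} := by
  ext M
  constructor
  · rintro ⟨σ, hσ, rfl⟩
    refine ⟨⟨hs, ?_⟩, fun h => ?_⟩
    · rw [Set.mem_preimage, restrict_of_sub (M := ⟨m, σ⟩) hs]
      exact fun f _ => hσ _ trivial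
    · rw [parts_of_sub (M := ⟨m, σ⟩) hs]
      exact ⟨_, fun f _ => hσ _ trivial, rfl⟩
  · rintro ⟨⟨hM, hr⟩, hb⟩
    obtain ⟨m', σ⟩ := M
    have hm : m' = m := by
      refine (Sub.isGluing (show Sub mk y m' from hM)).unique ?_
      have : (Sub.family (show Sub mk y m' from hM)) = hs.family := by
        funext h
        obtain ⟨s, -, hs'⟩ := hb h
        rw [parts_of_sub (M := ⟨m', σ⟩) hM] at hs'
        exact (congrArg Sigma.fst hs').symm
      rw [this]
      exact hs.isGluing
    subst hm
    refine ⟨σ, fun f _ => ?_, rfl⟩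
    obtain ⟨x, rfl⟩ := (hs.glue.faceEquiv (mk.mem y)).surjective f
    rcases x with f | ⟨h, f⟩
    · rw [Set.mem_preimage, restrict_of_sub (M := ⟨m', σ⟩) hs] at hr
      exact hr f trivial
    · obtain ⟨s, hs1, hs2⟩ := hb h
      rw [parts_of_sub (M := ⟨m', σ⟩) hs] at hs2
      have hs3 := eq_of_heq (Sigma.mk.inj hs2).2
      subst hs3
      exact hs1 f trivial

/-- A measure that is dominated by the law of the Boltzmann decorated map and has the Markov
property at `y` has a density that depends on the restriction to `y` only. -/
theorem HasMarkov.exists_density [SigmaFinite μ] [IsFiniteMeasure (decBoltzmann q β μ N b)]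
    (hκ : κ ≤ decBoltzmann q β μ N b) (hsub : κ {M | Sub mk y M.1}ᶜ = 0)
    (h : HasMarkov mk q β μ b κ y) :
    ∃ g : (y.InnerFace → EuclideanSpace ℝ (Fin k)) → ℝ≥0∞, Measurable g ∧
      κ = ((decBoltzmann q β μ N b).restrict {M | Sub mk y M.1}).withDensity
        fun M => g (restrict mk y M) := by
  have hS := measurableSet_sub (k := k) mk y
  have hr := measurable_restrict (k := k) mk y
  have : IsFiniteMeasure κ := isFiniteMeasure_of_le _ hκ
  have hself : ∀ κ' : Measure (DecMap k), κ' {M | Sub mk y M.1}ᶜ = 0 →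
      κ'.restrict {M | Sub mk y M.1} = κ' := fun κ' h0 =>
    Measure.restrict_eq_self_of_ae_mem (mem_ae_iff.2 h0)
  have hle : κ ≤ (decBoltzmann q β μ N b).restrict {M | Sub mk y M.1} := by
    rw [← hself κ hsub]
    exact Measure.restrict_mono le_rfl hκ
  -- The density compares the laws of the restriction to `y` only. The conditional law of the parts,
  -- common to both measures, does the rest.
  set ρ := ((decBoltzmann q β μ N b).restrict {M | Sub mk y M.1}).map (restrict mk y) with hρ
  have hac : κ.map (restrict mk y) ≪ ρ := (Measure.map_mono hle hr).absolutelyContinuous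
  refine ⟨(κ.map (restrict mk y)).rnDeriv ρ, Measure.measurable_rnDeriv _ _, ?_⟩
  have hg : Measurable ((κ.map (restrict mk y)).rnDeriv ρ) := Measure.measurable_rnDeriv _ _
  have hdens := Measure.withDensity_rnDeriv_eq _ _ hac
  generalize (κ.map (restrict mk y)).rnDeriv ρ = g at hg hdens
  have hnull : ((decBoltzmann q β μ N b).restrict {M | Sub mk y M.1}).withDensity
      (fun M => g (restrict mk y M)) {M | Sub mk y M.1}ᶜ = 0 :=
    withDensity_absolutelyContinuous _ _ (by
      rw [Measure.restrict_apply hS.compl]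
      simp)
  refine ext_sigma_of_box fun m A hA => ?_
  by_cases hs : Sub mk y m
  · rw [image_box_of_sub hs A]
    have hC : MeasurableSet (Set.univ.pi fun f => A (hs.glue.outerFace (mk.mem y) f)) :=
      MeasurableSet.univ_pi fun f => hA _
    have hB : ∀ h, MeasurableSet (Sigma.mk (hs.family h) ''
        Set.univ.pi fun f => A (hs.glue.holeFace (mk.mem y) h f) : Set (DecMap k)) := fun h =>
      (measurableEmbedding_sigmaMk _).measurableSet_image.2
        (MeasurableSet.univ_pi fun f => hA _)
    generalize (Set.univ.pi fun f => A (hs.glue.outerFace (mk.mem y) f)) = C at hC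
    set B : y.Hole → Set (DecMap k) := fun h => Sigma.mk (hs.family h) ''
        Set.univ.pi fun f => A (hs.glue.holeFace (mk.mem y) h f)
    change κ ({M | Sub mk y M.1} ∩ restrict mk y ⁻¹' C ∩ {M | ∀ h, parts mk y M h ∈ B h})
      = (((decBoltzmann q β μ N b).restrict {M | Sub mk y M.1}).withDensity
          fun M => g (restrict mk y M)) ({M | Sub mk y M.1} ∩ restrict mk y ⁻¹' C ∩ {M | ∀ h, parts mk y M h ∈ B h})
    rw [h C hC B hB, hasMarkov_withDensity (Sub.refl mk y) hg C hC B hB]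
    have hmap : κ.map (restrict mk y) = (((decBoltzmann q β μ N b).restrict
        {M | Sub mk y M.1}).withDensity fun M => g (restrict mk y M)).map (restrict mk y) := by
      rw [← hdens]
      ext s hs
      rw [withDensity_apply _ hs, Measure.map_apply hr hs, withDensity_apply _ (hr hs),
        setLIntegral_map hs hg hr]
    have hint : ∀ κ' : Measure (DecMap k), κ' {M | Sub mk y M.1}ᶜ = 0 →
        ∫⁻ M in {M | Sub mk y M.1} ∩ restrict mk y ⁻¹' C,
          holesLaw mk q β μ y b B (restrict mk y M) ∂κ'
        = ∫⁻ τ in C, holesLaw mk q β μ y b B τ ∂(κ'.map (restrict mk y)) := by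
      intro κ' h0
      rw [setLIntegral_map hC (measurable_holesLaw b hB) hr, Set.inter_comm,
        ← Measure.restrict_restrict (hr hC),
        hself κ' h0]
    rw [hint _ hsub, hint, hmap]
    exact hnull
  · have hd : ∀ κ' : Measure (DecMap k), κ' {M | Sub mk y M.1}ᶜ = 0 →
        κ' (Sigma.mk m '' Set.univ.pi A) = 0 := fun κ' h0 => measure_mono_null (by
      rintro _ ⟨σ, -, rfl⟩
      exact hs) h0
    rw [hd κ hsub, hd _ hnull]

/-- The step that allows exploration beyond `y`: written as a density in the restriction to `y`, the
measure keeps the Markov property at every larger map. -/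
theorem HasMarkov.of_sub [SigmaFinite μ] [IsFiniteMeasure (decBoltzmann q β μ N b)]
    (hκ : κ ≤ decBoltzmann q β μ N b) (hsub : κ {M | Sub mk y M.1}ᶜ = 0)
    (h : HasMarkov mk q β μ b κ y) (hyp : Sub mk y p) : HasMarkov mk q β μ b κ p := by
  obtain ⟨g, hg, rfl⟩ := h.exists_density hκ hsub
  exact hasMarkov_withDensity hyp hg

/-- Two finite measures agree on the σ-algebra generated by a variable `t` and a discrete
variable `Z` with a distinguished value `none`, if they agree on the events `t ∈ C` and on the
events `t ∈ C` and `Z = some y`. -/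
theorem measure_eq_of_forall_some {Ω α ι : Type*} [MeasurableSpace Ω] [MeasurableSpace α]
    [Countable ι] {L R : Measure Ω} [IsFiniteMeasure L] {t : Ω → α}
    (ht : Measurable t) {Z : Ω → Option ι} (hZ : ∀ o, MeasurableSet (Z ⁻¹' {o}))
    (h : ∀ C, MeasurableSet C → L (t ⁻¹' C) = R (t ⁻¹' C))
    (hs : ∀ C, MeasurableSet C → ∀ i, L (t ⁻¹' C ∩ Z ⁻¹' {some i}) = R (t ⁻¹' C ∩ Z ⁻¹' {some i}))
    {D : Option ι → Set α} (hD : ∀ o, MeasurableSet (D o)) :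
    L {ω | t ω ∈ D (Z ω)} = R {ω | t ω ∈ D (Z ω)} := by
  -- The value `none` is the complement of countably many values. The subtraction requires the
  -- finiteness of `L`.
  have hn : ∀ C, MeasurableSet C →
      L (t ⁻¹' C ∩ Z ⁻¹' {none}) = R (t ⁻¹' C ∩ Z ⁻¹' {none}) := by
    intro C hC
    have heq : Z ⁻¹' {none} = (⋃ i, Z ⁻¹' {some i})ᶜ := by
      ext ω
      cases hω : Z ω <;> simp [hω]
    have hdec : ∀ κ : Measure Ω, κ (t ⁻¹' C ∩ ⋃ i, Z ⁻¹' {some i})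
        = ∑' i, κ (t ⁻¹' C ∩ Z ⁻¹' {some i}) := by
      intro κ
      rw [Set.inter_iUnion, measure_iUnion]
      · intro i j hij
        refine Set.disjoint_left.2 fun ω h1 h2 => hij ?_
        exact Option.some_injective _ (h1.2.symm.trans h2.2)
      · exact fun i => (ht hC).inter (hZ _)
    have hU : L (t ⁻¹' C ∩ ⋃ i, Z ⁻¹' {some i}) = R (t ⁻¹' C ∩ ⋃ i, Z ⁻¹' {some i}) := by
      rw [hdec, hdec]
      exact tsum_congr (hs C hC)
    have hUm : MeasurableSet (⋃ i, Z ⁻¹' {some i}) := MeasurableSet.iUnion fun i => hZ _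
    have h1 := measure_inter_add_sdiff (μ := L) (t ⁻¹' C) hUm
    have h2 := measure_inter_add_sdiff (μ := R) (t ⁻¹' C) hUm
    rw [h C hC, hU, ← h2] at h1
    rw [heq, ← Set.sdiff_eq]
    refine (ENNReal.add_right_inj ?_).1 h1
    rw [← hU]
    exact measure_ne_top _ _
  have hdec : ∀ κ : Measure Ω, κ {ω | t ω ∈ D (Z ω)} = ∑' o, κ (t ⁻¹' D o ∩ Z ⁻¹' {o}) := by
    intro κ
    have : {ω | t ω ∈ D (Z ω)} = ⋃ o, (t ⁻¹' D o ∩ Z ⁻¹' {o}) := by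
      ext ω
      simp
    rw [this, measure_iUnion]
    · intro i j hij
      exact Set.disjoint_left.2 fun ω h1 h2 => hij (h1.2.symm.trans h2.2)
    · exact fun o => (ht (hD o)).inter (hZ o)
  rw [hdec, hdec]
  refine tsum_congr fun o => ?_
  cases o with
  | none => exact hn _ (hD _)
  | some i => exact hs _ (hD _) i

end HasMarkov
end QuadHoles

namespace QuadHoles
open LMap

/-! ### The filtration of a local map -/

section LocalData

variable {Ω : Type*} {k : ℕ} {mk : Marking} {M : Ω → DecMap k} {Y : Ω → QH}

/-- What is known about a local map after the exploration of `p`. -/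
noncomputable def localData (mk : Marking) (M : Ω → DecMap k) (Y : Ω → QH) (p : QH) (ω : Ω) :
    ∀ r : {r // Sub mk r p}, Prop × (r.1.InnerFace → EuclideanSpace ℝ (Fin k)) × Prop :=
  fun r => (Sub mk r.1 (M ω).1, restrict mk r.1 (M ω), Sub mk (Y ω) r.1)

-- `localData` lists all `r` below `p` so that it increases with `p`. On the event that `p` is
-- contained in the map, the restrictions to `r` follow from the one to `p`, and the events about
-- `Y` follow from its value when it is below `p`.
open Classical in
theorem exists_localData_eq (p : QH) : ∃ Φ : (p.InnerFace → EuclideanSpace ℝ (Fin k)) →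
      Option QH → ∀ r : {r // Sub mk r p}, Prop × (r.1.InnerFace → EuclideanSpace ℝ (Fin k)) × Prop,
    (∀ o, Measurable fun τ => Φ τ o) ∧ ∀ ω, Sub mk p (M ω).1 → localData mk M Y p ω
      = Φ (restrict mk p (M ω)) (if Sub mk (Y ω) p then some (Y ω) else none) := by
  choose f hf hfM using fun r : {r // Sub mk r p} => exists_restrict_eq (k := k) r.2
  refine ⟨fun τ o r => (True, f r τ, ∃ y, o = some y ∧ Sub mk y r.1), fun o => ?_, fun ω hω => ?_⟩
  · exact measurable_pi_lambda _ fun r => measurable_const.prodMk ((hf r).prodMk measurable_const)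
  · funext r
    refine Prod.ext (propext ⟨fun _ => trivial, fun _ => r.2.trans hω⟩)
      (Prod.ext (hfM r _ hω) (propext ⟨fun hr => ⟨Y ω, if_pos (hr.trans r.2), hr⟩, ?_⟩))
    rintro ⟨y, hy, hyr⟩
    split_ifs at hy with hs
    · change Sub mk (Y ω) r.1
      rw [Option.some_injective _ hy]
      exact hyr

end LocalData

section LocalMap

variable {Ω : Type*} [mΩ : MeasurableSpace Ω] {P : Measure Ω} {k : ℕ} {mk : Marking} {q β : ℝ}
  {μ : Measure (EuclideanSpace ℝ (Fin k))} {ℓ : ℕ} {b : Fin (2 * ℓ) → EuclideanSpace ℝ (Fin k)}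
  {M : Ω → DecMap k} {Y : Ω → QH}

theorem measurable_holesLaw_restrict [SigmaFinite μ] {p : QH} {N : ℕ}
    (b : Fin N → EuclideanSpace ℝ (Fin k)) {B : p.Hole → Set (DecMap k)}
    (hB : ∀ h, MeasurableSet (B h)) :
    Measurable fun M : DecMap k => holesLaw mk q β μ p b B (restrict mk p M) :=
  (measurable_holesLaw b hB).comp (measurable_restrict mk p)

theorem IsLocalMap.measurable_right (h : IsLocalMap P mk q β μ ℓ b M Y) : Measurable Y := by
  obtain ⟨-, T, U, hT, -⟩ := h
  exact measurable_sigma_fst.comp hT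

theorem IsLocalMap.ae_sub (h : IsLocalMap P mk q β μ ℓ b M Y) :
    ∀ᵐ ω ∂P, Sub mk (Y ω) (M ω).1 := by
  obtain ⟨-, T, U, -, hTU, -⟩ := h
  filter_upwards [hTU] with ω hω using hω.sub

/-- The hypothesis is tested on `Y = y` with `T` in `C`, the sets at maps other than `y` being
trivial. By uniqueness of decorated gluings, `T` and `U` are almost surely the restriction and the
parts. -/
theorem IsLocalMap.hasMarkov [SigmaFinite μ] (h : IsLocalMap P mk q β μ ℓ b M Y) (y : QH) :
    HasMarkov mk q β μ b ((P.restrict (Y ⁻¹' {y})).map M) y := by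
  classical
  have hY : MeasurableSet (Y ⁻¹' {y}) := h.measurable_right trivial
  obtain ⟨⟨hM, -⟩, T, U, hT, hTU, hmain⟩ := h
  intro C hC B hB
  have hSC : MeasurableSet ({M : DecMap k | Sub mk y M.1} ∩ restrict mk y ⁻¹' C) :=
    (measurableSet_sub mk y).inter (measurable_restrict mk y hC)
  have hcomap : MeasurableSet[MeasurableSpace.comap (fun ω => (⟨Y ω, T ω⟩ : DecMap k))
      inferInstance] ((fun ω => (⟨Y ω, T ω⟩ : DecMap k)) ⁻¹' (Sigma.mk y '' C)) :=
    ⟨_, (measurableEmbedding_sigmaMk y).measurableSet_image.2 hC, rfl⟩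
  have hB' : ∀ p h, MeasurableSet
      (Function.update (β := fun p : QH => p.Hole → Set (DecMap k)) (fun _ _ => Set.univ) y B
        p h) := by
    intro p h
    by_cases hp : p = y
    · subst hp
      rw [Function.update_self]
      exact hB h
    · rw [Function.update_of_ne hp]
      exact MeasurableSet.univ
  have key := hmain _ hcomap _ hB'
  set B' := Function.update (β := fun p : QH => p.Hole → Set (DecMap k)) (fun _ _ => Set.univ) y B
    with hB'def
  have hBy : B' y = B := Function.update_self ..
  have hset : ((fun ω => (⟨Y ω, T ω⟩ : DecMap k)) ⁻¹' (Sigma.mk y '' C) : Set Ω)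
      =ᵐ[P] (M ⁻¹' ({M : DecMap k | Sub mk y M.1} ∩ restrict mk y ⁻¹' C) ∩ Y ⁻¹' {y} : Set Ω) := by
    filter_upwards [hTU] with ω hω
    refine propext ?_
    change (⟨Y ω, T ω⟩ : DecMap k) ∈ Sigma.mk y '' C
      ↔ (Sub mk y (M ω).1 ∧ restrict mk y (M ω) ∈ C) ∧ Y ω = y
    have hs := hω.sub
    rw [hω.unique.1]
    clear hω
    generalize Y ω = p at hs
    constructor
    · rintro ⟨τ, hτ, heq⟩
      cases heq
      exact ⟨⟨hs, hτ⟩, rfl⟩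
    · rintro ⟨⟨-, hc⟩, rfl⟩
      exact ⟨_, hc, rfl⟩
  have hpart : ({ω | ∀ h, U ω h ∈ B' (Y ω) h} : Set Ω)
      =ᵐ[P] {ω | ∀ h, parts mk (Y ω) (M ω) h ∈ B' (Y ω) h} := by
    filter_upwards [hTU] with ω hω
    refine propext ?_
    change (∀ h, U ω h ∈ B' (Y ω) h) ↔ _
    rw [hω.unique.2]
    rfl
  rw [measure_congr (hset.inter hpart), setLIntegral_congr hset] at key
  rw [Measure.map_apply hM (hSC.inter (measurableSet_parts hB)),
    Measure.restrict_apply (hM (hSC.inter (measurableSet_parts hB))),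
    setLIntegral_map hSC (measurable_holesLaw_restrict b hB) hM,
    Measure.restrict_restrict (hM hSC)]
  refine Eq.trans (congrArg P ?_) (key.trans (setLIntegral_congr_fun_ae ((hM hSC).inter hY) ?_))
  · ext ω
    constructor
    · rintro ⟨⟨h1, h2⟩, h3⟩
      refine ⟨⟨h1, h3⟩, ?_⟩
      have h3' : Y ω = y := h3
      change ∀ h, parts mk (Y ω) (M ω) h ∈ B' (Y ω) h
      rw [h3', hBy]
      exact h2
    · rintro ⟨⟨h1, h3⟩, h2⟩
      refine ⟨⟨h1, ?_⟩, h3⟩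
      have h3' : Y ω = y := h3
      change ∀ h, parts mk (Y ω) (M ω) h ∈ B' (Y ω) h at h2
      rw [h3', hBy] at h2
      exact h2
  · filter_upwards [hTU] with ω hω hωy
    have h3 : Y ω = y := hωy.2
    change holesLaw mk q β μ (Y ω) b (B' (Y ω)) (T ω) = _
    rw [hω.unique.1, h3, hBy]

theorem HasMarkov.measure_inter_eq [SigmaFinite μ] {p : QH} (hM : Measurable M) {G : Set Ω}
    (h : HasMarkov mk q β μ b ((P.restrict G).map M) p)
    {C : Set (p.InnerFace → EuclideanSpace ℝ (Fin k))} (hC : MeasurableSet C)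
    {B : p.Hole → Set (DecMap k)} (hB : ∀ h, MeasurableSet (B h)) :
    P (((fun ω => restrict mk p (M ω)) ⁻¹' C ∩ G) ∩ {ω | Sub mk p (M ω).1}
        ∩ {ω | ∀ h, parts mk p (M ω) h ∈ B h})
      = ∫⁻ ω in ((fun ω => restrict mk p (M ω)) ⁻¹' C ∩ G) ∩ {ω | Sub mk p (M ω).1},
          holesLaw mk q β μ p b B (restrict mk p (M ω)) ∂P := by
  have hSC : MeasurableSet ({M : DecMap k | Sub mk p M.1} ∩ restrict mk p ⁻¹' C) :=
    (measurableSet_sub mk p).inter (measurable_restrict mk p hC)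
  have key := h C hC B hB
  rw [Measure.map_apply hM (hSC.inter (measurableSet_parts hB)),
    Measure.restrict_apply (hM (hSC.inter (measurableSet_parts hB))),
    setLIntegral_map hSC (measurable_holesLaw_restrict b hB) hM,
    Measure.restrict_restrict (hM hSC)] at key
  have h1 : ((fun ω => restrict mk p (M ω)) ⁻¹' C ∩ G) ∩ {ω | Sub mk p (M ω).1}
      = M ⁻¹' ({M : DecMap k | Sub mk p M.1} ∩ restrict mk p ⁻¹' C) ∩ G := by
    ext ω
    constructor
    · exact fun h => ⟨⟨h.2, h.1.1⟩, h.1.2⟩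
    · exact fun h => ⟨⟨h.1.2, h.2⟩, h.1.1⟩
  rw [h1, ← key]
  congr 1
  ext ω
  constructor
  · exact fun h => ⟨⟨h.1.1, h.2⟩, h.1.2⟩
  · exact fun h => ⟨⟨h.1.1, h.2⟩, h.1.2⟩

/-- The complete filtration generated by a local map. -/
@[reducible] noncomputable def localFiltration (P : Measure Ω) (mk : Marking) (M : Ω → DecMap k) (Y : Ω → QH)
    (p : QH) : MeasurableSpace Ω :=
  eventuallyMeasurableSpace (MeasurableSpace.comap (localData mk M Y p) inferInstance) (ae P) ⊓ mΩ

theorem measurable_localData (hM : Measurable M) (hY : Measurable Y) (p : QH) :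
    Measurable (localData mk M Y p) := by
  refine measurable_pi_lambda _ fun r => ?_
  refine Measurable.prodMk ?_ (Measurable.prodMk ((measurable_restrict mk r.1).comp hM) ?_)
  · exact measurableSet_setOfPred.1 (hM (measurableSet_sub mk r.1))
  · exact measurableSet_setOfPred.1 (hY (show MeasurableSet {y | Sub mk y r.1} from trivial))

theorem measurableSet_localFiltration {p : QH} {A : Set Ω} :
    MeasurableSet[localFiltration P mk M Y p] A ↔
      (∃ V, MeasurableSet V ∧ A =ᵐ[P] localData mk M Y p ⁻¹' V) ∧ MeasurableSet A := by
  refine MeasurableSpace.measurableSet_inf.trans ?_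
  refine and_congr_left fun _ => ⟨?_, ?_⟩
  · rintro ⟨_, ⟨V, hV, rfl⟩, hA⟩
    exact ⟨V, hV, hA⟩
  · rintro ⟨V, hV, hA⟩
    exact ⟨_, ⟨V, hV, rfl⟩, hA⟩

/-- The data at `p` are a subfamily of the data at a larger `p'`, by transitivity of inclusion. -/
theorem isFiltration_localFiltration : IsFiltration mk (localFiltration P mk M Y) where
  le p := inf_le_right
  mono p p' hp A (hA : MeasurableSet[localFiltration P mk M Y p] A) := by
    rw [measurableSet_localFiltration] at hA ⊢
    obtain ⟨⟨V, hV, hAV⟩, hA⟩ := hA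
    let proj : (∀ r : {r // Sub mk r p'}, Prop × (r.1.InnerFace → EuclideanSpace ℝ (Fin k)) × Prop)
        → ∀ r : {r // Sub mk r p}, Prop × (r.1.InnerFace → EuclideanSpace ℝ (Fin k)) × Prop :=
      fun x r => x ⟨r.1, r.2.trans hp⟩
    have hproj : Measurable proj := measurable_pi_lambda _ fun r => measurable_pi_apply _
    exact ⟨⟨proj ⁻¹' V, hproj hV, hAV⟩, hA⟩

theorem isCompleteFiltration_localFiltration :
    IsCompleteFiltration P (localFiltration P mk M Y) := fun _ _ hA h0 =>
  measurableSet_localFiltration.2 ⟨⟨∅, MeasurableSet.empty, ae_eq_empty.2 h0⟩, hA⟩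

theorem measurable_localData_localFiltration (hM : Measurable M) (hY : Measurable Y) (p : QH) :
    Measurable[localFiltration P mk M Y p] (localData mk M Y p) := fun V hV =>
  measurableSet_localFiltration.2 ⟨⟨V, hV, Filter.EventuallyEq.rfl⟩,
    measurable_localData hM hY p hV⟩

theorem measurable_localData_apply (hM : Measurable M) (hY : Measurable Y) (p : QH) :
    Measurable[localFiltration P mk M Y p]
      (fun ω => localData mk M Y p ω ⟨p, Sub.refl mk p⟩) :=
  (measurable_pi_apply _).comp (measurable_localData_localFiltration hM hY p)

/-- A local map is a Boltzmann decorated map for its filtration. -/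
theorem IsLocalMap.isFDecBoltzmann [IsProbabilityMeasure P] [SigmaFinite μ]
    (h : IsLocalMap P mk q β μ ℓ b M Y) :
    IsFDecBoltzmann P mk (localFiltration P mk M Y) q β μ ℓ b M where
  boltzmann := h.1
  adapted p := by
    exact (@measurableSet_setOfPred _ (localFiltration P mk M Y p) _).2 (measurable_fst.comp
      (measurable_localData_apply h.1.1 h.measurable_right p))
  increments p := by
    classical
    have hM : Measurable M := h.1.1
    have hY := h.measurable_right
    have hlaw : P.map M = decBoltzmann q β μ (2 * ℓ) b := h.1.2
    have : IsFiniteMeasure (decBoltzmann q β μ (2 * ℓ) b) := by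
      rw [← hlaw]
      infer_instance
    refine ⟨fun ω => restrict mk p (M ω), fun ω => parts mk p (M ω),
      fun ω hω => isDecGluing_restrict_parts hω, fun ω hω => restrict_of_not_sub hω,
      measurable_fst.comp (measurable_snd.comp (measurable_localData_apply hM hY p)), ?_⟩
    intro A hA B hB
    set S : Set Ω := {ω | Sub mk p (M ω).1} with hS
    have hSm : MeasurableSet S := hM (measurableSet_sub mk p)
    -- The two sides of the Markov identity, as measures of the conditioning event. Both live on
    -- `S`, where `A` is almost surely an event about `t` and `Z`.
    set L := P.restrict (S ∩ {ω | ∀ h, parts mk p (M ω) h ∈ B h}) with hL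
    set R := (P.restrict S).withDensity
      fun ω => holesLaw mk q β μ p b B (restrict mk p (M ω)) with hR
    set t : Ω → p.InnerFace → EuclideanSpace ℝ (Fin k) := fun ω => restrict mk p (M ω) with ht
    have htm : Measurable t := (measurable_restrict mk p).comp hM
    set Z : Ω → Option QH := fun ω => if Sub mk (Y ω) p then some (Y ω) else none with hZ
    obtain ⟨⟨V, hV, hAV⟩, hAm⟩ := measurableSet_localFiltration.1 hA
    obtain ⟨Φ, hΦ, hΦM⟩ := exists_localData_eq (mk := mk) (M := M) (Y := Y) p
    have hLapp : ∀ D, MeasurableSet D →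
        L D = P (D ∩ S ∩ {ω | ∀ h, parts mk p (M ω) h ∈ B h}) := fun D hD => by
      rw [hL, Measure.restrict_apply hD, Set.inter_assoc]
    have hRapp : ∀ D, MeasurableSet D →
        R D = ∫⁻ ω in D ∩ S, holesLaw mk q β μ p b B (restrict mk p (M ω)) ∂P := fun D hD => by
      rw [hR, withDensity_apply _ hD, Measure.restrict_restrict hD]
    have hRS : R ≪ P.restrict S := withDensity_absolutelyContinuous _ _
    have hLS : L ≪ P.restrict S :=
      (Measure.restrict_mono Set.inter_subset_left le_rfl).absolutelyContinuous
    have hae : ∀ κ : Measure Ω, κ ≪ P.restrict S → κ A = κ {ω | t ω ∈ {τ | Φ τ (Z ω) ∈ V}} := by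
      intro κ hκ
      refine measure_congr ?_
      have h1 : A =ᵐ[κ] localData mk M Y p ⁻¹' V :=
        (hκ.trans Measure.restrict_le_self.absolutelyContinuous).ae_eq hAV
      refine h1.trans ?_
      filter_upwards [hκ.ae_le (ae_restrict_mem hSm)] with ω hω
      refine propext ?_
      change localData mk M Y p ω ∈ V ↔ Φ _ _ ∈ V
      rw [hΦM ω hω]
    change P (A ∩ S ∩ _) = ∫⁻ ω in A ∩ S, holesLaw mk q β μ p b B (restrict mk p (M ω)) ∂P
    rw [← hLapp A hAm, ← hRapp A hAm, hae L hLS, hae R hRS]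
    have hYm : ∀ y, MeasurableSet (Y ⁻¹' {y}) := fun y => hY trivial
    -- Two families of events remain: those about the restriction to `p`, by the Markov property of
    -- the Boltzmann law, and those with in addition `Y = y`, by the local map property at `y`
    -- extended to `p`.
    refine measure_eq_of_forall_some (D := fun o => {τ | Φ τ o ∈ V}) htm (Z := Z) (fun o => ?_)
      (fun C hC => ?_) (fun C hC y => ?_) fun o => hΦ o hV
    · exact hY (show MeasurableSet {y | (if Sub mk y p then some y else none) = o} from trivial)
    · have hm := hasMarkov_decBoltzmann (mk := mk) (q := q) (β := β) (μ := μ) (b := b) (p := p)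
      rw [← hlaw, ← Measure.restrict_univ (μ := P)] at hm
      have h1 := hm.measure_inter_eq hM hC hB
      rw [Set.inter_univ] at h1
      rw [hLapp _ (htm hC), hRapp _ (htm hC)]
      exact h1
    · by_cases hyp : Sub mk y p
      · have hZy : Z ⁻¹' {some y} = Y ⁻¹' {y} := by
          ext ω
          change (if Sub mk (Y ω) p then some (Y ω) else none) = some y ↔ Y ω = y
          constructor
          · intro hω
            split_ifs at hω
            exact Option.some_injective _ hω
          · rintro rfl
            exact if_pos hyp
        have hle : (P.restrict (Y ⁻¹' {y})).map M ≤ decBoltzmann q β μ (2 * ℓ) b := by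
          rw [← hlaw]
          exact Measure.map_mono Measure.restrict_le_self hM
        have h0 : (P.restrict (Y ⁻¹' {y})).map M {M | Sub mk y M.1}ᶜ = 0 := by
          have hSy := (measurableSet_sub (k := k) mk y).compl
          rw [Measure.map_apply hM hSy, Measure.restrict_apply (hM hSy)]
          refine measure_mono_null ?_ h.ae_sub
          rintro ω ⟨h1, h2⟩ h3
          have h2' : Y ω = y := h2
          change Sub mk (Y ω) (M ω).1 at h3
          rw [h2'] at h3
          exact h1 h3
        have h1 := ((h.hasMarkov y).of_sub hle h0 hyp).measure_inter_eq hM hC hB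
        rw [hZy, hLapp _ ((htm hC).inter (hYm y)), hRapp _ ((htm hC).inter (hYm y))]
        exact h1
      · have hZy : Z ⁻¹' {some y} = ∅ := by
          refine Set.eq_empty_of_forall_notMem fun ω hω => ?_
          change (if Sub mk (Y ω) p then some (Y ω) else none) = some y at hω
          split_ifs at hω with hs
          rw [Option.some_injective _ hω] at hs
          exact hyp hs
        rw [hZy, Set.inter_empty, measure_empty, measure_empty]

theorem IsLocalMap.isStoppingMap (h : IsLocalMap P mk q β μ ℓ b M Y) :
    IsStoppingMap P mk (localFiltration P mk M Y) (fun ω => (M ω).1) Y where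
  sub := h.ae_sub
  measurable p := by
    exact (@measurableSet_setOfPred _ (localFiltration P mk M Y p) _).2 (measurable_snd.comp (measurable_snd.comp
      (measurable_localData_apply h.1.1 h.measurable_right p)))

end LocalMap
end QuadHoles

namespace QuadHoles
open LMap

/-! ### Decorations with values in a point -/

section Trivial

variable {q β : ℝ} {N : ℕ}

/-- In dimension zero all energies vanish and the decoration is unique, so only the law of the
undecorated map is left. -/
theorem decBoltzmann_dirac (b : Fin N → EuclideanSpace ℝ (Fin 0)) :
    decBoltzmann q β (Measure.dirac 0) N b
      = (boltzmann q N).map fun m => (⟨m, 0⟩ : DecMap 0) := by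
  classical
  have hι : Measurable fun m : QH => (⟨m, 0⟩ : DecMap 0) := fun _ _ => trivial
  have hen : ∀ (m : QH) σ, energy β m b σ = 0 := by
    intro m σ
    have h0 : ∀ x : EuclideanSpace ℝ (Fin 0), ‖x‖ = 0 := fun x => by
      rw [Subsingleton.elim x 0, norm_zero]
    simp [energy, h0]
  have hpi : ∀ m : QH, (Measure.pi fun _ : m.InnerFace =>
      (Measure.dirac 0 : Measure (EuclideanSpace ℝ (Fin 0)))) = Measure.dirac 0 := by
    intro m
    ext s hs
    rcases s.eq_empty_or_nonempty with rfl | hne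
    · simp
    · rw [Subsingleton.eq_univ_of_nonempty hne]
      simp
  have hw : decWeight q β (Measure.dirac 0) N b
      = (Measure.sum fun m : QH => if m.IsQuad N then
          ENNReal.ofReal q ^ Fintype.card m.InnerFace • Measure.dirac m else 0).map
          fun m => (⟨m, 0⟩ : DecMap 0) := by
    rw [decWeight, Measure.map_sum hι.aemeasurable]
    congr 1
    funext m
    split_ifs
    · rw [hpi, Measure.map_smul, Measure.map_dirac' hι]
      congr 1
      simp only [hen, neg_zero, Real.exp_zero, ENNReal.ofReal_one]
      rw [show (fun _ : m.InnerFace → EuclideanSpace ℝ (Fin 0) => (1 : ℝ≥0∞)) = 1 from rfl,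
        withDensity_one, Measure.map_dirac' (measurable_sigmaMk m)]
    · rw [Measure.map_zero]
  rw [decBoltzmann_eq, hw, boltzmann, normalize, Measure.map_smul,
    Measure.map_apply hι MeasurableSet.univ]
  rfl

theorem decBoltzmann_dirac_apply (b : Fin N → EuclideanSpace ℝ (Fin 0)) {B : Set (DecMap 0)}
    (hB : MeasurableSet B) :
    decBoltzmann q β (Measure.dirac 0) N b B = boltzmann q N {m | (⟨m, 0⟩ : DecMap 0) ∈ B} := by
  have hι : Measurable fun m : QH => (⟨m, 0⟩ : DecMap 0) := fun _ _ => trivial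
  rw [decBoltzmann_dirac, Measure.map_apply hι hB]
  rfl

variable {Ω : Type*} [mΩ : MeasurableSpace Ω] {P : Measure Ω} {mk : Marking} {ℓ : ℕ}
  {X Y : Ω → QH}

theorem isLocalMap_of_markovDecomposition (hY : Measurable Y) (hX : IsBoltzmann P q ℓ X)
    (h : MarkovDecomposition P mk q (MeasurableSpace.comap Y inferInstance) X Y) :
    IsLocalMap (k := 0) P mk q β (Measure.dirac 0) ℓ 0 (fun ω => ⟨X ω, 0⟩) Y := by
  have hι : Measurable fun m : QH => (⟨m, 0⟩ : DecMap 0) := fun _ _ => trivial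
  obtain ⟨U, hU, hmain⟩ := h
  refine ⟨⟨hι.comp hX.1, ?_⟩, fun ω => 0, fun ω h => ⟨U ω h, 0⟩, hι.comp hY, ?_, ?_⟩
  · rw [decBoltzmann_dirac, ← hX.2, Measure.map_map hι hX.1]
    rfl
  · filter_upwards [hU] with ω hω
    exact ⟨hω.some, fun d _ => Subsingleton.elim _ _, fun h d _ => Subsingleton.elim _ _⟩
  · intro A hA B hB
    have hA' : MeasurableSet[MeasurableSpace.comap Y inferInstance] A := by
      obtain ⟨s, hs, rfl⟩ := hA
      exact ⟨(fun m : QH => (⟨m, 0⟩ : DecMap 0)) ⁻¹' s, hι hs, rfl⟩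
    have key := hmain A hA' fun p h => {m | (⟨m, 0⟩ : DecMap 0) ∈ B p h}
    simp only [decBoltzmann_dirac_apply _ (hB _ _)]
    exact key

theorem IsFDecBoltzmann.isFBoltzmann {F : QH → MeasurableSpace Ω}
    {b : Fin (2 * ℓ) → EuclideanSpace ℝ (Fin 0)} (hX : IsBoltzmann P q ℓ X)
    (h : IsFDecBoltzmann (k := 0) P mk F q β (Measure.dirac 0) ℓ b fun ω => ⟨X ω, 0⟩) :
    IsFBoltzmann P mk F q ℓ X where
  boltzmann := hX
  adapted := h.adapted
  increments p := by
    obtain ⟨T, U, hTU, -, -, hmain⟩ := h.increments p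
    refine ⟨fun ω h => (U ω h).1, fun ω hω => ?_, fun A hA B => ?_⟩
    · obtain ⟨g, -⟩ := hTU ω hω
      exact ⟨g⟩
    · have hB : ∀ h, MeasurableSet (Sigma.fst ⁻¹' B h : Set (DecMap 0)) := fun h =>
        measurable_sigma_fst (show MeasurableSet (B h) from trivial)
      have key := hmain A hA (fun h => Sigma.fst ⁻¹' B h) hB
      simp only [decBoltzmann_dirac_apply _ (hB _)] at key
      refine key.trans ?_
      rw [lintegral_const, Measure.restrict_apply_univ, mul_comm]
      rfl

end Trivial
end QuadHoles

/-! ### The three statements together -/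

open QuadHoles in
theorem theoremt {Ω : Type*} [MeasurableSpace Ω] (P : MeasureTheory.Measure Ω)
    [MeasureTheory.IsProbabilityMeasure P] (mk : Marking) (q : ℝ) (hq : 0 < q) (ℓ : ℕ) :
    -- strong Markov property
    (∀ (F : QH → MeasurableSpace Ω) (X Y : Ω → QH), IsFiltration mk F →
      IsFBoltzmann P mk F q ℓ X → ∀ hY : IsStoppingMap P mk F X Y,
        Measurable[hY.sigma] Y ∧
        MarkovDecomposition P mk q hY.sigma X Y ∧
        MarkovDecomposition P mk q (MeasurableSpace.comap Y inferInstance) X Y) ∧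
    -- converse, without decoration
    (∀ X Y : Ω → QH, Measurable Y → IsBoltzmann P q ℓ X →
      MarkovDecomposition P mk q (MeasurableSpace.comap Y inferInstance) X Y →
        ∃ F : QH → MeasurableSpace Ω, IsFiltration mk F ∧ IsCompleteFiltration P F ∧
          IsFBoltzmann P mk F q ℓ X ∧ IsStoppingMap P mk F X Y) ∧
    -- converse, with decoration
    (∀ (k : ℕ) (β : ℝ) (μ : MeasureTheory.Measure (EuclideanSpace ℝ (Fin k)))
      [MeasureTheory.SigmaFinite μ] (b : Fin (2 * ℓ) → EuclideanSpace ℝ (Fin k))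
      (M : Ω → DecMap k) (Y : Ω → QH), 0 < β → IsLocalMap P mk q β μ ℓ b M Y →
        ∃ F : QH → MeasurableSpace Ω, IsFiltration mk F ∧ IsCompleteFiltration P F ∧
          IsFDecBoltzmann P mk F q β μ ℓ b M ∧
          IsStoppingMap P mk F (fun ω => (M ω).1) Y) := by
  refine ⟨fun F X Y hF hX hY => ?_, fun X Y hY hX h => ?_, fun k β μ _ b M Y _ h => ?_⟩
  · have hYm := hY.measurable_sigma hF
    have hdec := markovDecomposition_of_isStoppingMap hF hX hY
    exact ⟨hYm, hdec, hdec.mono hYm.comap_le⟩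
  -- The value of `β` is immaterial, the energy of decorations in `ℝ ^ 0` being zero.
  · have hl := isLocalMap_of_markovDecomposition (β := 1) hY hX h
    exact ⟨_, isFiltration_localFiltration, isCompleteFiltration_localFiltration,
      hl.isFDecBoltzmann.isFBoltzmann hX, hl.isStoppingMap⟩
  · exact ⟨_, isFiltration_localFiltration, isCompleteFiltration_localFiltration,
      h.isFDecBoltzmann, h.isStoppingMap⟩
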